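/- **Theorem 3.** *Data.* The observed data of a cluster are $\mathbf O=(\mathbf Y,\mathbf A,\mathbf X,N)$ with cluster size $N\ge 1$, outcomes $\mathbf Y\in\mathbb R^{N}$, treatments $\mathbf A\in\mathcal A(N)=\{0,1\}^N$ and covariates $\mathbf X\in\mathbb R^{N\times d}$. Let $\mathbf O_1,\mathbf O_2,\dots$ be i.i.d. from $\mathbb P$. Assume $\mathbb P(N\le n_{\max})=1$ for some $n_{\max}\in\mathbb N$, and $|\mathbb E(Y_j^q\mid\mathbf A,\mathbf X,N)|\le B$ for all units $j$ and all $q\le 4$, for some $B<\infty$ (with $\mathbb E Y_j^4<\infty$). Write $\|\cdot\|_2$ for the Euclidean norm, $\|f\|_{L_2(\mathbb P)}=\{\int f(\mathbf o)^2d\mathbb P(\mathbf o)\}^{1/2}$, where an estimated $f$ is treated as fixed, and $$G(\mathbf a,\mathbf x,n)=\mathbb E(\mathbf Y\mid\mathbf A=\mathbf a,\mathbf X=\mathbf x,N=n),\qquad H(\mathbf a,\mathbf x,n)=\mathbb P(\mathbf A=\mathbf a\mid\mathbf X=\mathbf x,N=n).$$ *Target.* Let $w(\mathbf a,\mathbf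 x,n)=w(\mathbf a,\mathbf x,n;\mathbb P)\in\mathbb R^n$ be a weight function, which may depend on the distribution of the data, and let $$\Psi(w)=\Psi(w;\mathbb P)=\mathbb E\Big\{\sum_{\mathbf a\in\mathcal A(N)}w(\mathbf a,\mathbf X,N)^\top G(\mathbf a,\mathbf X,N)\Big\}.$$ For a bounded measurable score $g$ with $\mathbb E\,g(\mathbf O)=0$ let $d\mathbb P_\varepsilon=(1+\varepsilon g)\,d\mathbb P$ be the submodel with score $g$. Let $\phi(\mathbf a',\mathbf x,n;\mathbf a)\in\mathbb R^n$ be such that $\{\mathbb 1(\mathbf X=\mathbf x,N=n)/d\mathbb P(\mathbf x,n)\}\,\phi(\mathbf A,\mathbf X,N;\mathbf a)$ is the efficient influence function of $w(\mathbf a,\mathbf x,n)$ at $\mathbb P$. This means that $\mathbb E\{\phi(\mathbf A,\mathbf X,N;\mathbf a)\mid\mathbf X=\mathbf x,N=n\}=0$ and that, for every score $g$, $\varepsilon\mapsto w(\mathbf a,\mathbf x,n;\mathbb P_\varepsilon)$ has the derivative $\mathbb E\{\phi(\mathbf A,\mathbf X,N;\mathbf a)g(\mathbf O)\mid\mathbf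 X=\mathbf x,N=n\}$ at $\varepsilon=0$, in the sense of $L_1(\mathbb P)$, summed over $\mathbf a$, as functions of $(\mathbf X,N)$. With $\boldsymbol\eta=(G,H,w,\phi)$ put $$\varphi(\mathbf O;\boldsymbol\eta)=\sum_{\mathbf a\in\mathcal A(N)}\{w(\mathbf a,\mathbf X,N)+\phi(\mathbf A,\mathbf X,N;\mathbf a)\}^\top G(\mathbf a,\mathbf X,N)+\frac{w(\mathbf A,\mathbf X,N)^\top\{\mathbf Y-G(\mathbf A,\mathbf X,N)\}}{H(\mathbf A,\mathbf X,N)},\qquad \varphi^*(\mathbf O)=\varphi(\mathbf O;\boldsymbol\eta)-\Psi(w).$$ *Estimator.* For each $m$, the clusters $1,\dots,m$ are split at random into $K\ge1$ groups, $K$ fixed. Let $S_i$ be the group of cluster $i$ and $m_k$ the size of group $k$. The split, and a random seed that the training methods may use, are independent of the data, and $m_k/m\to 1/K$ in probability for each $k$. For each $k$, $\widehat{\boldsymbol\eta}^{(-k)}=(\widehat G^{(-k)},\widehat H^{(-k)},\widehat w^{(-k)},\widehat\phi^{(-k)})$ is computed from the split, the seed and the clusters outside of group $k$. The cross-fitted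 nonparametric sample splitting (NSS) estimator is $$\widehat\Psi(w)=\frac1K\sum_{k=1}^K\frac1{m_k}\sum_{i:\,S_i=k}\varphi(\mathbf O_i;\widehat{\boldsymbol\eta}^{(-k)}).$$ *Assumptions.* There are constants $c\in(0,1)$, $C\in(0,\infty)$ and positive sequences $r_G,r_H,r_\phi,r_w$ (in $m$) such that, for all $m$ and $k$, almost surely, for all $\mathbf a,\mathbf a'\in\mathcal A(n)$ and almost all $(\mathbf x,n)$ under the law of $(\mathbf X,N)$: - (B1) $H(\mathbf a,\mathbf x,n)$ and $\widehat H^{(-k)}(\mathbf a,\mathbf x,n)$ lie in $(c,1-c)$; - (B2) $\|G(\mathbf a,\mathbf x,n)\|_2\le C$ and $\|\widehat G^{(-k)}(\mathbf a,\mathbf x,n)\|_2\le C$; - (B3) $\|\phi(\mathbf a',\mathbf x,n;\mathbf a)\|_2\le C$ and $\|\widehat\phi^{(-k)}(\mathbf a',\mathbf x,n;\mathbf a)\|_2\le C$; - (B4) $\|w(\mathbf a,\mathbf x,n)\|_2\le C$ and $\|\widehat w^{(-k)}(\mathbf a,\mathbf x,n)\|_2\le C$; and, for each $k$, as $m\to\infty$,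 - (B5) $\big\|\sum_{\mathbf a\in\mathcal A(N)}|(\widehat H^{(-k)}-H)(\mathbf a,\mathbf X,N)|\big\|_{L_2(\mathbb P)}=O_{\mathbb P}(r_H)$; - (B6) $\big\|\sum_{\mathbf a\in\mathcal A(N)}\|(\widehat G^{(-k)}-G)(\mathbf a,\mathbf X,N)\|_2\big\|_{L_2(\mathbb P)}=O_{\mathbb P}(r_G)$; - (B7) $\big\|\sum_{\mathbf a\in\mathcal A(N)}\|(\widehat\phi^{(-k)}-\phi)(\mathbf A,\mathbf X,N;\mathbf a)\|_2\big\|_{L_2(\mathbb P)}=O_{\mathbb P}(r_\phi)$; - (B8) $\big\|\sum_{\mathbf a\in\mathcal A(N)}\|(\widehat w^{(-k)}-w)(\mathbf a,\mathbf X,N)+\sum_{\mathbf a'\in\mathcal A(N)}\widehat\phi^{(-k)}(\mathbf a',\mathbf X,N;\mathbf a)H(\mathbf a',\mathbf X,N)\|_2\big\|_{L_2(\mathbb P)}=O_{\mathbb P}(r_w^2)$. *Conclusion.* If (i) $r_G$, $r_H$ and $r_\phi$ are each $o(1)$, (ii) $r_w=o(m^{-1/4})$ and (iii) $r_G(r_H+r_\phi)=o(m^{-1/2})$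 as $m\to\infty$, then $\varphi^*(\mathbf O)$ is square integrable and $$\sqrt m\,\{\widehat\Psi(w)-\Psi(w)\}\overset{d}{\to}N(0,\sigma^2(w)),\qquad \sigma^2(w)=\mathbb E\{\varphi^*(\mathbf O)^2\}.$$ Moreover, $\sigma^2(w)$ is the nonparametric efficiency bound of $\Psi(w)$ at $\mathbb P$: for every score $g$ the map $\varepsilon\mapsto\Psi(w;\mathbb P_\varepsilon)$ is differentiable at $0$, and $\sigma^2(w)$ is the supremum of the Cramér–Rao bounds $\{\partial_\varepsilon\Psi(w;\mathbb P_\varepsilon)|_{\varepsilon=0}\}^2/\mathbb E\{g(\mathbf O)^2\}$ over all scores $g$ with $\mathbb E\{g(\mathbf O)^2\}>0$. -/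

import Mathlib

open MeasureTheory ProbabilityTheory Filter Topology Asymptotics
open scoped ENNReal

noncomputable section

/-! ### Clustered data -/

/-- Treatment vectors of a cluster of size `n` (`true` is treated, `false` is untreated). -/
abbrev Treat (n : ℕ) : Type := Fin n → Bool

/-- Covariate arrays of a cluster of size `n`, with `d` covariates per unit. -/
abbrev Cov (d n : ℕ) : Type := Fin n → Fin d → ℝ

/-- Observed data `O = (Y, A, X, N)` of one cluster, as a dependent tuple `⟨N, (Y, A, X)⟩`. -/
abbrev Obs (d : ℕ) : Type := Σ n : ℕ, EuclideanSpace ℝ (Fin n) × Treat n × Cov d n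

namespace Obs

variable {d : ℕ}

/-- The cluster size `N`. -/
def N (o : Obs d) : ℕ := o.1

/-- The outcome vector `Y`. -/
def Y (o : Obs d) : EuclideanSpace ℝ (Fin o.N) := o.2.1

/-- The treatment vector `A`. -/
def A (o : Obs d) : Treat o.N := o.2.2.1

/-- The covariates `X`. -/
def X (o : Obs d) : Cov d o.N := o.2.2.2

/-- `(A, X, N)`. -/
def AXN (o : Obs d) : Σ n : ℕ, Treat n × Cov d n := ⟨o.N, o.A, o.X⟩

/-- `(X, N)`. -/
def XN (o : Obs d) : Σ n : ℕ, Cov d n := ⟨o.N, o.X⟩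

/-- `(A, N)`. -/
def AN (o : Obs d) : Σ n : ℕ, Treat n := ⟨o.N, o.A⟩

/-- The outcome of unit `j`, extended by `0` to `j ≥ N`. -/
def unitY (j : ℕ) (o : Obs d) : ℝ := if h : j < o.N then o.Y ⟨j, h⟩ else 0

theorem measurable_of_sigma {β : Type*} [MeasurableSpace β] {f : Obs d → β}
    (h : ∀ n, Measurable fun z : EuclideanSpace ℝ (Fin n) × Treat n × Cov d n => f ⟨n, z⟩) :
    Measurable f := by
  intro s hs
  rw [MeasurableSpace.measurableSet_iInf]
  exact fun n => h n hs

theorem measurable_AXN : Measurable (AXN (d := d)) := by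
  refine measurable_of_sigma fun n s hs => ?_
  have h : MeasurableSet (Sigma.mk n ⁻¹' s) := MeasurableSpace.measurableSet_iInf.1 hs n
  change MeasurableSet (Prod.snd ⁻¹' (Sigma.mk n ⁻¹' s))
  exact measurable_snd h

theorem measurable_XN : Measurable (XN (d := d)) := by
  refine measurable_of_sigma fun n s hs => ?_
  have h : MeasurableSet (Sigma.mk n ⁻¹' s) := MeasurableSpace.measurableSet_iInf.1 hs n
  change MeasurableSet (Prod.snd ⁻¹' (Prod.snd ⁻¹' (Sigma.mk n ⁻¹' s)))
  exact measurable_snd (measurable_snd h)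

end Obs

/-! ### Conditional expectations given `(A, X, N)` and given `(X, N)` -/

section Conditional

variable {d : ℕ}

/-- `E_Q {f(O) | A = a, X = x, N = n}`: the conditional expectation given the σ-algebra generated by
`(A, X, N)`, which does not depend on the outcome, read off at `(a, x, n)`. -/
def condAXN (Q : Measure (Obs d)) (f : Obs d → ℝ) (n : ℕ) (a : Treat n) (x : Cov d n) : ℝ :=
  (Q[f | MeasurableSpace.comap Obs.AXN inferInstance]) ⟨n, 0, a, x⟩

/-- `E_Q {f(O) | X = x, N = n}`: the conditional expectation given the σ-algebra generated by
`(X, N)`, which does not depend on the outcome and the treatment, read off at `(x, n)`. -/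
def condXN (Q : Measure (Obs d)) (f : Obs d → ℝ) (n : ℕ) (x : Cov d n) : ℝ :=
  (Q[f | MeasurableSpace.comap Obs.XN inferInstance]) ⟨n, 0, fun _ => false, x⟩

/-- Outcome regression `G(a, x, n) = E_Q(Y | A = a, X = x, N = n)`. -/
def outcomeReg (Q : Measure (Obs d)) (n : ℕ) (a : Treat n) (x : Cov d n) :
    EuclideanSpace ℝ (Fin n) :=
  WithLp.toLp 2 fun j => condAXN Q (Obs.unitY j) n a x

/-- Treatment probability `H(a, x, n) = Q(A = a | X = x, N = n)`. -/
def treatProb (Q : Measure (Obs d)) (n : ℕ) (a : Treat n) (x : Cov d n) : ℝ :=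
  condXN Q (Set.indicator {o | o.AN = ⟨n, a⟩} 1) n x

end Conditional

/-! ### Nuisance functions, estimand and uncentered influence function -/

/-- Vector valued functions of `(a, x, n)`. -/
abbrev VecFun (d : ℕ) : Type :=
  (n : ℕ) → Treat n → Cov d n → EuclideanSpace ℝ (Fin n)

/-- Functions `φ(a', x, n; a)`; the arguments are taken in the order `n, a', x, a`. -/
abbrev PhiFun (d : ℕ) : Type :=
  (n : ℕ) → Treat n → Cov d n → Treat n → EuclideanSpace ℝ (Fin n)

/-- A quadruple `η = (G, H, w, φ)`. -/
structure Nuisance (d : ℕ) where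
  G : VecFun d
  H : (n : ℕ) → Treat n → Cov d n → ℝ
  w : VecFun d
  φ : PhiFun d

section Estimand

variable {d : ℕ}

/-- `φ(O; η) = ∑_a {w(a,X,N) + φ(A,X,N;a)}ᵀ G(a,X,N) + w(A,X,N)ᵀ {Y - G(A,X,N)} / H(A,X,N)`. -/
def uncenteredEIF (η : Nuisance d) (o : Obs d) : ℝ :=
  ∑ a : Treat o.N, inner ℝ (η.w o.N a o.X + η.φ o.N o.A o.X a) (η.G o.N a o.X)
    + inner ℝ (η.w o.N o.A o.X) (o.Y - η.G o.N o.A o.X) / η.H o.N o.A o.X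

/-- `Ψ(w; Q) = E_Q {∑_a w(a, X, N; Q)ᵀ E_Q(Y | A = a, X, N)}`, where the weight may itself depend on
the distribution `Q`. -/
def estimand (w : Measure (Obs d) → VecFun d) (Q : Measure (Obs d)) : ℝ :=
  ∫ o, ∑ a : Treat o.N, inner ℝ (w Q o.N a o.X) (outcomeReg Q o.N a o.X) ∂Q

/-- The true nuisance functions at `P`. -/
def trueNuisance (P : Measure (Obs d)) (w : Measure (Obs d) → VecFun d) (φ : PhiFun d) :
    Nuisance d :=
  ⟨outcomeReg P, treatProb P, w P, φ⟩

/-- `φ*(O; η) = φ(O; η) - Ψ(w)` at the true `η`. -/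
def centeredEIF (P : Measure (Obs d)) (w : Measure (Obs d) → VecFun d) (φ : PhiFun d)
    (o : Obs d) : ℝ :=
  uncenteredEIF (trueNuisance P w φ) o - estimand w P

/-- `σ²(w) = E {φ*(O; η)²}`. -/
def asympVar (P : Measure (Obs d)) (w : Measure (Obs d) → VecFun d) (φ : PhiFun d) : ℝ :=
  ∫ o, centeredEIF P w φ o ^ 2 ∂P

end Estimand

/-! ### Submodels, influence function of the weight, efficiency bound -/

section Efficiency

variable {d : ℕ}

/-- Bounded scores of the nonparametric model at `P`: bounded functions of mean zero. They are
dense in the tangent space, which consists of all mean zero functions in `L²(P)`. -/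
def IsScore (P : Measure (Obs d)) (g : Obs d → ℝ) : Prop :=
  Measurable g ∧ (∃ M : ℝ, ∀ o, |g o| ≤ M) ∧ ∫ o, g o ∂P = 0

/-- The one-dimensional submodel `dP_ε = (1 + ε g) dP`, with score `g` at `ε = 0`. It is a
probability measure for `ε` near `0`. -/
def submodel (P : Measure (Obs d)) (g : Obs d → ℝ) (ε : ℝ) : Measure (Obs d) :=
  P.withDensity fun o => ENNReal.ofReal (1 + ε * g o)

/-- `E {φ(A, X, N; a) g(O) | X = x, N = n}
  = ∑_{a'} φ(a', x, n; a) E {1(A = a') g(O) | X = x, N = n}`. -/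
def condPhiScore (P : Measure (Obs d)) (φ : PhiFun d) (g : Obs d → ℝ)
    (n : ℕ) (a : Treat n) (x : Cov d n) : EuclideanSpace ℝ (Fin n) :=
  ∑ a' : Treat n, condXN P (Set.indicator {o | o.AN = ⟨n, a'⟩} g) n x • φ n a' x a

/-- The efficient influence function at `P` of the map `Q ↦ w(a, x, n; Q)` is
`{1(X = x, N = n) / dP(x, n)} φ(A, X, N; a)`. That is, it has mean zero, and the derivative of
`ε ↦ w(a, x, n; P_ε)` at `0` is `E {φ(A, X, N; a) g(O) | X = x, N = n}` along every submodel. As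
point values given a continuous `X` are not determined by `Q`, the derivative is that of a curve in
`L¹(P)`. -/
structure IsWeightEIF (P : Measure (Obs d)) (w : Measure (Obs d) → VecFun d) (φ : PhiFun d) :
    Prop where
  mean_zero : ∀ᵐ o ∂P, ∀ a : Treat o.N,
    ∑ a' : Treat o.N, treatProb P o.N a' o.X • φ o.N a' o.X a = 0
  derivative : ∀ g, IsScore P g →
    Tendsto (fun ε : ℝ => ∫⁻ o, ∑ a : Treat o.N,
        ‖ε⁻¹ • (w (submodel P g ε) o.N a o.X - w P o.N a o.X) - condPhiScore P φ g o.N a o.X‖ₑ ∂P)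
      (𝓝[≠] 0) (𝓝 0)

/-- `V` is the nonparametric efficiency bound at `P` for estimating `Ψ`: the functional is
differentiable along every submodel, and `V` is the supremum over all submodels of the
Cramér–Rao bounds `(d Ψ(P_ε) / dε |_{ε = 0})² / E {g(O)²}`. -/
structure IsEfficiencyBound (Ψ : Measure (Obs d) → ℝ) (P : Measure (Obs d)) (V : ℝ) : Prop where
  differentiable : ∀ g, IsScore P g → DifferentiableAt ℝ (fun ε => Ψ (submodel P g ε)) 0
  isLUB : IsLUB {b : ℝ | ∃ g, IsScore P g ∧ 0 < ∫ o, g o ^ 2 ∂P ∧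
    b = deriv (fun ε => Ψ (submodel P g ε)) 0 ^ 2 / ∫ o, g o ^ 2 ∂P} V

end Efficiency

/-! ### Cross-fitting -/

/-- Training rules. For sample size `m`, group `k` and split `s`, the rule returns estimators of the
nuisance functions computed from a random seed and from the clusters outside of group `k`. -/
abbrev Learner (d K : ℕ) (U : Type*) : Type _ :=
  (m : ℕ) → (k : Fin K) → (s : Fin m → Fin K) → U → ({i : Fin m // s i ≠ k} → Obs d) → Nuisance d

section CrossFit

variable {d K : ℕ} {U : Type*}

/-- Joint measurability of the fitted functions in the seed, the training data and the argument. -/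
structure Learner.IsMeasurable [MeasurableSpace U] (L : Learner d K U) : Prop where
  G : ∀ m k s n a, Measurable fun z : U × ({i : Fin m // s i ≠ k} → Obs d) × Cov d n =>
    (L m k s z.1 z.2.1).G n a z.2.2
  H : ∀ m k s n a, Measurable fun z : U × ({i : Fin m // s i ≠ k} → Obs d) × Cov d n =>
    (L m k s z.1 z.2.1).H n a z.2.2
  w : ∀ m k s n a, Measurable fun z : U × ({i : Fin m // s i ≠ k} → Obs d) × Cov d n =>
    (L m k s z.1 z.2.1).w n a z.2.2
  φ : ∀ m k s n a a', Measurable fun z : U × ({i : Fin m // s i ≠ k} → Obs d) × Cov d n =>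
    (L m k s z.1 z.2.1).φ n a' z.2.2 a

/-- The estimator `η̂^(-k)` from a sample `D` of `m` clusters. -/
def fitted (L : Learner d K U) {m : ℕ} (s : Fin m → Fin K) (u : U) (D : Fin m → Obs d)
    (k : Fin K) : Nuisance d :=
  L m k s u fun i => D i

/-- The group size `m_k`. -/
def groupSize {m : ℕ} (s : Fin m → Fin K) (k : Fin K) : ℕ :=
  (Finset.univ.filter fun i => s i = k).card

/-- The estimator `Ψ̂(w) = K⁻¹ ∑_k m_k⁻¹ ∑_{i : S_i = k} φ(O_i; η̂^(-k))`. -/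
def crossFit (L : Learner d K U) {m : ℕ} (s : Fin m → Fin K) (u : U) (D : Fin m → Obs d) : ℝ :=
  (1 / (K : ℝ)) * ∑ k : Fin K, (1 / (groupSize s k : ℝ)) *
    ∑ i ∈ Finset.univ.filter (fun i => s i = k), uncenteredEIF (fitted L s u D k) (D i)

end CrossFit

/-! ### Bounds and rates -/

section Rates

variable {d : ℕ}

/-- `X_m = O_P(r_m)` for nonnegative `X_m`. -/
def IsBigOP {Ω : Type*} [MeasurableSpace Ω] (μ : Measure Ω) (X : ℕ → Ω → ℝ≥0∞) (r : ℕ → ℝ) :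
    Prop :=
  ∀ δ : ℝ, 0 < δ → ∃ M : ℝ, ∀ᶠ m in atTop,
    μ {ω | ENNReal.ofReal (M * r m) < X m ω} ≤ ENNReal.ofReal δ

/-- Bounds on `η = (G, H, w, φ)` for all treatment vectors and `P`-almost all `(x, n)`. -/
def Nuisance.IsBounded (P : Measure (Obs d)) (c C : ℝ) (η : Nuisance d) : Prop :=
  ∀ᵐ o ∂P, ∀ a a' : Treat o.N,
    (c < η.H o.N a o.X ∧ η.H o.N a o.X < 1 - c) ∧ ‖η.G o.N a o.X‖ ≤ C ∧
    ‖η.φ o.N a' o.X a‖ ≤ C ∧ ‖η.w o.N a o.X‖ ≤ C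

/-- `‖∑_a |(Ĥ - H)(a, X, N)|‖` in `L²(P)`, with `Ĥ` treated as fixed. -/
def errH (P : Measure (Obs d)) (η' η : Nuisance d) : ℝ≥0∞ :=
  eLpNorm (fun o => ∑ a : Treat o.N, |η'.H o.N a o.X - η.H o.N a o.X|) 2 P

/-- `‖∑_a ‖(Ĝ - G)(a, X, N)‖₂‖` in `L²(P)`. -/
def errG (P : Measure (Obs d)) (η' η : Nuisance d) : ℝ≥0∞ :=
  eLpNorm (fun o => ∑ a : Treat o.N, ‖η'.G o.N a o.X - η.G o.N a o.X‖) 2 P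

/-- `‖∑_a ‖(φ̂ - φ)(A, X, N; a)‖₂‖` in `L²(P)`. -/
def errPhi (P : Measure (Obs d)) (η' η : Nuisance d) : ℝ≥0∞ :=
  eLpNorm (fun o => ∑ a : Treat o.N, ‖η'.φ o.N o.A o.X a - η.φ o.N o.A o.X a‖) 2 P

/-- `‖∑_a ‖(ŵ - w)(a, X, N) + ∑_{a'} φ̂(a', X, N; a) H(a', X, N)‖₂‖` in `L²(P)`. -/
def errW (P : Measure (Obs d)) (η' η : Nuisance d) : ℝ≥0∞ :=
  eLpNorm (fun o => ∑ a : Treat o.N,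
    ‖(η'.w o.N a o.X - η.w o.N a o.X)
      + ∑ a' : Treat o.N, η.H o.N a' o.X • η'.φ o.N a' o.X a‖) 2 P

end Rates

end

/-!
# Asymptotic normality and efficiency of the cross-fitted NSS estimator

Write `d = φ(·; η̂) - φ(·; η)` for the error of the fitted influence function of a group. Then
`√m (Ψ̂ - Ψ)` is the normalized sum `m^{-1/2} ∑ φ*(O_i)`, to which the central limit theorem applies,
plus remainders that vanish in probability (`isLittleOP_crossFit_sub`).

* *Centred fitted part.* Given the seed and the clusters outside of a group, the clusters of the
  group are still i.i.d. from `P`, so by Chebyshev's inequality the sum of `d - E d` over the group is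
  of the order of its conditional standard deviation (`isLittleOP_sum_group`). This is negligible
  since `E d²` tends to zero (`lintegral_influence_sub_sq_le`): `d` is Lipschitz in the nuisance
  functions with a constant linear in `1 + ‖Y‖`, and given `(A, X, N)` the outcomes have bounded
  second moments. The error of `w` alone is not among the assumed rates; it is controlled by its
  corrected error and the error of `φ`, because `φ` has conditional mean zero.
* *Unequal group sizes.* The weight `√m / (K m_k)` of an observation differs from `m^{-1/2}` by a
  factor that tends to one in probability; the same Chebyshev argument applies to `φ*`.
* *Bias.* Replacing `Y` by `G` and averaging over the treatment, the mean of `φ(·; η̂)` differs from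
  `Ψ` by the corrected error of `w`, of order `r_w²`, and by products of errors, of order
  `r_G r_H` and `r_G r_φ` (`abs_conditional_bias_le`, `enorm_bias_le`). All are `o(m^{-1/2})`.

For the efficiency bound, Bayes' formula (`condAXN_submodel`) gives the derivative of the outcome
regression along the submodel with score `g`. With the assumed derivative of the weight, the product
rule gives the derivative of the estimand (`hasDerivAt_estimand`), which is the inner product of `g`
with `φ*` (`integral_estimandScore`). The Cramér–Rao bounds are then at most `E (φ*)²` by the
Cauchy–Schwarz inequality, and bounded truncations of `φ*`, recentred, are scores whose bounds
approach it (`isLUB_cramerRao`).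
-/

/-! ### Measurability on the space of clusters -/

section Measurability

variable {d : ℕ}

theorem Obs.measurable_mk (n : ℕ) :
    Measurable fun z : EuclideanSpace ℝ (Fin n) × Treat n × Cov d n => (⟨n, z⟩ : Obs d) :=
  fun _ hs => MeasurableSpace.measurableSet_iInf.1 hs n

theorem Obs.measurable_N : Measurable (Obs.N (d := d)) :=
  Obs.measurable_of_sigma fun _ => measurable_const

theorem Obs.measurableSet_AN (n : ℕ) (a : Treat n) :
    MeasurableSet {o : Obs d | o.AN = ⟨n, a⟩} := by
  rw [MeasurableSpace.measurableSet_iInf]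
  intro k
  change MeasurableSet {z : EuclideanSpace ℝ (Fin k) × Treat k × Cov d k |
    (⟨k, z.2.1⟩ : Σ n, Treat n) = ⟨n, a⟩}
  by_cases h : k = n
  · subst h
    have : {z : EuclideanSpace ℝ (Fin k) × Treat k × Cov d k |
        (⟨k, z.2.1⟩ : Σ n, Treat n) = ⟨k, a⟩} = (fun z => z.2.1) ⁻¹' {a} := by
      ext z; simp
    rw [this]
    exact (measurable_fst.comp measurable_snd) (measurableSet_singleton a)
  · convert MeasurableSet.empty
    ext z
    simp [h]

/-- Measurability of a function of a parameter and a cluster can be checked for each size. -/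
theorem Obs.measurable_prod {Z β : Type*} [MeasurableSpace Z] [MeasurableSpace β]
    {f : Z × Obs d → β}
    (h : ∀ n, Measurable fun z : Z × (EuclideanSpace ℝ (Fin n) × Treat n × Cov d n) =>
      f (z.1, ⟨n, z.2⟩)) :
    Measurable f := by
  classical
  -- retractions of the sigma type onto its fibres
  let r : (n : ℕ) → Obs d → EuclideanSpace ℝ (Fin n) × Treat n × Cov d n :=
    fun n o => if e : o.1 = n then e ▸ o.2 else (0, fun _ => false, 0)
  have hr : ∀ n, Measurable (r n) := by
    intro n
    refine Obs.measurable_of_sigma fun k => ?_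
    by_cases e : k = n
    · subst e
      simpa [r] using measurable_id'
    · simp [r, e]
  intro t ht
  have : f ⁻¹' t = ⋃ n, ({p : Z × Obs d | p.2.N = n} ∩
      (fun p : Z × Obs d => f (p.1, ⟨n, r n p.2⟩)) ⁻¹' t) := by
    ext ⟨z, k, y⟩
    simp [Obs.N, r]
  rw [this]
  refine MeasurableSet.iUnion fun n => MeasurableSet.inter ?_ ?_
  · exact (Obs.measurable_N.comp measurable_snd) (measurableSet_singleton n)
  · exact ((h n).comp (measurable_fst.prodMk ((hr n).comp measurable_snd))) ht

theorem measurable_comp_axn {Z β : Type*} [MeasurableSpace Z] [MeasurableSpace β]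
    {F : Z → (n : ℕ) → Treat n → Cov d n → β}
    (hF : ∀ n a, Measurable fun p : Z × Cov d n => F p.1 n a p.2) :
    Measurable fun p : Z × Obs d => F p.1 p.2.N p.2.A p.2.X := by
  refine Obs.measurable_prod fun n => ?_
  have : Measurable fun q : Treat n × (Z × Cov d n) => F q.2.1 n q.1 q.2.2 :=
    measurable_from_prod_countable_right fun a => hF n a
  exact this.comp (f := fun z : Z × (EuclideanSpace ℝ (Fin n) × Treat n × Cov d n) =>
    (z.2.2.1, (z.1, z.2.2.2))) (by fun_prop)

theorem measurable_axn {β : Type*} [MeasurableSpace β]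
    {F : (n : ℕ) → Treat n → Cov d n → β} (hF : ∀ n a, Measurable (F n a)) :
    Measurable fun o : Obs d => F o.N o.A o.X :=
  (measurable_comp_axn (Z := Unit) (F := fun _ => F)
    fun n a => (hF n a).comp measurable_snd).comp (measurable_const (a := ()).prodMk measurable_id)

/-- Joint measurability in a parameter and the covariates of the four nuisance functions. -/
structure NuisanceMeasurable {Z : Type*} [MeasurableSpace Z] (η : Z → Nuisance d) : Prop where
  G : ∀ n a, Measurable fun p : Z × Cov d n => (η p.1).G n a p.2
  H : ∀ n a, Measurable fun p : Z × Cov d n => (η p.1).H n a p.2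
  w : ∀ n a, Measurable fun p : Z × Cov d n => (η p.1).w n a p.2
  φ : ∀ n a a', Measurable fun p : Z × Cov d n => (η p.1).φ n a' p.2 a

theorem NuisanceMeasurable.comp {Z Z' : Type*} [MeasurableSpace Z] [MeasurableSpace Z']
    {η : Z → Nuisance d} (h : NuisanceMeasurable η) {f : Z' → Z} (hf : Measurable f) :
    NuisanceMeasurable (η ∘ f) where
  G n a := (h.G n a).comp (f := fun p : Z' × Cov d n => (f p.1, p.2)) (by fun_prop)
  H n a := (h.H n a).comp (f := fun p : Z' × Cov d n => (f p.1, p.2)) (by fun_prop)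
  w n a := (h.w n a).comp (f := fun p : Z' × Cov d n => (f p.1, p.2)) (by fun_prop)
  φ n a a' := (h.φ n a a').comp (f := fun p : Z' × Cov d n => (f p.1, p.2)) (by fun_prop)

theorem NuisanceMeasurable.measurable_uncenteredEIF {Z : Type*} [MeasurableSpace Z]
    {η : Z → Nuisance d} (h : NuisanceMeasurable η) :
    Measurable fun p : Z × Obs d => uncenteredEIF (η p.1) p.2 := by
  refine Obs.measurable_prod fun n => ?_
  have : Measurable fun q : Treat n × (Z × EuclideanSpace ℝ (Fin n) × Cov d n) =>
      uncenteredEIF (η q.2.1) ⟨n, q.2.2.1, q.1, q.2.2.2⟩ := by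
    refine measurable_from_prod_countable_right fun a => ?_
    change Measurable fun q : Z × EuclideanSpace ℝ (Fin n) × Cov d n =>
      ∑ b : Treat n, inner ℝ ((η q.1).w n b q.2.2 + (η q.1).φ n a q.2.2 b) ((η q.1).G n b q.2.2)
        + inner ℝ ((η q.1).w n a q.2.2) (q.2.1 - (η q.1).G n a q.2.2) / (η q.1).H n a q.2.2
    have hp : Measurable fun q : Z × EuclideanSpace ℝ (Fin n) × Cov d n => (q.1, q.2.2) := by
      fun_prop
    have hy : Measurable fun q : Z × EuclideanSpace ℝ (Fin n) × Cov d n => q.2.1 := by fun_prop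
    refine Measurable.add (Finset.measurable_sum _ fun b _ => ?_) (Measurable.div ?_ ?_)
    · exact (((h.w n b).comp hp).add ((h.φ n b a).comp hp)).inner ((h.G n b).comp hp)
    · exact ((h.w n a).comp hp).inner (hy.sub ((h.G n a).comp hp))
    · exact (h.H n a).comp hp
  exact this.comp (f := fun z : Z × (EuclideanSpace ℝ (Fin n) × Treat n × Cov d n) =>
    (z.2.2.1, (z.1, z.2.1, z.2.2.2))) (by fun_prop)

end Measurability

/-! ### Conditional expectations as functions of the conditioning variables -/

section CondExp

variable {d : ℕ}

/-- A function that is measurable for the σ-algebra generated by `T` is constant on the fibres of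
`T`. Hence conditional expectations may be read off at an arbitrary point of the fibre. -/
theorem eq_of_measurable_comap {α β : Type*} [MeasurableSpace β] {T : α → β} {f : α → ℝ}
    (hf : Measurable[MeasurableSpace.comap T inferInstance] f) {x y : α} (h : T x = T y) :
    f x = f y := by
  obtain ⟨s, -, hs⟩ := hf (measurableSet_singleton (f y))
  have hy : y ∈ T ⁻¹' s := by rw [hs]; rfl
  have hx : x ∈ T ⁻¹' s := by rw [Set.mem_preimage, h]; exact hy
  rw [hs] at hx
  exact hx

theorem comap_AXN_le : MeasurableSpace.comap (Obs.AXN (d := d)) inferInstance ≤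
    (inferInstance : MeasurableSpace (Obs d)) :=
  Obs.measurable_AXN.comap_le

theorem comap_XN_le : MeasurableSpace.comap (Obs.XN (d := d)) inferInstance ≤
    (inferInstance : MeasurableSpace (Obs d)) :=
  Obs.measurable_XN.comap_le

theorem condAXN_apply (Q : Measure (Obs d)) (f : Obs d → ℝ) (o : Obs d) :
    condAXN Q f o.N o.A o.X = (Q[f | MeasurableSpace.comap Obs.AXN inferInstance]) o :=
  eq_of_measurable_comap stronglyMeasurable_condExp.measurable rfl

theorem condXN_apply (Q : Measure (Obs d)) (f : Obs d → ℝ) (o : Obs d) :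
    condXN Q f o.N o.X = (Q[f | MeasurableSpace.comap Obs.XN inferInstance]) o :=
  eq_of_measurable_comap stronglyMeasurable_condExp.measurable rfl

theorem measurable_condAXN (Q : Measure (Obs d)) (f : Obs d → ℝ) (n : ℕ) (a : Treat n) :
    Measurable (condAXN Q f n a) :=
  (stronglyMeasurable_condExp.measurable.mono comap_AXN_le le_rfl).comp
    ((Obs.measurable_mk n).comp (by fun_prop : Measurable fun x : Cov d n =>
      ((0 : EuclideanSpace ℝ (Fin n)), a, x)))

theorem measurable_condXN (Q : Measure (Obs d)) (f : Obs d → ℝ) (n : ℕ) :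
    Measurable (condXN Q f n) :=
  (stronglyMeasurable_condExp.measurable.mono comap_XN_le le_rfl).comp
    ((Obs.measurable_mk n).comp (by fun_prop : Measurable fun x : Cov d n =>
      ((0 : EuclideanSpace ℝ (Fin n)), (fun _ => false : Treat n), x)))

theorem measurable_outcomeReg (Q : Measure (Obs d)) (n : ℕ) (a : Treat n) :
    Measurable (outcomeReg Q n a) :=
  (WithLp.measurable_toLp 2 _).comp (measurable_pi_lambda _ fun _ => measurable_condAXN Q _ n a)

theorem measurable_treatProb (Q : Measure (Obs d)) (n : ℕ) (a : Treat n) :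
    Measurable (treatProb Q n a) :=
  measurable_condXN Q _ n

theorem measurable_comap_AXN {F : (n : ℕ) → Treat n → Cov d n → ℝ}
    (hF : ∀ n a, Measurable (F n a)) :
    Measurable[MeasurableSpace.comap Obs.AXN inferInstance] fun o : Obs d => F o.N o.A o.X := by
  have h : Measurable fun q : (Σ n : ℕ, Treat n × Cov d n) => F q.1 q.2.1 q.2.2 := by
    intro s hs
    rw [MeasurableSpace.measurableSet_iInf]
    intro n
    have : Measurable fun q : Treat n × Cov d n => F n q.1 q.2 :=
      measurable_from_prod_countable_right fun a => hF n a
    exact this hs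
  exact h.comp (comap_measurable Obs.AXN)

theorem measurable_comap_XN {F : (n : ℕ) → Cov d n → ℝ} (hF : ∀ n, Measurable (F n)) :
    Measurable[MeasurableSpace.comap Obs.XN inferInstance] fun o : Obs d => F o.N o.X := by
  have h : Measurable fun q : (Σ n : ℕ, Cov d n) => F q.1 q.2 := by
    intro s hs
    rw [MeasurableSpace.measurableSet_iInf]
    exact fun n => hF n hs
  exact h.comp (comap_measurable Obs.XN)

/-- Conditioning on `(A, X, N)` under an integral. -/
theorem integral_mul_condAXN (P : Measure (Obs d)) [IsProbabilityMeasure P] {f : Obs d → ℝ}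
    (hf : Integrable f P) {F : (n : ℕ) → Treat n → Cov d n → ℝ} (hF : ∀ n a, Measurable (F n a))
    (hFf : Integrable (fun o => F o.N o.A o.X * f o) P) :
    Integrable (fun o => F o.N o.A o.X * condAXN P f o.N o.A o.X) P ∧
      ∫ o, F o.N o.A o.X * f o ∂P = ∫ o, F o.N o.A o.X * condAXN P f o.N o.A o.X ∂P := by
  have h := condExp_mul_of_stronglyMeasurable_left (μ := P)
    (measurable_comap_AXN hF).stronglyMeasurable hFf hf
  have e : (fun o : Obs d => F o.N o.A o.X * condAXN P f o.N o.A o.X) =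
      (fun o : Obs d => F o.N o.A o.X) * P[f | MeasurableSpace.comap Obs.AXN inferInstance] := by
    funext o; simp [condAXN_apply]
  rw [e]
  refine ⟨(integrable_congr h).1 integrable_condExp, ?_⟩
  rw [← integral_congr_ae h, integral_condExp comap_AXN_le]
  rfl

/-- Conditioning on `(X, N)` under an integral. -/
theorem integral_condXN_mul (P : Measure (Obs d)) [IsProbabilityMeasure P] {f : Obs d → ℝ}
    (hf : Integrable f P) {F : (n : ℕ) → Cov d n → ℝ} (hF : ∀ n, Measurable (F n))
    (hFf : Integrable (fun o => F o.N o.X * f o) P) :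
    Integrable (fun o => F o.N o.X * condXN P f o.N o.X) P ∧
      ∫ o, F o.N o.X * f o ∂P = ∫ o, F o.N o.X * condXN P f o.N o.X ∂P := by
  have h := condExp_mul_of_stronglyMeasurable_left (μ := P)
    (measurable_comap_XN hF).stronglyMeasurable hFf hf
  have e : (fun o : Obs d => F o.N o.X * condXN P f o.N o.X) =
      (fun o : Obs d => F o.N o.X) * P[f | MeasurableSpace.comap Obs.XN inferInstance] := by
    funext o; simp [condXN_apply]
  rw [e]
  refine ⟨(integrable_congr h).1 integrable_condExp, ?_⟩
  rw [← integral_congr_ae h, integral_condExp comap_XN_le]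
  rfl

end CondExp

/-! ### Averaging over the treatment -/

section Treatment

variable {d : ℕ} {P : Measure (Obs d)} [IsProbabilityMeasure P]

/-- Functions of the covariates of clusters of size `n`, extended by `0` to other sizes. -/
noncomputable def extendSize {d : ℕ} (n : ℕ) (f : Cov d n → ℝ) (k : ℕ) (x : Cov d k) : ℝ :=
  if h : k = n then f (h ▸ x) else 0

theorem extendSize_self (n : ℕ) (f : Cov d n → ℝ) (x : Cov d n) : extendSize n f n x = f x := by
  simp [extendSize]

theorem extendSize_of_ne {n k : ℕ} (h : k ≠ n) (f : Cov d n → ℝ) (x : Cov d k) :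
    extendSize n f k x = 0 := by
  simp [extendSize, h]

theorem measurable_extendSize {n : ℕ} {f : Cov d n → ℝ} (hf : Measurable f) (k : ℕ) :
    Measurable (extendSize n f k) := by
  by_cases h : k = n
  · subst h
    simpa only [funext (extendSize_self k f)] using hf
  · simpa only [funext (extendSize_of_ne h f)] using measurable_const

/-- The law of total expectation over the treatment: for functions `f` of the cluster and `F` of
`(A, X, N)`, the mean of `f(O) F(A, X, N)` is that of `∑_a E{1(A = a) f(O) | X, N} F(a, X, N)`. -/
theorem integral_eq_integral_sum_condXN {M : ℕ} (hM : ∀ᵐ o ∂P, o.N ≤ M) {f : Obs d → ℝ}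
    (hf : Integrable f P) {F : (n : ℕ) → Treat n → Cov d n → ℝ} (hF : ∀ n a, Measurable (F n a))
    (hFf : Integrable (fun o => F o.N o.A o.X * f o) P) :
    Integrable (fun o => ∑ a : Treat o.N,
        F o.N a o.X * condXN P (Set.indicator {o' | o'.AN = ⟨o.N, a⟩} f) o.N o.X) P ∧
      ∫ o, F o.N o.A o.X * f o ∂P = ∫ o, ∑ a : Treat o.N,
        F o.N a o.X * condXN P (Set.indicator {o' | o'.AN = ⟨o.N, a⟩} f) o.N o.X ∂P := by
  classical
  have hterm : ∀ n (a : Treat n), (fun o : Obs d => extendSize n (F n a) o.N o.X *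
      Set.indicator {o | o.AN = ⟨n, a⟩} f o) =
      Set.indicator {o | o.AN = ⟨n, a⟩} fun o => F o.N o.A o.X * f o := by
    intro n a
    funext o
    by_cases h : o.AN = ⟨n, a⟩
    · rw [Set.indicator_of_mem (show o ∈ {o : Obs d | o.AN = ⟨n, a⟩} from h),
        Set.indicator_of_mem (show o ∈ {o : Obs d | o.AN = ⟨n, a⟩} from h)]
      obtain ⟨k, y, b, x⟩ := o
      obtain ⟨rfl, h2⟩ := Sigma.mk.inj_iff.1 h
      obtain rfl := eq_of_heq h2
      exact congrArg (· * _) (extendSize_self k _ x)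
    · rw [Set.indicator_of_notMem (show o ∉ {o : Obs d | o.AN = ⟨n, a⟩} from h),
        Set.indicator_of_notMem (show o ∉ {o : Obs d | o.AN = ⟨n, a⟩} from h), mul_zero]
  have hcond : ∀ n (a : Treat n), _ := fun n a =>
    integral_condXN_mul P (hf.indicator (Obs.measurableSet_AN n a))
      (F := extendSize n (F n a)) (measurable_extendSize (hF n a))
      (by rw [hterm]; exact hFf.indicator (Obs.measurableSet_AN n a))
  have hleft : (fun o : Obs d => F o.N o.A o.X * f o) =ᵐ[P] fun o => ∑ n ∈ Finset.range (M + 1),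
      ∑ a : Treat n, extendSize n (F n a) o.N o.X * Set.indicator {o | o.AN = ⟨n, a⟩} f o := by
    filter_upwards [hM] with o ho
    have h1 : ∀ n, ∀ a : Treat n, extendSize n (F n a) o.N o.X *
        Set.indicator {o | o.AN = ⟨n, a⟩} f o =
        Set.indicator {o | o.AN = ⟨n, a⟩} (fun o => F o.N o.A o.X * f o) o :=
      fun n a => congrFun (hterm n a) o
    simp_rw [h1]
    rw [Finset.sum_eq_single o.N, Finset.sum_eq_single o.A]
    · exact (Set.indicator_of_mem (show o ∈ {o' : Obs d | o'.AN = ⟨o.N, o.A⟩} from rfl)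
        fun o => F o.N o.A o.X * f o).symm
    · intro a _ ha
      refine Set.indicator_of_notMem (M := ℝ) (fun h => ha ?_) _
      exact (eq_of_heq (Sigma.mk.inj_iff.1 h).2).symm
    · simp
    · intro n _ hn
      refine Finset.sum_eq_zero fun a _ => Set.indicator_of_notMem (M := ℝ) (fun h => hn ?_) _
      exact (Sigma.mk.inj_iff.1 h).1.symm
    · intro h
      exact absurd (Finset.mem_range.2 (Nat.lt_succ_of_le ho)) h
  have hright : (fun o : Obs d => ∑ a : Treat o.N,
        F o.N a o.X * condXN P (Set.indicator {o' | o'.AN = ⟨o.N, a⟩} f) o.N o.X) =ᵐ[P]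
      fun o => ∑ n ∈ Finset.range (M + 1), ∑ a : Treat n, extendSize n (F n a) o.N o.X *
        condXN P (Set.indicator {o | o.AN = ⟨n, a⟩} f) o.N o.X := by
    filter_upwards [hM] with o ho
    rw [Finset.sum_eq_single o.N]
    · simp_rw [extendSize_self]
    · intro n _ hn
      refine Finset.sum_eq_zero fun a _ => ?_
      rw [extendSize_of_ne hn.symm, zero_mul]
    · intro h
      exact absurd (Finset.mem_range.2 (Nat.lt_succ_of_le ho)) h
  refine ⟨(integrable_congr hright).2 (integrable_finsetSum _ fun n _ =>
    integrable_finsetSum _ fun a _ => (hcond n a).1), ?_⟩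
  have hint : ∀ n, ∀ a : Treat n, Integrable (fun o : Obs d => extendSize n (F n a) o.N o.X *
      Set.indicator {o | o.AN = ⟨n, a⟩} f o) P := fun n a => by
    rw [hterm]; exact hFf.indicator (Obs.measurableSet_AN n a)
  rw [integral_congr_ae hleft, integral_congr_ae hright,
    integral_finsetSum _ fun n _ => integrable_finsetSum _ fun a _ => hint n a,
    integral_finsetSum _ fun n _ => integrable_finsetSum _ fun a _ => (hcond n a).1]
  refine Finset.sum_congr rfl fun n _ => ?_
  rw [integral_finsetSum _ fun a _ => hint n a,
    integral_finsetSum _ fun a _ => (hcond n a).1]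
  exact Finset.sum_congr rfl fun a _ => (hcond n a).2

/-- The mean of `F(A, X, N)` is that of `∑_a H(a, X, N) F(a, X, N)`. -/
theorem integral_axn {M : ℕ} (hM : ∀ᵐ o ∂P, o.N ≤ M)
    {F : (n : ℕ) → Treat n → Cov d n → ℝ} (hF : ∀ n a, Measurable (F n a))
    (hFi : Integrable (fun o : Obs d => F o.N o.A o.X) P) :
    Integrable (fun o => ∑ a : Treat o.N, F o.N a o.X * treatProb P o.N a o.X) P ∧
      ∫ o, F o.N o.A o.X ∂P = ∫ o, ∑ a : Treat o.N, F o.N a o.X * treatProb P o.N a o.X ∂P := by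
  have h := integral_eq_integral_sum_condXN hM (f := 1) (integrable_const (1 : ℝ)) hF
    (by simpa using hFi)
  simp only [Pi.one_apply, mul_one] at h
  exact h

/-- Under positivity, a property of `(A, X, N)` that holds almost surely holds at `(a, X, N)` for
all `a`. -/
theorem ae_forall_treat {M : ℕ} (hM : ∀ᵐ o ∂P, o.N ≤ M)
    (hpos : ∀ᵐ o ∂P, ∀ a : Treat o.N, 0 < treatProb P o.N a o.X)
    {p : (n : ℕ) → Treat n → Cov d n → Prop} (hp : ∀ n a, MeasurableSet {x | p n a x})
    (h : ∀ᵐ o ∂P, p o.N o.A o.X) : ∀ᵐ o ∂P, ∀ a : Treat o.N, p o.N a o.X := by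
  classical
  let F : (n : ℕ) → Treat n → Cov d n → ℝ := fun n a x => if p n a x then 0 else 1
  have hF : ∀ n a, Measurable (F n a) := fun n a =>
    Measurable.ite (hp n a) measurable_const measurable_const
  have h0 : (fun o : Obs d => F o.N o.A o.X) =ᵐ[P] 0 := by
    filter_upwards [h] with o ho
    simp [F, ho]
  obtain ⟨h1, h2⟩ := integral_axn hM hF ((integrable_congr h0).2 (integrable_zero _ _ _))
  rw [integral_congr_ae h0] at h2
  have hnn : ∀ᵐ o ∂P, ∀ a : Treat o.N, 0 ≤ F o.N a o.X * treatProb P o.N a o.X := by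
    filter_upwards [hpos] with o ho a
    refine mul_nonneg ?_ (ho a).le
    simp only [F]; split_ifs <;> norm_num
  have h3 := (integral_eq_zero_iff_of_nonneg_ae (hnn.mono fun o ho =>
    Finset.sum_nonneg fun a _ => ho a) h1).1 (by rw [← h2]; simp)
  filter_upwards [h3, hnn, hpos] with o ho1 ho2 ho3 a
  have h4 := (Finset.sum_eq_zero_iff_of_nonneg fun a _ => ho2 a).1 ho1 a (Finset.mem_univ a)
  by_contra hcon
  have : F o.N a o.X = 1 := by simp [F, hcon]
  rw [this, one_mul] at h4
  exact (ho3 a).ne' h4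

end Treatment

/-! ### Conditional moments of the outcome vector -/

section Outcome

variable {d : ℕ} {P : Measure (Obs d)} [IsProbabilityMeasure P]

/-- The coordinates of a vector, extended by `0`. -/
noncomputable def extendVec {n : ℕ} (v : EuclideanSpace ℝ (Fin n)) (j : ℕ) : ℝ :=
  if h : j < n then v ⟨j, h⟩ else 0

theorem abs_extendVec_le {n : ℕ} (v : EuclideanSpace ℝ (Fin n)) (j : ℕ) :
    |extendVec v j| ≤ ‖v‖ := by
  unfold extendVec
  split_ifs with h
  · exact PiLp.norm_apply_le v ⟨j, h⟩
  · simp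

theorem inner_eq_sum_extendVec {n M : ℕ} (h : n ≤ M) (u v : EuclideanSpace ℝ (Fin n)) :
    inner ℝ u v = ∑ j ∈ Finset.range M, extendVec u j * extendVec v j := by
  rw [← Finset.sum_subset (Finset.range_subset_range.2 h), Finset.sum_range]
  · simp [extendVec, PiLp.inner_apply, mul_comm]
  · intro j _ hj
    simp [extendVec, Finset.mem_range.not.1 hj]

theorem unitY_eq_extendVec (j : ℕ) (o : Obs d) : o.unitY j = extendVec o.Y j := rfl

theorem norm_sq_eq_sum_unitY {M : ℕ} {o : Obs d} (h : o.N ≤ M) :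
    ‖o.Y‖ ^ 2 = ∑ j ∈ Finset.range M, o.unitY j ^ 2 := by
  rw [← real_inner_self_eq_norm_sq, inner_eq_sum_extendVec h]
  simp [unitY_eq_extendVec, sq]

theorem measurable_extendVec {n : ℕ} (j : ℕ) :
    Measurable fun v : EuclideanSpace ℝ (Fin n) => extendVec v j := by
  unfold extendVec
  split_ifs
  · fun_prop
  · exact measurable_const

/-- `E_P {Y g(O) | A = a, X = x, N = n}`. -/
noncomputable def condScoreY (P : Measure (Obs d)) (g : Obs d → ℝ) (n : ℕ) (a : Treat n)
    (x : Cov d n) : EuclideanSpace ℝ (Fin n) :=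
  WithLp.toLp 2 fun j => condAXN P (fun o => o.unitY j * g o) n a x

theorem condScoreY_one (P : Measure (Obs d)) : condScoreY P (fun _ => 1) = outcomeReg P := by
  funext n a x
  simp only [condScoreY, outcomeReg, mul_one]

theorem measurable_condScoreY (P : Measure (Obs d)) (g : Obs d → ℝ) (n : ℕ) (a : Treat n) :
    Measurable (condScoreY P g n a) :=
  (WithLp.measurable_toLp 2 _).comp (measurable_pi_lambda _ fun _ => measurable_condAXN P _ n a)

theorem integrable_of_abs_le {f : Obs d → ℝ} (hf : Measurable f) {C : ℝ}
    (h : ∀ᵐ o ∂P, |f o| ≤ C) : Integrable f P :=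
  Integrable.of_bound hf.aestronglyMeasurable C h

/-- Conditioning on `(A, X, N)` in a linear function of the outcome vector. -/
theorem integral_score_inner_Y {M : ℕ} (hM : ∀ᵐ o ∂P, o.N ≤ M)
    (hY : ∀ j, Integrable (Obs.unitY (d := d) j) P) {v : VecFun d}
    (hv : ∀ n a, Measurable (v n a)) {C : ℝ} (hvC : ∀ᵐ o ∂P, ‖v o.N o.A o.X‖ ≤ C)
    {g : Obs d → ℝ} (hg : Measurable g) {B : ℝ} (hgB : ∀ o, |g o| ≤ B) :
    Integrable (fun o => inner ℝ (v o.N o.A o.X) o.Y * g o) P ∧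
    Integrable (fun o => inner ℝ (v o.N o.A o.X) (condScoreY P g o.N o.A o.X)) P ∧
    ∫ o, inner ℝ (v o.N o.A o.X) o.Y * g o ∂P =
      ∫ o, inner ℝ (v o.N o.A o.X) (condScoreY P g o.N o.A o.X) ∂P := by
  have hYg : ∀ j, Integrable (fun o : Obs d => o.unitY j * g o) P := fun j =>
    (hY j).mul_bdd (c := B) hg.aestronglyMeasurable (ae_of_all _ hgB)
  have hvj : ∀ j n a, Measurable fun x => extendVec (v n a x) j :=
    fun j n a => (measurable_extendVec j).comp (hv n a)
  have hvYg : ∀ j, Integrable (fun o : Obs d =>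
      extendVec (v o.N o.A o.X) j * (o.unitY j * g o)) P := fun j =>
    (hYg j).bdd_mul (c := C) (measurable_axn (hvj j)).aestronglyMeasurable
      (hvC.mono fun o ho => (abs_extendVec_le _ j).trans ho)
  have hcond := fun j => integral_mul_condAXN P (hYg j)
    (F := fun n a x => extendVec (v n a x) j) (hvj j) (hvYg j)
  have e1 : (fun o : Obs d => inner ℝ (v o.N o.A o.X) o.Y * g o) =ᵐ[P]
      fun o => ∑ j ∈ Finset.range M, extendVec (v o.N o.A o.X) j * (o.unitY j * g o) := by
    filter_upwards [hM] with o ho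
    rw [inner_eq_sum_extendVec ho, Finset.sum_mul]
    exact Finset.sum_congr rfl fun j _ => mul_assoc _ _ _
  have e2 : (fun o : Obs d => (inner ℝ (v o.N o.A o.X) (condScoreY P g o.N o.A o.X) : ℝ)) =ᵐ[P]
      fun o => ∑ j ∈ Finset.range M, extendVec (v o.N o.A o.X) j *
        condAXN P (fun o => o.unitY j * g o) o.N o.A o.X := by
    filter_upwards [hM] with o ho
    rw [inner_eq_sum_extendVec ho]
    refine Finset.sum_congr rfl fun j _ => ?_
    by_cases hj : j < o.N
    · simp [extendVec, condScoreY, hj]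
    · simp [extendVec, hj]
  refine ⟨(integrable_congr e1).2 (integrable_finsetSum _ fun j _ => hvYg j),
    (integrable_congr e2).2 (integrable_finsetSum _ fun j _ => (hcond j).1), ?_⟩
  rw [integral_congr_ae e1, integral_congr_ae e2, integral_finsetSum _ fun j _ => hvYg j,
    integral_finsetSum _ fun j _ => (hcond j).1]
  exact Finset.sum_congr rfl fun j _ => (hcond j).2

theorem integrable_norm_Y_sq {P : Measure (Obs d)} {M : ℕ} (hM : ∀ᵐ o ∂P, o.N ≤ M)
    (hY2 : ∀ j, Integrable (fun o : Obs d => o.unitY j ^ 2) P) :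
    Integrable (fun o : Obs d => ‖o.Y‖ ^ 2) P :=
  (integrable_congr (hM.mono fun _ ho => norm_sq_eq_sum_unitY ho)).2
    (integrable_finsetSum _ fun j _ => hY2 j)

/-- A bound on the conditional second moments of the outcomes bounds the mean of
`F(A, X, N) (1 + ‖Y‖²)` by a multiple of that of `F(A, X, N)`. -/
theorem integral_mul_one_add_norm_sq_le {M : ℕ} (hM : ∀ᵐ o ∂P, o.N ≤ M)
    (hY2 : ∀ j, Integrable (fun o : Obs d => o.unitY j ^ 2) P) {B : ℝ}
    (hB : ∀ j, ∀ᵐ o ∂P, |condAXN P (fun o' => o'.unitY j ^ 2) o.N o.A o.X| ≤ B)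
    {F : (n : ℕ) → Treat n → Cov d n → ℝ} (hF : ∀ n a, Measurable (F n a)) {C : ℝ}
    (hF0 : ∀ᵐ o : Obs d ∂P, 0 ≤ F o.N o.A o.X) (hFC : ∀ᵐ o : Obs d ∂P, F o.N o.A o.X ≤ C) :
    Integrable (fun o : Obs d => F o.N o.A o.X * (1 + ‖o.Y‖ ^ 2)) P ∧
      ∫ o, F o.N o.A o.X * (1 + ‖o.Y‖ ^ 2) ∂P ≤ (1 + M * B) * ∫ o, F o.N o.A o.X ∂P := by
  have hFb : ∀ᵐ o : Obs d ∂P, ‖F o.N o.A o.X‖ ≤ C := by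
    filter_upwards [hF0, hFC] with o h0 h1
    rwa [Real.norm_of_nonneg h0]
  have hFm := (measurable_axn hF).aestronglyMeasurable (μ := P)
  have hFi : Integrable (fun o : Obs d => F o.N o.A o.X) P := integrable_of_abs_le
    (measurable_axn hF) hFb
  have hj := fun j => integral_mul_condAXN P (hY2 j) hF ((hY2 j).bdd_mul hFm hFb)
  have e : (fun o : Obs d => F o.N o.A o.X * (1 + ‖o.Y‖ ^ 2)) =ᵐ[P] fun o => F o.N o.A o.X +
      ∑ j ∈ Finset.range M, F o.N o.A o.X * o.unitY j ^ 2 := by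
    filter_upwards [hM] with o ho
    rw [norm_sq_eq_sum_unitY ho, mul_add, mul_one, Finset.mul_sum]
  have hji : ∀ j, Integrable (fun o : Obs d => F o.N o.A o.X * o.unitY j ^ 2) P := fun j =>
    (hY2 j).bdd_mul hFm hFb
  refine ⟨(integrable_congr e).2 (hFi.add (integrable_finsetSum _ fun j _ => hji j)), ?_⟩
  rw [integral_congr_ae e, integral_add hFi (integrable_finsetSum _ fun j _ => hji j),
    integral_finsetSum _ fun j _ => hji j, add_mul, one_mul]
  gcongr
  calc ∑ j ∈ Finset.range M, ∫ o, F o.N o.A o.X * o.unitY j ^ 2 ∂P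
      ≤ ∑ j ∈ Finset.range M, B * ∫ o, F o.N o.A o.X ∂P := by
        refine Finset.sum_le_sum fun j _ => ?_
        rw [(hj j).2, ← integral_const_mul]
        refine integral_mono_ae (hj j).1 (hFi.const_mul B) ?_
        filter_upwards [hF0, hB j] with o h0 h1
        rw [mul_comm B]
        exact mul_le_mul_of_nonneg_left ((le_abs_self _).trans h1) h0
    _ = M * B * ∫ o, F o.N o.A o.X ∂P := by simp [mul_assoc]

end Outcome

/-! ### Pointwise expansions of the influence function -/

section Pointwise

variable {T E : Type*} [Fintype T] [NormedAddCommGroup E] [InnerProductSpace ℝ E]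

/-- The conditional bias given `(X, N)` of the influence function at misspecified nuisance
functions. It is of first order only in the errors of `w` corrected by the mean of `φ̂`; the other
terms are products of errors. -/
theorem abs_conditional_bias_le {c C : ℝ} (hc : 0 < c) (hC : 0 ≤ C) {H H' : T → ℝ}
    {w w' G G' : T → E} {φ φ' : T → T → E} (hH : ∀ a, 0 < H a ∧ H a ≤ 1) (hH' : ∀ a, c < H' a)
    (hG : ∀ a, ‖G a‖ ≤ C) (hG' : ∀ a, ‖G' a‖ ≤ C) (hw' : ∀ a, ‖w' a‖ ≤ C)
    (hφ : ∀ a, ∑ a', H a' • φ a' a = 0) :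
    |∑ a, inner ℝ (w' a) (G' a) + ∑ a', ((∑ a, inner ℝ (φ' a' a) (G' a)) +
        inner ℝ (w' a') (G a' - G' a') / H' a') * H a' - ∑ a, inner ℝ (w a) (G a)| ≤
      3 * C * ∑ a, ‖(w' a - w a) + ∑ a', H a' • φ' a' a‖ +
      C / c * ((∑ a, |H' a - H a|) * ∑ a, ‖G' a - G a‖) +
      ∑ a', ((∑ a, ‖φ' a' a - φ a' a‖) * ∑ a, ‖G' a - G a‖) * H a' := by
  set δ : T → E := fun a => (w' a - w a) + ∑ a', H a' • φ' a' a with hδ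
  set ρ : T → E := fun a => ∑ a', H a' • (φ' a' a - φ a' a) with hρ
  have hρ' : ∀ a, ρ a = ∑ a', H a' • φ' a' a := by
    intro a
    simp only [hρ, smul_sub, Finset.sum_sub_distrib, hφ, sub_zero]
  have hwδ : ∀ a, w' a - w a = δ a - ρ a := by
    intro a; rw [hρ']; simp [hδ]
  have hswap : ∑ a', (∑ a, inner ℝ (φ' a' a) (G' a)) * H a' = ∑ a, inner ℝ (ρ a) (G' a) := by
    simp_rw [hρ', sum_inner, Finset.sum_mul]
    rw [Finset.sum_comm]
    refine Finset.sum_congr rfl fun a _ => Finset.sum_congr rfl fun a' _ => ?_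
    rw [real_inner_smul_left, mul_comm]
  have hexp : ∑ a, inner ℝ (w' a) (G' a) + ∑ a', ((∑ a, inner ℝ (φ' a' a) (G' a)) +
        inner ℝ (w' a') (G a' - G' a') / H' a') * H a' - ∑ a, inner ℝ (w a) (G a) =
      ∑ a, (inner ℝ (δ a) (G' a) + (inner ℝ (w' a) (G a - G' a) * ((H a - H' a) / H' a) +
        inner ℝ (δ a) (G a - G' a) - inner ℝ (ρ a) (G a - G' a))) := by
    simp_rw [add_mul, Finset.sum_add_distrib]
    rw [hswap, ← Finset.sum_add_distrib, ← Finset.sum_add_distrib, ← Finset.sum_sub_distrib,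
      ← Finset.sum_add_distrib]
    refine Finset.sum_congr rfl fun a _ => ?_
    have h0 : H' a ≠ 0 := (hc.trans (hH' a)).ne'
    have h1 : w a = w' a - (δ a - ρ a) := by rw [← hwδ]; abel
    rw [h1]
    simp only [inner_sub_left, inner_sub_right]
    field_simp
    ring
  rw [hexp]
  have hsG : ∀ a, ‖G' a - G a‖ ≤ ∑ a, ‖G' a - G a‖ := fun a =>
    Finset.single_le_sum (f := fun a => ‖G' a - G a‖) (fun _ _ => norm_nonneg _)
      (Finset.mem_univ a)
  have hsH : ∀ a, |H' a - H a| ≤ ∑ a, |H' a - H a| := fun a =>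
    Finset.single_le_sum (f := fun a => |H' a - H a|) (fun _ _ => abs_nonneg _)
      (Finset.mem_univ a)
  have hterm : ∀ a, |inner ℝ (δ a) (G' a) + (inner ℝ (w' a) (G a - G' a) *
      ((H a - H' a) / H' a) + inner ℝ (δ a) (G a - G' a) - inner ℝ (ρ a) (G a - G' a))| ≤
      3 * C * ‖δ a‖ + C / c * ((∑ a, |H' a - H a|) * ‖G' a - G a‖) +
        ‖ρ a‖ * ∑ a, ‖G' a - G a‖ := by
    intro a
    have e1 : |inner ℝ (δ a) (G' a)| ≤ ‖δ a‖ * C :=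
      (abs_real_inner_le_norm _ _).trans (by gcongr; exact hG' a)
    have e2 : |inner ℝ (δ a) (G a - G' a)| ≤ ‖δ a‖ * (2 * C) :=
      (abs_real_inner_le_norm _ _).trans (by
        gcongr; exact (norm_sub_le _ _).trans (by linarith [hG a, hG' a]))
    have e3 : |inner ℝ (ρ a) (G a - G' a)| ≤ ‖ρ a‖ * ∑ a, ‖G' a - G a‖ :=
      (abs_real_inner_le_norm _ _).trans (by gcongr; rw [norm_sub_rev]; exact hsG a)
    have e4 : |inner ℝ (w' a) (G a - G' a) * ((H a - H' a) / H' a)| ≤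
        C / c * ((∑ a, |H' a - H a|) * ‖G' a - G a‖) := by
      rw [abs_mul, abs_div, abs_of_pos (hc.trans (hH' a))]
      have f1 : |inner ℝ (w' a) (G a - G' a)| ≤ C * ‖G' a - G a‖ :=
        (abs_real_inner_le_norm _ _).trans (by rw [norm_sub_rev]; gcongr; exact hw' a)
      have f2 : |H a - H' a| / H' a ≤ (∑ a, |H' a - H a|) / c :=
        div_le_div₀ ((abs_nonneg _).trans (hsH a)) (by rw [abs_sub_comm]; exact hsH a) hc
          (hH' a).le
      calc _ ≤ (C * ‖G' a - G a‖) * ((∑ a, |H' a - H a|) / c) :=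
            mul_le_mul f1 f2 (div_nonneg (abs_nonneg _) (hc.trans (hH' a)).le) (by positivity)
        _ = _ := by ring
    rw [abs_le] at *
    constructor <;> linarith
  calc _ ≤ ∑ a, |_| := Finset.abs_sum_le_sum_abs _ _
    _ ≤ ∑ a, (3 * C * ‖δ a‖ + C / c * ((∑ a, |H' a - H a|) * ‖G' a - G a‖) +
        ‖ρ a‖ * ∑ a, ‖G' a - G a‖) := Finset.sum_le_sum fun a _ => hterm a
    _ ≤ _ := by
      rw [Finset.sum_add_distrib, Finset.sum_add_distrib, ← Finset.mul_sum, ← Finset.mul_sum,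
        ← Finset.mul_sum, ← Finset.sum_mul]
      refine add_le_add le_rfl ?_
      simp_rw [mul_right_comm _ (∑ a, ‖G' a - G a‖)]
      rw [← Finset.sum_mul]
      refine mul_le_mul_of_nonneg_right ?_ (Finset.sum_nonneg fun _ _ => norm_nonneg _)
      simp_rw [Finset.sum_mul]
      rw [Finset.sum_comm]
      refine Finset.sum_le_sum fun a _ => (norm_sum_le _ _).trans ?_
      refine Finset.sum_le_sum fun a' _ => ?_
      rw [norm_smul, Real.norm_of_nonneg (hH a').1.le, mul_comm]

/-- Since `φ` has conditional mean zero, the error of `w` is at most its corrected error plus the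
conditional mean of the error of `φ`. -/
theorem sum_norm_weight_error_le {H : T → ℝ} {w w' : T → E} {φ φ' : T → T → E}
    (hH : ∀ a, 0 < H a) (hφ : ∀ a, ∑ a', H a' • φ a' a = 0) :
    ∑ a, ‖w' a - w a‖ ≤ ∑ a, ‖(w' a - w a) + ∑ a', H a' • φ' a' a‖ +
      ∑ a', (∑ a, ‖φ' a' a - φ a' a‖) * H a' := by
  have h : ∀ a, ‖w' a - w a‖ ≤ ‖(w' a - w a) + ∑ a', H a' • φ' a' a‖ +
      ∑ a', ‖φ' a' a - φ a' a‖ * H a' := by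
    intro a
    have e : w' a - w a = ((w' a - w a) + ∑ a', H a' • φ' a' a) -
        ∑ a', H a' • (φ' a' a - φ a' a) := by
      simp only [smul_sub, Finset.sum_sub_distrib, hφ, sub_zero]
      abel
    calc ‖w' a - w a‖ = _ := congrArg norm e
      _ ≤ _ := norm_sub_le _ _
      _ ≤ _ := by
        gcongr
        refine (norm_sum_le _ _).trans (Finset.sum_le_sum fun a' _ => ?_)
        rw [norm_smul, Real.norm_of_nonneg (hH a').le, mul_comm]
  refine (Finset.sum_le_sum fun a _ => h a).trans ?_
  rw [Finset.sum_add_distrib, Finset.sum_comm]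
  simp_rw [Finset.sum_mul]
  rfl

/-- With bounded nuisance functions the influence function grows at most linearly in the outcome. -/
theorem abs_influence_le {c C K : ℝ} (hc : 0 < c) (hC : 0 ≤ C) {h : ℝ} {w₀ G₀ : E}
    {w G φ : T → E} (hH : c < h) (hw₀ : ‖w₀‖ ≤ C) (hG₀ : ‖G₀‖ ≤ C)
    (hG : ∀ a, ‖G a‖ ≤ C) (hw : ∀ a, ‖w a‖ ≤ C) (hφ : ∀ a, ‖φ a‖ ≤ C)
    (hK : (Fintype.card T : ℝ) ≤ K) (y : E) :
    |∑ a, inner ℝ (w a + φ a) (G a) + inner ℝ w₀ (y - G₀) / h| ≤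
      (K * (2 * C * C) + C * (1 + C) / c) * (1 + ‖y‖) := by
  have h1 : |∑ a, inner ℝ (w a + φ a) (G a)| ≤ K * (2 * C * C) := by
    refine (Finset.abs_sum_le_sum_abs _ _).trans ?_
    calc ∑ a, |inner ℝ (w a + φ a) (G a)| ≤ ∑ _a : T, 2 * C * C := by
          refine Finset.sum_le_sum fun a _ => (abs_real_inner_le_norm _ _).trans ?_
          gcongr
          · exact (norm_add_le _ _).trans (by linarith [hw a, hφ a])
          · exact hG a
      _ ≤ _ := by
          rw [Finset.sum_const, nsmul_eq_mul, Finset.card_univ]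
          gcongr
  have h2 : |inner ℝ w₀ (y - G₀) / h| ≤ C * (1 + C) / c * (1 + ‖y‖) := by
    rw [abs_div, abs_of_pos (hc.trans hH)]
    have e : |inner ℝ w₀ (y - G₀)| ≤ C * ((1 + C) * (1 + ‖y‖)) := by
      refine (abs_real_inner_le_norm _ _).trans ?_
      gcongr
      refine (norm_sub_le _ _).trans ?_
      nlinarith [norm_nonneg y]
    calc _ ≤ C * ((1 + C) * (1 + ‖y‖)) / c := by gcongr
      _ = _ := by ring
  have h3 : 0 ≤ K * (2 * C * C) * ‖y‖ := by
    have : (0 : ℝ) ≤ K := (Nat.cast_nonneg _).trans hK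
    positivity
  refine (abs_add_le _ _).trans ?_
  nlinarith

/-- The influence function is Lipschitz in the nuisance functions, with a constant that is linear in
the outcome. -/
theorem abs_influence_sub_le {c C : ℝ} (hc : 0 < c) (hC : 0 ≤ C) {H H' : T → ℝ}
    {w w' G G' φ φ' : T → E} (hH : ∀ a, c < H a) (hH' : ∀ a, c < H' a)
    (hG : ∀ a, ‖G a‖ ≤ C) (hG' : ∀ a, ‖G' a‖ ≤ C) (hw : ∀ a, ‖w a‖ ≤ C)
    (hφ : ∀ a, ‖φ a‖ ≤ C) (y : E) (b : T) :
    |(∑ a, inner ℝ (w' a + φ' a) (G' a) + inner ℝ (w' b) (y - G' b) / H' b) -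
      (∑ a, inner ℝ (w a + φ a) (G a) + inner ℝ (w b) (y - G b) / H b)| ≤
      (2 * C + (1 + C) / c + C * (1 + C) / c ^ 2) * (1 + ‖y‖) *
        (∑ a, ‖w' a - w a‖ + ∑ a, ‖φ' a - φ a‖ + ∑ a, ‖G' a - G a‖ + ∑ a, |H' a - H a|) := by
  set dw := ∑ a, ‖w' a - w a‖
  set dφ := ∑ a, ‖φ' a - φ a‖
  set dG := ∑ a, ‖G' a - G a‖
  set dH := ∑ a, |H' a - H a|
  have hdw0 : 0 ≤ dw := Finset.sum_nonneg fun _ _ => norm_nonneg _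
  have hdφ0 : 0 ≤ dφ := Finset.sum_nonneg fun _ _ => norm_nonneg _
  have hdG0 : 0 ≤ dG := Finset.sum_nonneg fun _ _ => norm_nonneg _
  have hdH0 : 0 ≤ dH := Finset.sum_nonneg fun _ _ => abs_nonneg _
  have hb1 : ‖w' b - w b‖ ≤ dw := Finset.single_le_sum (f := fun a => ‖w' a - w a‖)
    (fun _ _ => norm_nonneg _) (Finset.mem_univ b)
  have hb3 : ‖G' b - G b‖ ≤ dG := Finset.single_le_sum (f := fun a => ‖G' a - G a‖)
    (fun _ _ => norm_nonneg _) (Finset.mem_univ b)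
  have hb4 : |H' b - H b| ≤ dH := Finset.single_le_sum (f := fun a => |H' a - H a|)
    (fun _ _ => abs_nonneg _) (Finset.mem_univ b)
  have e0 : (0 : ℝ) < H b := hc.trans (hH b)
  have e0' : (0 : ℝ) < H' b := hc.trans (hH' b)
  have hexp : (∑ a, inner ℝ (w' a + φ' a) (G' a) + inner ℝ (w' b) (y - G' b) / H' b) -
      (∑ a, inner ℝ (w a + φ a) (G a) + inner ℝ (w b) (y - G b) / H b) =
      ∑ a, (inner ℝ ((w' a - w a) + (φ' a - φ a)) (G' a) + inner ℝ (w a + φ a) (G' a - G a)) +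
      (inner ℝ (w' b - w b) (y - G' b) / H' b - inner ℝ (w b) (G' b - G b) / H' b +
        inner ℝ (w b) (y - G b) * (H b - H' b) / (H b * H' b)) := by
    rw [add_sub_add_comm, ← Finset.sum_sub_distrib]
    congr 1
    · refine Finset.sum_congr rfl fun a _ => ?_
      simp only [inner_sub_left, inner_sub_right, inner_add_left]
      ring
    · simp only [inner_sub_left, inner_sub_right]
      field_simp
      ring
  have h1 : |∑ a, (inner ℝ ((w' a - w a) + (φ' a - φ a)) (G' a) +
      inner ℝ (w a + φ a) (G' a - G a))| ≤ C * (dw + dφ) + 2 * C * dG := by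
    refine (Finset.abs_sum_le_sum_abs _ _).trans ?_
    rw [← Finset.sum_add_distrib, Finset.mul_sum, Finset.mul_sum, ← Finset.sum_add_distrib]
    refine Finset.sum_le_sum fun a _ => (abs_add_le _ _).trans (add_le_add ?_ ?_)
    · refine (abs_real_inner_le_norm _ _).trans ?_
      rw [mul_comm]
      gcongr
      · exact hG' a
      · exact norm_add_le _ _
    · refine (abs_real_inner_le_norm _ _).trans ?_
      gcongr
      exact (norm_add_le _ _).trans (by linarith [hw a, hφ a])
  have hyG : ∀ {g : E}, ‖g‖ ≤ C → ‖y - g‖ ≤ (1 + C) * (1 + ‖y‖) := fun {g} hg =>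
    (norm_sub_le _ _).trans (by nlinarith [norm_nonneg y])
  have h2 : |inner ℝ (w' b - w b) (y - G' b) / H' b| ≤ dw * ((1 + C) * (1 + ‖y‖)) / c := by
    rw [abs_div, abs_of_pos e0']
    gcongr
    · refine (abs_real_inner_le_norm _ _).trans ?_
      gcongr
      exact hyG (hG' b)
    · exact (hH' b).le
  have h3 : |inner ℝ (w b) (G' b - G b) / H' b| ≤ C * dG / c := by
    rw [abs_div, abs_of_pos e0']
    gcongr
    · refine (abs_real_inner_le_norm _ _).trans ?_
      gcongr
      exact hw b
    · exact (hH' b).le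
  have h4 : |inner ℝ (w b) (y - G b) * (H b - H' b) / (H b * H' b)| ≤
      C * ((1 + C) * (1 + ‖y‖)) * dH / (c * c) := by
    rw [abs_div, abs_mul, abs_of_pos (mul_pos e0 e0')]
    gcongr
    · refine (abs_real_inner_le_norm _ _).trans ?_
      gcongr
      · exact hw b
      · exact hyG (hG b)
    · rw [abs_sub_comm]; exact hb4
    · exact (hH b).le
    · exact (hH' b).le
  rw [hexp]
  have h5 : |inner ℝ (w' b - w b) (y - G' b) / H' b - inner ℝ (w b) (G' b - G b) / H' b +
      inner ℝ (w b) (y - G b) * (H b - H' b) / (H b * H' b)| ≤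
      dw * ((1 + C) * (1 + ‖y‖)) / c + C * dG / c + C * ((1 + C) * (1 + ‖y‖)) * dH / (c * c) :=
    (abs_add_le _ _).trans (add_le_add ((abs_sub _ _).trans (add_le_add h2 h3)) h4)
  refine (abs_add_le _ _).trans ((add_le_add h1 h5).trans ?_)
  have hy0 : 0 ≤ ‖y‖ := norm_nonneg y
  have s1 : C * (dw + dφ) + 2 * C * dG ≤ 2 * C * (1 + ‖y‖) * (dw + dφ + dG + dH) := by
    have h6 : 0 ≤ C * (dw + dφ) + 2 * C * dH + 2 * C * (‖y‖ * (dw + dφ + dG + dH)) := by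
      positivity
    linear_combination h6
  have s2 : dw * ((1 + C) * (1 + ‖y‖)) / c + C * dG / c ≤
      (1 + C) / c * (1 + ‖y‖) * (dw + dφ + dG + dH) := by
    have h6 : 0 ≤ (1 + C) / c * (1 + ‖y‖) * (dφ + dH) + dG * (1 + ‖y‖ + C * ‖y‖) / c := by
      positivity
    linear_combination h6
  have s3 : C * ((1 + C) * (1 + ‖y‖)) * dH / (c * c) ≤
      C * (1 + C) / c ^ 2 * (1 + ‖y‖) * (dw + dφ + dG + dH) := by
    have h6 : 0 ≤ C * (1 + C) / c ^ 2 * (1 + ‖y‖) * (dw + dφ + dG) := by positivity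
    linear_combination h6
  linear_combination s1 + s2 + s3

end Pointwise

/-! ### Bias and variance of the influence function at estimated nuisance functions -/

section BiasVariance

variable {d : ℕ}

theorem NuisanceMeasurable.apply {Z : Type*} [MeasurableSpace Z] {η : Z → Nuisance d}
    (h : NuisanceMeasurable η) (z : Z) : NuisanceMeasurable fun _ : Unit => η z :=
  h.comp (f := fun _ => z) measurable_const

/-- Separate measurability of the nuisance functions in the covariates. -/
abbrev Nuisance.IsMeasurable (η : Nuisance d) : Prop := NuisanceMeasurable fun _ : Unit => η

namespace Nuisance.IsMeasurable

variable {η : Nuisance d}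

theorem meas_G (h : η.IsMeasurable) (n : ℕ) (a : Treat n) : Measurable (η.G n a) :=
  (h.G n a).comp (measurable_const (a := ()).prodMk measurable_id)

theorem meas_H (h : η.IsMeasurable) (n : ℕ) (a : Treat n) : Measurable (η.H n a) :=
  (h.H n a).comp (measurable_const (a := ()).prodMk measurable_id)

theorem meas_w (h : η.IsMeasurable) (n : ℕ) (a : Treat n) : Measurable (η.w n a) :=
  (h.w n a).comp (measurable_const (a := ()).prodMk measurable_id)

theorem meas_φ (h : η.IsMeasurable) (n : ℕ) (a a' : Treat n) :
    Measurable fun x => η.φ n a' x a :=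
  (h.φ n a a').comp (measurable_const (a := ()).prodMk measurable_id)

theorem measurable_uncenteredEIF (h : η.IsMeasurable) : Measurable (uncenteredEIF η) := by
  have h1 : Measurable fun p : Unit × Obs d => uncenteredEIF η p.2 :=
    NuisanceMeasurable.measurable_uncenteredEIF (η := fun _ : Unit => η) h
  have h2 := h1.comp (measurable_prodMk_left (x := ()))
  simpa only [Function.comp_def] using h2

end Nuisance.IsMeasurable

/-- The nuisance functions `η` are the true ones at `P`, apart from the weight `w`, whose influence
function enters only through its conditional mean zero, and `P` satisfies the moment and boundedness
conditions. -/
structure RegularTruth (P : Measure (Obs d)) (η : Nuisance d) (c C : ℝ) (M : ℕ) (B : ℝ) :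
    Prop where
  G_eq : η.G = outcomeReg P
  H_eq : η.H = treatProb P
  meas : η.IsMeasurable
  c_pos : 0 < c
  C_nonneg : 0 ≤ C
  B_nonneg : 0 ≤ B
  bdd : η.IsBounded P c C
  size : ∀ᵐ o ∂P, o.N ≤ M
  int_Y : ∀ j, Integrable (Obs.unitY (d := d) j) P
  int_Y_sq : ∀ j, Integrable (fun o : Obs d => o.unitY j ^ 2) P
  cond_Y_sq : ∀ j, ∀ᵐ o ∂P, |condAXN P (fun o' => o'.unitY j ^ 2) o.N o.A o.X| ≤ B
  mean_zero : ∀ᵐ o ∂P, ∀ a : Treat o.N, ∑ a' : Treat o.N, η.H o.N a' o.X • η.φ o.N a' o.X a = 0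

theorem sum_treat_le {n M : ℕ} (h : n ≤ M) {f : Treat n → ℝ} {K : ℝ} (hK : 0 ≤ K)
    (hf : ∀ a, f a ≤ K) : ∑ a, f a ≤ 2 ^ M * K := by
  calc ∑ a, f a ≤ ∑ _a : Treat n, K := Finset.sum_le_sum fun a _ => hf a
    _ = 2 ^ n * K := by simp
    _ ≤ _ := by gcongr; norm_num

theorem card_treat_le {n M : ℕ} (h : n ≤ M) : (Fintype.card (Treat n) : ℝ) ≤ 2 ^ M := by
  simp only [Fintype.card_pi, Fintype.card_bool, Finset.prod_const, Finset.card_univ,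
    Fintype.card_fin, Nat.cast_pow, Nat.cast_ofNat]
  gcongr
  norm_num

variable {P : Measure (Obs d)} [IsProbabilityMeasure P]

theorem ofReal_integral_le_eLpNorm_two {f : Obs d → ℝ} (hf : Measurable f) (hf0 : ∀ o, 0 ≤ f o) :
    ENNReal.ofReal (∫ o, f o ∂P) ≤ eLpNorm f 2 P := by
  by_cases hi : Integrable f P
  · rw [ofReal_integral_eq_lintegral_ofReal hi (ae_of_all _ hf0)]
    calc ∫⁻ o, ENNReal.ofReal (f o) ∂P = eLpNorm f 1 P := by
          rw [eLpNorm_one_eq_lintegral_enorm]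
          exact lintegral_congr fun o => (Real.enorm_of_nonneg (hf0 o)).symm
      _ ≤ _ := eLpNorm_le_eLpNorm_of_exponent_le (by norm_num) hf.aestronglyMeasurable
  · rw [integral_undef hi]; simp

theorem ofReal_integral_mul_le_eLpNorm_two {P : Measure (Obs d)} {f g : Obs d → ℝ}
    (hf : Measurable f) (hg : Measurable g) (hf0 : ∀ o, 0 ≤ f o) (hg0 : ∀ o, 0 ≤ g o) :
    ENNReal.ofReal (∫ o, f o * g o ∂P) ≤ eLpNorm f 2 P * eLpNorm g 2 P := by
  by_cases hi : Integrable (fun o => f o * g o) P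
  · rw [ofReal_integral_eq_lintegral_ofReal hi (ae_of_all _ fun o => mul_nonneg (hf0 o) (hg0 o))]
    calc ∫⁻ o, ENNReal.ofReal (f o * g o) ∂P = eLpNorm (f • g) 1 P := by
          rw [eLpNorm_one_eq_lintegral_enorm]
          exact lintegral_congr fun o =>
            (Real.enorm_of_nonneg (mul_nonneg (hf0 o) (hg0 o))).symm
      _ ≤ _ := eLpNorm_smul_le_mul_eLpNorm hg.aestronglyMeasurable hf.aestronglyMeasurable
  · rw [integral_undef hi]; simp

variable {η η' : Nuisance d} {c C B : ℝ} {M : ℕ}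

theorem RegularTruth.pos {P : Measure (Obs d)} (h : RegularTruth P η c C M B) :
    ∀ᵐ o ∂P, ∀ a : Treat o.N, 0 < treatProb P o.N a o.X := by
  filter_upwards [h.bdd] with o ho a
  rw [← h.H_eq]
  exact h.c_pos.trans (ho a a).1.1

/-- The errors that enter the bias and the variance, as functions of `(X, N)` or `(A, X, N)`. -/
theorem measurable_errors (hη : η.IsMeasurable) (hη' : η'.IsMeasurable) :
    (Measurable fun o : Obs d => ∑ a : Treat o.N, |η'.H o.N a o.X - η.H o.N a o.X|) ∧
    (Measurable fun o : Obs d => ∑ a : Treat o.N, ‖η'.G o.N a o.X - η.G o.N a o.X‖) ∧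
    (Measurable fun o : Obs d => ∑ a : Treat o.N,
      ‖η'.φ o.N o.A o.X a - η.φ o.N o.A o.X a‖) ∧
    (Measurable fun o : Obs d => ∑ a : Treat o.N, ‖(η'.w o.N a o.X - η.w o.N a o.X)
      + ∑ a' : Treat o.N, η.H o.N a' o.X • η'.φ o.N a' o.X a‖) ∧
    (Measurable fun o : Obs d => ∑ a : Treat o.N, ‖η'.w o.N a o.X - η.w o.N a o.X‖) := by
  have G := hη.meas_G; have G' := hη'.meas_G
  have H := hη.meas_H; have H' := hη'.meas_H
  have w := hη.meas_w; have w' := hη'.meas_w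
  have φ := hη.meas_φ; have φ' := hη'.meas_φ
  refine ⟨?_, ?_, ?_, ?_, ?_⟩
  · exact measurable_axn (F := fun n _ x => ∑ a : Treat n, |η'.H n a x - η.H n a x|)
      fun n _ => Finset.measurable_sum _ fun a _ => ((H' n a).sub (H n a)).abs
  · exact measurable_axn (F := fun n _ x => ∑ a : Treat n, ‖η'.G n a x - η.G n a x‖)
      fun n _ => Finset.measurable_sum _ fun a _ => ((G' n a).sub (G n a)).norm
  · exact measurable_axn (F := fun n b x => ∑ a : Treat n, ‖η'.φ n b x a - η.φ n b x a‖)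
      fun n b => Finset.measurable_sum _ fun a _ => ((φ' n a b).sub (φ n a b)).norm
  · exact measurable_axn (F := fun n _ x => ∑ a : Treat n, ‖(η'.w n a x - η.w n a x)
      + ∑ a' : Treat n, η.H n a' x • η'.φ n a' x a‖)
      fun n _ => Finset.measurable_sum _ fun a _ => (((w' n a).sub (w n a)).add
        (Finset.measurable_sum _ fun a' _ => (H n a').smul (φ' n a a'))).norm
  · exact measurable_axn (F := fun n _ x => ∑ a : Treat n, ‖η'.w n a x - η.w n a x‖)
      fun n _ => Finset.measurable_sum _ fun a _ => ((w' n a).sub (w n a)).norm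

theorem integrable_errors (h : RegularTruth P η c C M B) (hη' : η'.IsMeasurable)
    (hb : η'.IsBounded P c C) :
    Integrable (fun o : Obs d => ∑ a : Treat o.N, |η'.H o.N a o.X - η.H o.N a o.X|) P ∧
    Integrable (fun o : Obs d => ∑ a : Treat o.N, ‖η'.G o.N a o.X - η.G o.N a o.X‖) P ∧
    Integrable (fun o : Obs d => ∑ a : Treat o.N, ‖η'.φ o.N o.A o.X a - η.φ o.N o.A o.X a‖) P ∧
    Integrable (fun o : Obs d => ∑ a : Treat o.N, ‖(η'.w o.N a o.X - η.w o.N a o.X)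
      + ∑ a' : Treat o.N, η.H o.N a' o.X • η'.φ o.N a' o.X a‖) P ∧
    Integrable (fun o : Obs d => ∑ a : Treat o.N, ‖η'.w o.N a o.X - η.w o.N a o.X‖) P ∧
    (∀ᵐ o ∂P, ∑ a : Treat o.N, |η'.H o.N a o.X - η.H o.N a o.X| ≤ 2 ^ M * 1) ∧
    (∀ᵐ o ∂P, ∑ a : Treat o.N, ‖η'.G o.N a o.X - η.G o.N a o.X‖ ≤ 2 ^ M * (2 * C)) ∧
    (∀ᵐ o ∂P, ∑ a : Treat o.N, ‖η'.φ o.N o.A o.X a - η.φ o.N o.A o.X a‖ ≤ 2 ^ M * (2 * C)) ∧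
    (∀ᵐ o ∂P, ∑ a : Treat o.N, ‖η'.w o.N a o.X - η.w o.N a o.X‖ ≤ 2 ^ M * (2 * C)) := by
  obtain ⟨m1, m2, m3, m4, m5⟩ := measurable_errors h.meas hη'
  have hC := h.C_nonneg
  have hc := h.c_pos
  have b1 : ∀ᵐ o ∂P, ∑ a : Treat o.N, |η'.H o.N a o.X - η.H o.N a o.X| ≤ 2 ^ M * 1 := by
    filter_upwards [h.bdd, hb, h.size] with o h1 h2 h3
    refine sum_treat_le h3 zero_le_one fun a => ?_
    have := (h1 a a).1; have := (h2 a a).1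
    rw [abs_le]; constructor <;> linarith
  have b2 : ∀ᵐ o ∂P, ∑ a : Treat o.N, ‖η'.G o.N a o.X - η.G o.N a o.X‖ ≤ 2 ^ M * (2 * C) := by
    filter_upwards [h.bdd, hb, h.size] with o h1 h2 h3
    refine sum_treat_le h3 (by positivity) fun a => (norm_sub_le _ _).trans ?_
    linarith [(h1 a a).2.1, (h2 a a).2.1]
  have b3 : ∀ᵐ o ∂P, ∑ a : Treat o.N, ‖η'.φ o.N o.A o.X a - η.φ o.N o.A o.X a‖ ≤
      2 ^ M * (2 * C) := by
    filter_upwards [h.bdd, hb, h.size] with o h1 h2 h3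
    refine sum_treat_le h3 (by positivity) fun a => (norm_sub_le _ _).trans ?_
    linarith [(h1 a o.A).2.2.1, (h2 a o.A).2.2.1]
  have b5 : ∀ᵐ o ∂P, ∑ a : Treat o.N, ‖η'.w o.N a o.X - η.w o.N a o.X‖ ≤ 2 ^ M * (2 * C) := by
    filter_upwards [h.bdd, hb, h.size] with o h1 h2 h3
    refine sum_treat_le h3 (by positivity) fun a => (norm_sub_le _ _).trans ?_
    linarith [(h1 a a).2.2.2, (h2 a a).2.2.2]
  have b4 : ∀ᵐ o ∂P, ∑ a : Treat o.N, ‖(η'.w o.N a o.X - η.w o.N a o.X)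
      + ∑ a' : Treat o.N, η.H o.N a' o.X • η'.φ o.N a' o.X a‖ ≤
      2 ^ M * (2 * C + 2 ^ M * C) := by
    filter_upwards [h.bdd, hb, h.size] with o h1 h2 h3
    refine sum_treat_le h3 (by positivity) fun a => (norm_add_le _ _).trans (add_le_add ?_ ?_)
    · exact (norm_sub_le _ _).trans (by linarith [(h1 a a).2.2.2, (h2 a a).2.2.2])
    · refine (norm_sum_le _ _).trans (sum_treat_le h3 hC fun a' => ?_)
      have e1 := (h1 a' a').1
      rw [norm_smul, Real.norm_of_nonneg (hc.trans e1.1).le]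
      exact (mul_le_of_le_one_left (norm_nonneg _) (by linarith)).trans (h2 a a').2.2.1
  have aux : ∀ {f : Obs d → ℝ} {K : ℝ}, Measurable f → (∀ o, 0 ≤ f o) → (∀ᵐ o ∂P, f o ≤ K) →
      Integrable f P := fun hm h0 hk => integrable_of_abs_le hm
        (hk.mono fun o ho => by rwa [abs_of_nonneg (h0 o)])
  exact ⟨aux m1 (fun o => by positivity) b1, aux m2 (fun o => by positivity) b2,
    aux m3 (fun o => by positivity) b3, aux m4 (fun o => by positivity) b4,
    aux m5 (fun o => by positivity) b5, b1, b2, b3, b5⟩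

/-- In the mean of the influence function the outcome may be replaced by its regression. -/
theorem integral_uncenteredEIF (h : RegularTruth P η c C M B) (hη' : η'.IsMeasurable)
    (hb : η'.IsBounded P c C) :
    Integrable (uncenteredEIF η') P ∧
    Integrable (fun o : Obs d => ∑ a : Treat o.N,
      inner ℝ (η'.w o.N a o.X) (η'.G o.N a o.X)) P ∧
    Integrable (fun o : Obs d => ∑ a' : Treat o.N,
      ((∑ a, inner ℝ (η'.φ o.N a' o.X a) (η'.G o.N a o.X)) +
        inner ℝ (η'.w o.N a' o.X) (η.G o.N a' o.X - η'.G o.N a' o.X) / η'.H o.N a' o.X) *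
        η.H o.N a' o.X) P ∧
    ∫ o, uncenteredEIF η' o ∂P = ∫ o, ∑ a : Treat o.N,
      inner ℝ (η'.w o.N a o.X) (η'.G o.N a o.X) ∂P +
      ∫ o, ∑ a' : Treat o.N, ((∑ a, inner ℝ (η'.φ o.N a' o.X a) (η'.G o.N a o.X)) +
        inner ℝ (η'.w o.N a' o.X) (η.G o.N a' o.X - η'.G o.N a' o.X) / η'.H o.N a' o.X) *
        η.H o.N a' o.X ∂P := by
  have hC := h.C_nonneg
  have hc := h.c_pos
  have G := h.meas.meas_G; have G' := hη'.meas_G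
  have H' := hη'.meas_H
  have w' := hη'.meas_w
  have φ' := hη'.meas_φ
  -- the bounded pieces
  have hcs : ∀ {n : ℕ} (u v : EuclideanSpace ℝ (Fin n)), ‖u‖ ≤ C → ‖v‖ ≤ C →
      |inner ℝ u v| ≤ C * C := fun u v hu hv =>
    (abs_real_inner_le_norm u v).trans (by gcongr)
  have hW : Integrable (fun o : Obs d => ∑ a : Treat o.N,
      (inner ℝ (η'.w o.N a o.X) (η'.G o.N a o.X) : ℝ)) P := by
    refine integrable_of_abs_le (C := 2 ^ M * (C * C)) (measurable_axn
      (F := fun n _ x => ∑ a : Treat n, (inner ℝ (η'.w n a x) (η'.G n a x) : ℝ))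
      fun n _ => Finset.measurable_sum _ fun a _ => (w' n a).inner (G' n a)) ?_
    filter_upwards [hb, h.size] with o h2 h3
    refine (Finset.abs_sum_le_sum_abs _ _).trans (sum_treat_le h3 (by positivity) fun a => ?_)
    exact hcs _ _ (h2 a a).2.2.2 (h2 a a).2.1
  let v : VecFun d := fun n a x => (η'.H n a x)⁻¹ • η'.w n a x
  have hv : ∀ n a, Measurable (v n a) := fun n a => (H' n a).inv.smul (w' n a)
  have hvC : ∀ᵐ o ∂P, ‖v o.N o.A o.X‖ ≤ c⁻¹ * C := by
    filter_upwards [hb] with o h2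
    have e := (h2 o.A o.A).1.1
    rw [norm_smul, norm_inv, Real.norm_of_nonneg (hc.trans e).le]
    exact mul_le_mul (inv_anti₀ hc e.le) (h2 o.A o.A).2.2.2 (norm_nonneg _) (inv_pos.2 hc).le
  let Q : (n : ℕ) → Treat n → Cov d n → ℝ := fun n b x =>
    (∑ a, inner ℝ (η'.φ n b x a) (η'.G n a x)) +
      inner ℝ (η'.w n b x) (η.G n b x - η'.G n b x) / η'.H n b x
  have hQ : ∀ n b, Measurable (Q n b) := fun n b =>
    (Finset.measurable_sum _ fun a _ => (φ' n a b).inner (G' n a)).add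
      (((w' n b).inner ((G n b).sub (G' n b))).div (H' n b))
  have hQi : Integrable (fun o : Obs d => Q o.N o.A o.X) P := by
    refine integrable_of_abs_le (C := 2 ^ M * (C * C) + C * (2 * C) / c) (measurable_axn hQ) ?_
    filter_upwards [hb, h.bdd, h.size] with o h2 h1 h3
    refine (abs_add_le _ _).trans (add_le_add ?_ ?_)
    · refine (Finset.abs_sum_le_sum_abs _ _).trans (sum_treat_le h3 (by positivity) fun a => ?_)
      exact hcs _ _ (h2 a o.A).2.2.1 (h2 a a).2.1
    · have e := (h2 o.A o.A).1.1
      rw [abs_div, abs_of_pos (hc.trans e)]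
      refine div_le_div₀ (by positivity) ?_ hc e.le
      refine (abs_real_inner_le_norm _ _).trans (mul_le_mul (h2 o.A o.A).2.2.2
        ((norm_sub_le _ _).trans ?_) (norm_nonneg _) hC)
      linarith [(h1 o.A o.A).2.1, (h2 o.A o.A).2.1]
  obtain ⟨hQ1, hQ2⟩ := integral_axn h.size hQ hQi
  obtain ⟨hY1, hY2, hY3⟩ := integral_score_inner_Y h.size h.int_Y hv hvC
    (measurable_const (a := (1 : ℝ))) (B := 1) (fun _ => by simp)
  rw [condScoreY_one, ← h.G_eq] at hY2 hY3
  simp only [mul_one] at hY1 hY3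
  have e : uncenteredEIF η' = fun o : Obs d =>
      ((∑ a : Treat o.N, inner ℝ (η'.w o.N a o.X) (η'.G o.N a o.X)) + Q o.N o.A o.X) +
      (inner ℝ (v o.N o.A o.X) o.Y - inner ℝ (v o.N o.A o.X) (η.G o.N o.A o.X)) := by
    funext o
    simp only [uncenteredEIF, Q, v, inner_add_left, Finset.sum_add_distrib, inner_sub_right,
      real_inner_smul_left]
    ring
  have hH : η.H = treatProb P := h.H_eq
  refine ⟨?_, hW, by rw [hH]; exact hQ1, ?_⟩
  · rw [e]
    exact (hW.add hQi).add (hY1.sub hY2)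
  · have s1 : Integrable (fun o : Obs d => (∑ a : Treat o.N,
        inner ℝ (η'.w o.N a o.X) (η'.G o.N a o.X)) + Q o.N o.A o.X) P := hW.add hQi
    have s2 : Integrable (fun o : Obs d => (inner ℝ (v o.N o.A o.X) o.Y -
        inner ℝ (v o.N o.A o.X) (η.G o.N o.A o.X) : ℝ)) P := hY1.sub hY2
    rw [e, integral_add s1 s2, integral_add hW hQi, integral_sub hY1 hY2,
      hY3, sub_self, add_zero, hQ2, hH]

/-- The bias of the influence function at `η'` is bounded by the error of the corrected weight and
products of two errors. -/
theorem enorm_bias_le (h : RegularTruth P η c C M B) (hη' : η'.IsMeasurable)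
    (hb : η'.IsBounded P c C) :
    ‖∫ o, uncenteredEIF η' o ∂P -
        ∫ o, ∑ a : Treat o.N, inner ℝ (η.w o.N a o.X) (η.G o.N a o.X) ∂P‖ₑ ≤
      ENNReal.ofReal (3 * C) * errW P η' η +
        ENNReal.ofReal (C / c) * (errH P η' η * errG P η' η) + errPhi P η' η * errG P η' η := by
  obtain ⟨m1, m2, m3, m4, m5⟩ := measurable_errors h.meas hη'
  obtain ⟨i1, i2, i3, i4, -, b1, b2, b3, -⟩ := integrable_errors h hη' hb
  obtain ⟨-, hW, hQ, hint⟩ := integral_uncenteredEIF h hη' hb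
  obtain ⟨-, hΨ, -⟩ := integral_uncenteredEIF h h.meas h.bdd
  have hC := h.C_nonneg
  have hc := h.c_pos
  have i12 : Integrable (fun o : Obs d => (∑ a : Treat o.N, |η'.H o.N a o.X - η.H o.N a o.X|) *
      ∑ a : Treat o.N, ‖η'.G o.N a o.X - η.G o.N a o.X‖) P :=
    i2.bdd_mul m1.aestronglyMeasurable (b1.mono fun o ho => by
      rwa [Real.norm_of_nonneg (by positivity)])
  have i32 : Integrable (fun o : Obs d =>
      (∑ a : Treat o.N, ‖η'.φ o.N o.A o.X a - η.φ o.N o.A o.X a‖) *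
      ∑ a : Treat o.N, ‖η'.G o.N a o.X - η.G o.N a o.X‖) P :=
    i2.bdd_mul m3.aestronglyMeasurable (b3.mono fun o ho => by
      rwa [Real.norm_of_nonneg (by positivity)])
  obtain ⟨j1, j2⟩ := integral_axn h.size (F := fun n b x =>
      (∑ a : Treat n, ‖η'.φ n b x a - η.φ n b x a‖) *
      ∑ a : Treat n, ‖η'.G n a x - η.G n a x‖) (fun n b =>
      (Finset.measurable_sum _ fun a _ => ((hη'.meas_φ n a b).sub (h.meas.meas_φ n a b)).norm).mul
      (Finset.measurable_sum _ fun a _ => ((hη'.meas_G n a).sub (h.meas.meas_G n a)).norm)) i32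
  rw [← h.H_eq] at j1 j2
  have key : |∫ o, uncenteredEIF η' o ∂P -
        ∫ o, ∑ a : Treat o.N, inner ℝ (η.w o.N a o.X) (η.G o.N a o.X) ∂P| ≤
      3 * C * ∫ o, ∑ a : Treat o.N, ‖(η'.w o.N a o.X - η.w o.N a o.X)
        + ∑ a' : Treat o.N, η.H o.N a' o.X • η'.φ o.N a' o.X a‖ ∂P +
      C / c * ∫ o, (∑ a : Treat o.N, |η'.H o.N a o.X - η.H o.N a o.X|) *
        ∑ a : Treat o.N, ‖η'.G o.N a o.X - η.G o.N a o.X‖ ∂P +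
      ∫ o, (∑ a : Treat o.N, ‖η'.φ o.N o.A o.X a - η.φ o.N o.A o.X a‖) *
        ∑ a : Treat o.N, ‖η'.G o.N a o.X - η.G o.N a o.X‖ ∂P := by
    have t1 := integral_sub (hW.add hQ) hΨ
    have t2 := integral_add (i4.const_mul (3 * C)) (i12.const_mul (C / c))
    have t3 := integral_add ((i4.const_mul (3 * C)).add (i12.const_mul (C / c))) j1
    simp only [Pi.add_apply] at t1 t3
    rw [hint, ← integral_add hW hQ, ← t1, j2, ← integral_const_mul,
      ← integral_const_mul, ← t2, ← t3]
    refine abs_integral_le_integral_abs.trans (integral_mono_ae ((hW.add hQ).sub hΨ).abs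
      (((i4.const_mul _).add (i12.const_mul _)).add j1) ?_)
    filter_upwards [h.bdd, hb, h.mean_zero] with o h1 h2 h3
    exact abs_conditional_bias_le hc hC
      (fun a => ⟨hc.trans (h1 a a).1.1, by linarith [(h1 a a).1.2]⟩) (fun a => (h2 a a).1.1)
      (fun a => (h1 a a).2.1) (fun a => (h2 a a).2.1) (fun a => (h2 a a).2.2.2) h3
  rw [Real.enorm_eq_ofReal_abs]
  refine (ENNReal.ofReal_le_ofReal key).trans ?_
  refine ENNReal.ofReal_add_le.trans (add_le_add (ENNReal.ofReal_add_le.trans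
    (add_le_add ?_ ?_)) ?_)
  · rw [ENNReal.ofReal_mul (by positivity)]
    gcongr
    exact ofReal_integral_le_eLpNorm_two m4 fun o => by positivity
  · rw [ENNReal.ofReal_mul (by positivity)]
    gcongr
    exact ofReal_integral_mul_le_eLpNorm_two m1 m2 (fun o => by positivity)
      fun o => by positivity
  · exact ofReal_integral_mul_le_eLpNorm_two m3 m2 (fun o => by positivity)
      fun o => by positivity

/-- The influence function is unbiased at the true nuisance functions, where all errors vanish. -/
theorem integral_uncenteredEIF_truth (h : RegularTruth P η c C M B) :
    ∫ o, uncenteredEIF η o ∂P =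
      ∫ o, ∑ a : Treat o.N, inner ℝ (η.w o.N a o.X) (η.G o.N a o.X) ∂P := by
  have hb := enorm_bias_le h h.meas h.bdd
  have hG : errG P η η = 0 := by simp [errG]
  have hW : errW P η η = 0 := by
    unfold errW
    rw [eLpNorm_congr_ae (g := fun _ => (0 : ℝ))]
    · simp
    · filter_upwards [h.mean_zero] with o ho
      refine Finset.sum_eq_zero fun a _ => ?_
      rw [ho a]; simp
  rw [hG, hW] at hb
  simpa [sub_eq_zero] using hb

theorem integrable_one_add_norm_Y_sq (h : RegularTruth P η c C M B) :
    Integrable (fun o : Obs d => 1 + ‖o.Y‖ ^ 2) P :=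
  (integrable_const _).add (integrable_norm_Y_sq h.size h.int_Y_sq)

theorem memLp_uncenteredEIF (h : RegularTruth P η c C M B) (hη' : η'.IsMeasurable)
    (hb : η'.IsBounded P c C) : MemLp (uncenteredEIF η') 2 P := by
  set K : ℝ := 2 ^ M * (2 * C * C) + C * (1 + C) / c with hK
  rw [memLp_two_iff_integrable_sq hη'.measurable_uncenteredEIF.aestronglyMeasurable]
  refine ((integrable_one_add_norm_Y_sq h).const_mul (2 * K ^ 2)).mono'
    (hη'.measurable_uncenteredEIF.pow_const 2).aestronglyMeasurable ?_
  filter_upwards [hb, h.size] with o h2 h3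
  have e := abs_influence_le (T := Treat o.N) h.c_pos h.C_nonneg (h2 o.A o.A).1.1
    (h2 o.A o.A).2.2.2 (h2 o.A o.A).2.1 (fun a => (h2 a a).2.1) (fun a => (h2 a a).2.2.2)
    (fun a => (h2 a o.A).2.2.1) (card_treat_le h3) o.Y
  rw [Real.norm_of_nonneg (sq_nonneg _), ← sq_abs]
  calc |uncenteredEIF η' o| ^ 2 ≤ (K * (1 + ‖o.Y‖)) ^ 2 := by gcongr; exact e
    _ = K ^ 2 * (1 + ‖o.Y‖) ^ 2 := by ring
    _ ≤ K ^ 2 * (2 * (1 + ‖o.Y‖ ^ 2)) := by gcongr; nlinarith [sq_nonneg (1 - ‖o.Y‖)]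
    _ = _ := by ring

/-- The influence function is continuous in the nuisance functions, in mean square. -/
theorem lintegral_influence_sub_sq_le (h : RegularTruth P η c C M B) (hη' : η'.IsMeasurable)
    (hb : η'.IsBounded P c C) :
    ∫⁻ o, ‖uncenteredEIF η' o - uncenteredEIF η o‖ₑ ^ 2 ∂P ≤
      ENNReal.ofReal (4 * (2 ^ M * (2 * C * C) + C * (1 + C) / c) *
        (2 * C + (1 + C) / c + C * (1 + C) / c ^ 2) * (1 + M * B)) *
      (errW P η' η + 2 * errPhi P η' η + errG P η' η + errH P η' η) := by
  obtain ⟨m1, m2, m3, m4, m5⟩ := measurable_errors h.meas hη'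
  obtain ⟨i1, i2, i3, i4, i5, b1, b2, b3, b5⟩ := integrable_errors h hη' hb
  have hC := h.C_nonneg
  have hc := h.c_pos
  have hB := h.B_nonneg
  set K : ℝ := 2 ^ M * (2 * C * C) + C * (1 + C) / c with hK
  set K' : ℝ := 2 * C + (1 + C) / c + C * (1 + C) / c ^ 2 with hK'
  have hK0 : 0 ≤ K := by positivity
  have hK'0 : 0 ≤ K' := by positivity
  let F : (n : ℕ) → Treat n → Cov d n → ℝ := fun n b x =>
    ∑ a, ‖η'.w n a x - η.w n a x‖ + ∑ a, ‖η'.φ n b x a - η.φ n b x a‖ +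
      ∑ a, ‖η'.G n a x - η.G n a x‖ + ∑ a, |η'.H n a x - η.H n a x|
  have hF : ∀ n b, Measurable (F n b) := fun n b =>
    (((Finset.measurable_sum _ fun a _ => ((hη'.meas_w n a).sub (h.meas.meas_w n a)).norm).add
    (Finset.measurable_sum _ fun a _ => ((hη'.meas_φ n a b).sub (h.meas.meas_φ n a b)).norm)).add
    (Finset.measurable_sum _ fun a _ => ((hη'.meas_G n a).sub (h.meas.meas_G n a)).norm)).add
    (Finset.measurable_sum _ fun a _ => ((hη'.meas_H n a).sub (h.meas.meas_H n a)).abs)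
  have hF0 : ∀ n b x, 0 ≤ F n b x := fun n b x => by positivity
  have hFC : ∀ᵐ o : Obs d ∂P, F o.N o.A o.X ≤
      2 ^ M * (2 * C) + 2 ^ M * (2 * C) + 2 ^ M * (2 * C) + 2 ^ M * 1 := by
    filter_upwards [b1, b2, b3, b5] with o h1 h2 h3 h5
    exact add_le_add (add_le_add (add_le_add h5 h3) h2) h1
  obtain ⟨hFY, hFY'⟩ := integral_mul_one_add_norm_sq_le h.size h.int_Y_sq h.cond_Y_sq hF
    (ae_of_all _ fun o => hF0 _ _ _) hFC
  obtain ⟨j1, j2⟩ := integral_axn h.size (F := fun n b x =>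
      (∑ a : Treat n, ‖η'.φ n b x a - η.φ n b x a‖)) (fun n b =>
      (Finset.measurable_sum _ fun a _ => ((hη'.meas_φ n a b).sub (h.meas.meas_φ n a b)).norm)) i3
  rw [← h.H_eq] at j1 j2
  have hpt : ∀ᵐ o ∂P, (uncenteredEIF η' o - uncenteredEIF η o) ^ 2 ≤
      4 * K * K' * (F o.N o.A o.X * (1 + ‖o.Y‖ ^ 2)) := by
    filter_upwards [h.bdd, hb, h.size] with o h1 h2 h3
    have e1 := abs_influence_sub_le (T := Treat o.N) hc hC (fun a => (h1 a a).1.1)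
      (fun a => (h2 a a).1.1) (fun a => (h1 a a).2.1) (fun a => (h2 a a).2.1)
      (fun a => (h1 a a).2.2.2) (fun a => (h1 a o.A).2.2.1) (φ' := η'.φ o.N o.A o.X)
      (w' := fun a => η'.w o.N a o.X) o.Y o.A
    have e2 := abs_influence_le (T := Treat o.N) hc hC (h2 o.A o.A).1.1
      (h2 o.A o.A).2.2.2 (h2 o.A o.A).2.1 (fun a => (h2 a a).2.1) (fun a => (h2 a a).2.2.2)
      (fun a => (h2 a o.A).2.2.1) (card_treat_le h3) o.Y
    have e3 := abs_influence_le (T := Treat o.N) hc hC (h1 o.A o.A).1.1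
      (h1 o.A o.A).2.2.2 (h1 o.A o.A).2.1 (fun a => (h1 a a).2.1) (fun a => (h1 a a).2.2.2)
      (fun a => (h1 a o.A).2.2.1) (card_treat_le h3) o.Y
    change |uncenteredEIF η' o - uncenteredEIF η o| ≤ K' * (1 + ‖o.Y‖) * F o.N o.A o.X at e1
    change |uncenteredEIF η' o| ≤ K * (1 + ‖o.Y‖) at e2
    change |uncenteredEIF η o| ≤ K * (1 + ‖o.Y‖) at e3
    -- bound one factor of the square by growth and the other by the Lipschitz estimate, so that the
    -- outcome enters only through its second moment
    have e4 : |uncenteredEIF η' o - uncenteredEIF η o| ≤ 2 * K * (1 + ‖o.Y‖) :=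
      (abs_sub _ _).trans (by linarith)
    calc (uncenteredEIF η' o - uncenteredEIF η o) ^ 2
        = |uncenteredEIF η' o - uncenteredEIF η o| *
          |uncenteredEIF η' o - uncenteredEIF η o| := by rw [← sq, sq_abs]
      _ ≤ (2 * K * (1 + ‖o.Y‖)) * (K' * (1 + ‖o.Y‖) * F o.N o.A o.X) :=
          mul_le_mul e4 e1 (abs_nonneg _) (by positivity)
      _ = 2 * K * K' * F o.N o.A o.X * (1 + ‖o.Y‖) ^ 2 := by ring
      _ ≤ 2 * K * K' * F o.N o.A o.X * (2 * (1 + ‖o.Y‖ ^ 2)) := by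
          have := hF0 o.N o.A o.X
          gcongr
          nlinarith [sq_nonneg (1 - ‖o.Y‖)]
      _ = _ := by ring
  have hFint : ∫ o, F o.N o.A o.X ∂P ≤
      ∫ o, ∑ a : Treat o.N, ‖(η'.w o.N a o.X - η.w o.N a o.X)
        + ∑ a' : Treat o.N, η.H o.N a' o.X • η'.φ o.N a' o.X a‖ ∂P +
      2 * ∫ o, ∑ a : Treat o.N, ‖η'.φ o.N o.A o.X a - η.φ o.N o.A o.X a‖ ∂P +
      ∫ o, ∑ a : Treat o.N, ‖η'.G o.N a o.X - η.G o.N a o.X‖ ∂P +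
      ∫ o, ∑ a : Treat o.N, |η'.H o.N a o.X - η.H o.N a o.X| ∂P := by
    have e1 : ∫ o, F o.N o.A o.X ∂P = ∫ o, ∑ a : Treat o.N, ‖η'.w o.N a o.X - η.w o.N a o.X‖ ∂P +
        ∫ o, ∑ a : Treat o.N, ‖η'.φ o.N o.A o.X a - η.φ o.N o.A o.X a‖ ∂P +
        ∫ o, ∑ a : Treat o.N, ‖η'.G o.N a o.X - η.G o.N a o.X‖ ∂P +
        ∫ o, ∑ a : Treat o.N, |η'.H o.N a o.X - η.H o.N a o.X| ∂P := by
      have t1 := integral_add (i5.add i3) i2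
      have t2 := integral_add ((i5.add i3).add i2) i1
      simp only [Pi.add_apply] at t1 t2
      rw [← integral_add i5 i3, ← t1, ← t2]
    have e2 : ∫ o, ∑ a : Treat o.N, ‖η'.w o.N a o.X - η.w o.N a o.X‖ ∂P ≤
        ∫ o, ∑ a : Treat o.N, ‖(η'.w o.N a o.X - η.w o.N a o.X)
          + ∑ a' : Treat o.N, η.H o.N a' o.X • η'.φ o.N a' o.X a‖ ∂P +
        ∫ o, ∑ a : Treat o.N, ‖η'.φ o.N o.A o.X a - η.φ o.N o.A o.X a‖ ∂P := by
      rw [j2, ← integral_add i4 j1]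
      refine integral_mono_ae i5 (i4.add j1) ?_
      filter_upwards [h.bdd, h.mean_zero] with o h1 h3
      exact sum_norm_weight_error_le (fun a => hc.trans (h1 a a).1.1) h3
    linarith
  have hlin : ∫⁻ o, ‖uncenteredEIF η' o - uncenteredEIF η o‖ₑ ^ 2 ∂P ≤
      ENNReal.ofReal (∫ o, 4 * K * K' * (F o.N o.A o.X * (1 + ‖o.Y‖ ^ 2)) ∂P) := by
    rw [ofReal_integral_eq_lintegral_ofReal (hFY.const_mul _) (ae_of_all _ fun o => by
      have := hF0 o.N o.A o.X
      positivity)]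
    refine lintegral_mono_ae ?_
    filter_upwards [hpt] with o ho
    rw [Real.enorm_eq_ofReal_abs, ← ENNReal.ofReal_pow (abs_nonneg _), sq_abs]
    exact ENNReal.ofReal_le_ofReal ho
  refine hlin.trans ?_
  rw [integral_const_mul]
  have hle : 4 * K * K' * ∫ o, F o.N o.A o.X * (1 + ‖o.Y‖ ^ 2) ∂P ≤
      4 * K * K' * (1 + M * B) * (∫ o, ∑ a : Treat o.N, ‖(η'.w o.N a o.X - η.w o.N a o.X)
        + ∑ a' : Treat o.N, η.H o.N a' o.X • η'.φ o.N a' o.X a‖ ∂P +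
      2 * ∫ o, ∑ a : Treat o.N, ‖η'.φ o.N o.A o.X a - η.φ o.N o.A o.X a‖ ∂P +
      ∫ o, ∑ a : Treat o.N, ‖η'.G o.N a o.X - η.G o.N a o.X‖ ∂P +
      ∫ o, ∑ a : Treat o.N, |η'.H o.N a o.X - η.H o.N a o.X| ∂P) := by
    rw [mul_assoc (4 * K * K')]
    gcongr
    exact hFY'.trans (by gcongr)
  refine (ENNReal.ofReal_le_ofReal hle).trans ?_
  rw [ENNReal.ofReal_mul (by positivity)]
  gcongr
  refine ENNReal.ofReal_add_le.trans (add_le_add (ENNReal.ofReal_add_le.trans (add_le_add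
    (ENNReal.ofReal_add_le.trans (add_le_add ?_ ?_)) ?_)) ?_)
  · exact ofReal_integral_le_eLpNorm_two m4 fun o => by positivity
  · rw [ENNReal.ofReal_mul (by norm_num), ENNReal.ofReal_ofNat]
    gcongr
    exact ofReal_integral_le_eLpNorm_two m3 fun o => by positivity
  · exact ofReal_integral_le_eLpNorm_two m2 fun o => by positivity
  · exact ofReal_integral_le_eLpNorm_two m1 fun o => by positivity

end BiasVariance

/-! ### Stochastic orders of nonnegative random variables -/

section StochasticOrder

variable {Ω : Type*} [MeasurableSpace Ω] {μ : Measure Ω}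

/-- `X_m = o_P(1)` for nonnegative `X_m`. -/
def IsLittleOP (μ : Measure Ω) (X : ℕ → Ω → ℝ≥0∞) : Prop :=
  ∀ ε : ℝ≥0∞, 0 < ε → Tendsto (fun m => μ {ω | ε < X m ω}) atTop (𝓝 0)

theorem IsLittleOP.mono {X Y : ℕ → Ω → ℝ≥0∞} (hY : IsLittleOP μ Y)
    (h : ∀ᶠ m in atTop, ∀ᵐ ω ∂μ, X m ω ≤ Y m ω) : IsLittleOP μ X := by
  intro ε hε
  refine tendsto_of_tendsto_of_tendsto_of_le_of_le' tendsto_const_nhds (hY ε hε)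
    (Eventually.of_forall fun _ => zero_le) (h.mono fun m hm => measure_mono_ae ?_)
  filter_upwards [hm] with ω hω h1
  exact lt_of_lt_of_le (show ε < X m ω from h1) hω

theorem IsLittleOP.add {X Y : ℕ → Ω → ℝ≥0∞} (hX : IsLittleOP μ X) (hY : IsLittleOP μ Y) :
    IsLittleOP μ fun m ω => X m ω + Y m ω := by
  intro ε hε
  have h := (hX (ε / 2) (ENNReal.half_pos hε.ne')).add (hY (ε / 2) (ENNReal.half_pos hε.ne'))
  rw [add_zero] at h
  refine tendsto_of_tendsto_of_tendsto_of_le_of_le tendsto_const_nhds h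
    (fun _ => zero_le) fun m => (measure_mono fun ω hω => ?_).trans (measure_union_le _ _)
  by_contra hcon
  simp only [Set.mem_union, Set.mem_ofPred_eq, not_or, not_lt] at hcon hω
  exact absurd ((add_le_add hcon.1 hcon.2).trans (ENNReal.add_halves ε).le) (not_le.2 hω)

theorem IsLittleOP.sum {ι : Type*} (s : Finset ι) {X : ι → ℕ → Ω → ℝ≥0∞}
    (hX : ∀ i ∈ s, IsLittleOP μ (X i)) : IsLittleOP μ fun m ω => ∑ i ∈ s, X i m ω := by
  classical
  induction s using Finset.induction_on with
  | empty => intro ε _; simp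
  | insert i s hi ih =>
    simp_rw [Finset.sum_insert hi]
    exact (hX i (Finset.mem_insert_self _ _)).add
      (ih fun j hj => hX j (Finset.mem_insert_of_mem hj))

theorem IsLittleOP.const_mul {X : ℕ → Ω → ℝ≥0∞} (hX : IsLittleOP μ X) {a : ℝ≥0∞} (ha : a ≠ ∞) :
    IsLittleOP μ fun m ω => a * X m ω := by
  intro ε hε
  rcases eq_or_ne a 0 with rfl | h0
  · simp
  · have h := hX (ε / a) (ENNReal.div_pos hε.ne' ha)
    refine tendsto_of_tendsto_of_tendsto_of_le_of_le tendsto_const_nhds h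
      (fun _ => zero_le) fun m => measure_mono fun ω hω => ?_
    exact (ENNReal.div_lt_iff (Or.inl h0) (Or.inl ha)).2 (by rw [mul_comm]; exact hω)

theorem IsBigOP.mul {X Y : ℕ → Ω → ℝ≥0∞} {r s : ℕ → ℝ} (hX : IsBigOP μ X r) (hY : IsBigOP μ Y s)
    (hr : ∀ m, 0 < r m) (hs : ∀ m, 0 < s m) :
    IsBigOP μ (fun m ω => X m ω * Y m ω) fun m => r m * s m := by
  intro δ hδ
  obtain ⟨M₁, h₁⟩ := hX (δ / 2) (by positivity)
  obtain ⟨M₂, h₂⟩ := hY (δ / 2) (by positivity)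
  refine ⟨|M₁| * |M₂|, ?_⟩
  filter_upwards [h₁, h₂] with m k₁ k₂
  have hle : μ {ω | ENNReal.ofReal (|M₁| * |M₂| * (r m * s m)) < X m ω * Y m ω} ≤
      μ {ω | ENNReal.ofReal (M₁ * r m) < X m ω} + μ {ω | ENNReal.ofReal (M₂ * s m) < Y m ω} := by
    refine (measure_mono fun ω hω => ?_).trans (measure_union_le _ _)
    by_contra hcon
    simp only [Set.mem_union, Set.mem_ofPred_eq, not_or, not_lt] at hcon hω
    refine absurd ((mul_le_mul' hcon.1 hcon.2).trans ?_) (not_le.2 hω)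
    have := hr m; have := hs m
    calc ENNReal.ofReal (M₁ * r m) * ENNReal.ofReal (M₂ * s m)
        ≤ ENNReal.ofReal (|M₁| * r m) * ENNReal.ofReal (|M₂| * s m) := by
          gcongr <;> exact le_abs_self _
      _ = ENNReal.ofReal (|M₁| * |M₂| * (r m * s m)) := by
          rw [← ENNReal.ofReal_mul (by positivity)]; ring_nf
  refine hle.trans ((add_le_add k₁ k₂).trans ?_)
  rw [← ENNReal.ofReal_add (by positivity) (by positivity), add_halves]

/-- If `X_m = O_P(r_m)` and `a_m r_m → 0`, then `a_m X_m = o_P(1)`. -/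
theorem IsBigOP.isLittleOP_mul {X : ℕ → Ω → ℝ≥0∞} {r a : ℕ → ℝ} (hX : IsBigOP μ X r)
    (ha : ∀ m, 0 ≤ a m) (har : Tendsto (fun m => a m * r m) atTop (𝓝 0)) :
    IsLittleOP μ fun m ω => ENNReal.ofReal (a m) * X m ω := by
  intro ε hε
  rw [ENNReal.tendsto_nhds_zero]
  intro δ hδ
  -- it suffices to consider a finite `δ`
  obtain ⟨δ', hδ'0, hδ'⟩ : ∃ δ' : ℝ, 0 < δ' ∧ ENNReal.ofReal δ' ≤ δ := by
    rcases eq_or_ne δ ∞ with rfl | ht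
    · exact ⟨1, one_pos, le_top⟩
    · exact ⟨δ.toReal, ENNReal.toReal_pos hδ.ne' ht, (ENNReal.ofReal_toReal ht).le⟩
  obtain ⟨M, hM⟩ := hX δ' hδ'0
  have hlim : Tendsto (fun m => ENNReal.ofReal (M * (a m * r m))) atTop (𝓝 0) := by
    simpa using ENNReal.tendsto_ofReal (har.const_mul M)
  filter_upwards [hM, hlim.eventually_lt_const hε] with m h1 h2
  refine (measure_mono fun ω hω => ?_).trans (h1.trans hδ')
  by_contra hcon
  simp only [Set.mem_ofPred_eq, not_lt] at hcon hω
  refine absurd (hω.trans_le (mul_le_mul_right hcon _)) (not_lt.2 ?_)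
  rw [← ENNReal.ofReal_mul (ha m)]
  refine le_trans (le_of_eq ?_) h2.le
  congr 1; ring

theorem IsBigOP.isLittleOP {X : ℕ → Ω → ℝ≥0∞} {r : ℕ → ℝ} (hX : IsBigOP μ X r)
    (hr : Tendsto r atTop (𝓝 0)) : IsLittleOP μ X := by
  have h := hX.isLittleOP_mul (a := fun _ => 1) (fun _ => zero_le_one) (by simpa using hr)
  simpa using h

theorem IsLittleOP.tendstoInMeasure {X : ℕ → Ω → ℝ} (h : IsLittleOP μ fun m ω => ‖X m ω‖ₑ) :
    TendstoInMeasure μ X atTop 0 := by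
  rw [tendstoInMeasure_iff_enorm]
  intro ε hε ht
  refine tendsto_of_tendsto_of_tendsto_of_le_of_le tendsto_const_nhds
    (h (ε / 2) (ENNReal.half_pos hε.ne')) (fun _ => zero_le) fun m => measure_mono fun ω hω => ?_
  have : ε ≤ ‖X m ω‖ₑ := by simpa using hω
  exact (ENNReal.half_lt_self hε.ne' ht).trans_le this

end StochasticOrder

/-! ### Sums over a group of functions fitted outside of the group -/

section OutOfFold

variable {𝒪 : Type*} [MeasurableSpace 𝒪] {P : Measure 𝒪} [IsProbabilityMeasure P]

/-- Chebyshev's inequality for a sum of i.i.d. centred variables. -/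
theorem pi_abs_sum_ge_le {ι : Type*} [Fintype ι] {h : 𝒪 → ℝ} (hm : Measurable h)
    (h2 : ∫⁻ o, ‖h o‖ₑ ^ 2 ∂P < ∞) (h0 : ∫ o, h o ∂P = 0) {δ : ℝ} (hδ : 0 < δ) :
    Measure.pi (fun _ : ι => P) {z | δ ≤ |∑ i, h (z i)|} ≤
      Fintype.card ι * (∫⁻ o, ‖h o‖ₑ ^ 2 ∂P) / ENNReal.ofReal (δ ^ 2) := by
  classical
  have hL : MemLp h 2 P := by
    rw [memLp_two_iff_integrable_sq hm.aestronglyMeasurable]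
    refine ⟨(hm.pow_const 2).aestronglyMeasurable, ?_⟩
    simpa [HasFiniteIntegral, enorm_pow] using h2
  have hmp : ∀ i : ι, MeasurePreserving (Function.eval i) (Measure.pi fun _ : ι => P) P :=
    fun i => measurePreserving_eval (fun _ : ι => P) i
  have hLi : ∀ i : ι, MemLp (fun z : ι → 𝒪 => h (z i)) 2 (Measure.pi fun _ : ι => P) := fun i =>
    hL.comp_measurePreserving (hmp i)
  have hindep : iIndepFun (fun (i : ι) (z : ι → 𝒪) => h (z i)) (Measure.pi fun _ : ι => P) :=
    iIndepFun_pi fun i => hm.aemeasurable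
  have hvar1 : ∀ i : ι, variance (fun z : ι → 𝒪 => h (z i)) (Measure.pi fun _ : ι => P) =
      variance h P := fun i => by
    have := variance_map (X := h) (μ := Measure.pi fun _ : ι => P) (Y := Function.eval i)
      hm.aemeasurable (hmp i).measurable.aemeasurable
    rw [(hmp i).map_eq] at this
    exact this.symm
  have hvar : variance (∑ i, fun z : ι → 𝒪 => h (z i)) (Measure.pi fun _ : ι => P) =
      Fintype.card ι * variance h P := by
    rw [IndepFun.variance_sum (fun i _ => hLi i) fun i _ j _ hij => hindep.indepFun hij]
    simp [hvar1]
  have hmean : ∫ z, (∑ i, fun z : ι → 𝒪 => h (z i)) z ∂(Measure.pi fun _ : ι => P) = 0 := by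
    simp only [Finset.sum_apply]
    rw [integral_finsetSum _ fun i _ => (hLi i).integrable (by norm_num)]
    refine Finset.sum_eq_zero fun i _ => ?_
    have := integral_map (μ := Measure.pi fun _ : ι => P) (φ := Function.eval i) (f := h)
      (hmp i).measurable.aemeasurable hm.aestronglyMeasurable
    rw [(hmp i).map_eq, h0] at this
    exact this.symm
  have hch := meas_ge_le_variance_div_sq (memLp_finsetSum' Finset.univ fun i _ => hLi i) hδ
  rw [hmean, hvar] at hch
  simp only [Finset.sum_apply, sub_zero] at hch
  refine hch.trans (le_of_eq ?_)
  rw [ENNReal.ofReal_div_of_pos (by positivity), ENNReal.ofReal_mul (by positivity),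
    hL.ofReal_variance_eq, ENNReal.ofReal_natCast, mul_div_assoc, mul_div_assoc]
  simp [evariance, h0]

theorem measurable_lintegral_enorm_sq {Z : Type*} [MeasurableSpace Z] {h : Z → 𝒪 → ℝ}
    (hm : Measurable fun p : Z × 𝒪 => h p.1 p.2) :
    Measurable fun z => ∫⁻ o, ‖h z o‖ₑ ^ 2 ∂P :=
  Measurable.lintegral_prod_right' (f := fun p : Z × 𝒪 => ‖h p.1 p.2‖ₑ ^ 2)
    (hm.enorm.pow_const 2)

/-- Given the data outside of a group, the data of the group are still i.i.d., so that Chebyshev's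
inequality holds for functions fitted outside of the group. -/
theorem pi_abs_sum_fold_ge_le {ι : Type*} [Fintype ι] (p : ι → Prop) [DecidablePred p]
    {h : ({i // p i} → 𝒪) → 𝒪 → ℝ}
    (hm : Measurable fun q : ({i // p i} → 𝒪) × 𝒪 => h q.1 q.2)
    (h0 : ∀ x, ∫⁻ o, ‖h x o‖ₑ ^ 2 ∂P < ∞ → ∫ o, h x o ∂P = 0) {δ : ℝ} (hδ : 0 < δ)
    {τ : ℝ≥0∞} (hτ : τ ≠ ∞) :
    Measure.pi (fun _ : ι => P) {D | δ ≤ |∑ i : {i // ¬ p i}, h (fun j => D j) (D i)| ∧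
      Fintype.card {i // ¬ p i} * ∫⁻ o, ‖h (fun j => D j) o‖ₑ ^ 2 ∂P ≤ τ} ≤
      τ / ENNReal.ofReal (δ ^ 2) := by
  set A : Set (({i // p i} → 𝒪) × ({i // ¬ p i} → 𝒪)) :=
    {q | δ ≤ |∑ i : {i // ¬ p i}, h q.1 (q.2 i)| ∧
      Fintype.card {i // ¬ p i} * ∫⁻ o, ‖h q.1 o‖ₑ ^ 2 ∂P ≤ τ} with hA
  have hAm : MeasurableSet A := by
    have h1 : Measurable fun q : ({i // p i} → 𝒪) × ({i // ¬ p i} → 𝒪) =>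
        |∑ i : {i // ¬ p i}, h q.1 (q.2 i)| := by
      refine (Finset.measurable_sum _ fun i _ => ?_).abs
      exact hm.comp (f := fun q : ({i // p i} → 𝒪) × ({i // ¬ p i} → 𝒪) => (q.1, q.2 i))
        (by fun_prop)
    have h2 : Measurable fun q : ({i // p i} → 𝒪) × ({i // ¬ p i} → 𝒪) =>
        Fintype.card {i // ¬ p i} * ∫⁻ o, ‖h q.1 o‖ₑ ^ 2 ∂P :=
      ((measurable_lintegral_enorm_sq hm).comp measurable_fst).const_mul _
    exact (measurableSet_le measurable_const h1).inter (measurableSet_le h2 measurable_const)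
  have hmp := measurePreserving_piEquivPiSubtypeProd (fun _ : ι => P) p
  have hpre : {D : ι → 𝒪 | δ ≤ |∑ i : {i // ¬ p i}, h (fun j => D j) (D i)| ∧
      Fintype.card {i // ¬ p i} * ∫⁻ o, ‖h (fun j => D j) o‖ₑ ^ 2 ∂P ≤ τ} =
      MeasurableEquiv.piEquivPiSubtypeProd (fun _ : ι => 𝒪) p ⁻¹' A := rfl
  rw [hpre, hmp.measure_preimage hAm.nullMeasurableSet, Measure.prod_apply hAm]
  calc _ ≤ ∫⁻ _x : {i // p i} → 𝒪, τ / ENNReal.ofReal (δ ^ 2)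
        ∂(Measure.pi fun _ : {i // p i} => P) := by
        refine lintegral_mono fun x => ?_
        rcases isEmpty_or_nonempty {i // ¬ p i} with hE | hE
        · have : Prod.mk x ⁻¹' A = ∅ := by
            ext y
            simp [hA, hδ]
          simp [this]
        by_cases hx : Fintype.card {i // ¬ p i} * ∫⁻ o, ‖h x o‖ₑ ^ 2 ∂P ≤ τ
        · have hfin : ∫⁻ o, ‖h x o‖ₑ ^ 2 ∂P < ∞ := by
            by_contra hcon
            rw [not_lt, top_le_iff] at hcon
            rw [hcon, ENNReal.mul_top (Nat.cast_ne_zero.2 Fintype.card_ne_zero)] at hx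
            exact hτ (top_le_iff.1 hx)
          have hxm : Measurable (h x) := hm.comp measurable_prodMk_left
          refine (measure_mono fun y hy => ?_).trans
            ((pi_abs_sum_ge_le (ι := {i // ¬ p i}) hxm hfin (h0 x hfin) hδ).trans ?_)
          · exact hy.1
          · exact ENNReal.div_le_div_right hx _
        · have : Prod.mk x ⁻¹' A = ∅ := by
            ext y
            simp only [hA, Set.mem_preimage, Set.mem_ofPred_eq, Set.mem_empty_iff_false, iff_false,
              not_and]
            exact fun _ => hx
          simp [this]
    _ = _ := by simp

variable {Ω : Type*} [MeasurableSpace Ω] {μ : Measure Ω} [IsProbabilityMeasure μ]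
  {U : Type*} [MeasurableSpace U] {K : ℕ}

/-- Chebyshev's inequality for the group `k` of a random split: the functions `h` are fitted from the
split, the seed and the data outside of the group, and `τ` truncates their conditional variance. -/
theorem abs_sum_group_ge_le {m : ℕ} {S : Ω → Fin m → Fin K} (hS : Measurable S) {u : Ω → U}
    (hu : Measurable u) {D : Ω → Fin m → 𝒪} (hD : Measurable D)
    (hDlaw : μ.map D = Measure.pi fun _ => P)
    (hindep : IndepFun (fun ω => (S ω, u ω)) D μ) (k : Fin K)
    {h : (s : Fin m → Fin K) → U → ({i : Fin m // s i ≠ k} → 𝒪) → 𝒪 → ℝ}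
    (hm : ∀ s, Measurable fun q : U × ({i : Fin m // s i ≠ k} → 𝒪) × 𝒪 => h s q.1 q.2.1 q.2.2)
    (h0 : ∀ s v x, ∫⁻ o, ‖h s v x o‖ₑ ^ 2 ∂P < ∞ → ∫ o, h s v x o ∂P = 0) {δ : ℝ} (hδ : 0 < δ)
    {τ : ℝ≥0∞} (hτ : τ ≠ ∞) :
    μ {ω | δ ≤ |∑ i ∈ Finset.univ.filter (fun i => S ω i = k),
        h (S ω) (u ω) (fun j => D ω j) (D ω i)|} ≤
      μ {ω | τ < groupSize (S ω) k * ∫⁻ o, ‖h (S ω) (u ω) (fun j => D ω j) o‖ₑ ^ 2 ∂P} +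
        τ / ENNReal.ofReal (δ ^ 2) := by
  set A : Set (((Fin m → Fin K) × U) × (Fin m → 𝒪)) :=
    {q | δ ≤ |∑ i ∈ Finset.univ.filter (fun i => q.1.1 i = k),
        h q.1.1 q.1.2 (fun j => q.2 j) (q.2 i)| ∧
      groupSize q.1.1 k * ∫⁻ o, ‖h q.1.1 q.1.2 (fun j => q.2 j) o‖ₑ ^ 2 ∂P ≤ τ} with hA
  have hAm : MeasurableSet A := by
    have h1 : Measurable fun q : ((Fin m → Fin K) × U) × (Fin m → 𝒪) =>
        |∑ i ∈ Finset.univ.filter (fun i => q.1.1 i = k),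
          h q.1.1 q.1.2 (fun j => q.2 j) (q.2 i)| := by
      have h1 : Measurable fun q : (Fin m → Fin K) × (U × (Fin m → 𝒪)) =>
          |∑ i ∈ Finset.univ.filter (fun i => q.1 i = k),
            h q.1 q.2.1 (fun j => q.2.2 j) (q.2.2 i)| := by
        refine measurable_from_prod_countable_right fun s => ?_
        change Measurable fun q : U × (Fin m → 𝒪) =>
          |∑ i ∈ Finset.univ.filter (fun i => s i = k), h s q.1 (fun j => q.2 j) (q.2 i)|
        refine (Finset.measurable_sum _ fun i _ => ?_).abs
        exact (hm s).comp (f := fun q : U × (Fin m → 𝒪) =>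
          (q.1, (fun j : {i : Fin m // s i ≠ k} => q.2 j), q.2 i)) (by fun_prop)
      exact h1.comp (f := fun q : ((Fin m → Fin K) × U) × (Fin m → 𝒪) => (q.1.1, q.1.2, q.2))
        (by fun_prop)
    have h2 : Measurable fun q : ((Fin m → Fin K) × U) × (Fin m → 𝒪) =>
        groupSize q.1.1 k * ∫⁻ o, ‖h q.1.1 q.1.2 (fun j => q.2 j) o‖ₑ ^ 2 ∂P := by
      have h1 : Measurable fun q : (Fin m → Fin K) × (U × (Fin m → 𝒪)) =>
          groupSize q.1 k * ∫⁻ o, ‖h q.1 q.2.1 (fun j => q.2.2 j) o‖ₑ ^ 2 ∂P := by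
        refine measurable_from_prod_countable_right fun s => ?_
        change Measurable fun q : U × (Fin m → 𝒪) =>
          groupSize s k * ∫⁻ o, ‖h s q.1 (fun j => q.2 j) o‖ₑ ^ 2 ∂P
        refine Measurable.const_mul ?_ _
        refine measurable_lintegral_enorm_sq
          (h := fun q : U × (Fin m → 𝒪) => h s q.1 fun j => q.2 j) ?_
        exact (hm s).comp (f := fun q : (U × (Fin m → 𝒪)) × 𝒪 =>
          (q.1.1, (fun j : {i : Fin m // s i ≠ k} => q.1.2 j), q.2)) (by fun_prop)
      exact h1.comp (f := fun q : ((Fin m → Fin K) × U) × (Fin m → 𝒪) => (q.1.1, q.1.2, q.2))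
        (by fun_prop)
    exact (measurableSet_le measurable_const h1).inter (measurableSet_le h2 measurable_const)
  have hSu : Measurable fun ω => (S ω, u ω) := hS.prodMk hu
  have hjoint : Measurable fun ω => ((S ω, u ω), D ω) := hSu.prodMk hD
  have hlaw := (indepFun_iff_map_prod_eq_prod_map_map hSu.aemeasurable hD.aemeasurable).1 hindep
  have hprob : IsProbabilityMeasure (μ.map fun ω => (S ω, u ω)) :=
    Measure.isProbabilityMeasure_map hSu.aemeasurable
  have hbound : μ ((fun ω => ((S ω, u ω), D ω)) ⁻¹' A) ≤ τ / ENNReal.ofReal (δ ^ 2) := by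
    rw [← Measure.map_apply hjoint hAm, hlaw, hDlaw, Measure.prod_apply hAm]
    calc _ ≤ ∫⁻ _q, τ / ENNReal.ofReal (δ ^ 2) ∂(μ.map fun ω => (S ω, u ω)) := by
          refine lintegral_mono fun q => ?_
          obtain ⟨s, v⟩ := q
          refine le_trans (measure_mono fun y hy => ?_) (pi_abs_sum_fold_ge_le (P := P)
            (fun i => s i ≠ k) (h := h s v) ((hm s).comp measurable_prodMk_left) (h0 s v) hδ hτ)
          have hcard : Fintype.card {i // ¬ s i ≠ k} = groupSize s k := by
            rw [groupSize, Fintype.card_subtype]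
            simp
          have hsum : ∀ f : Fin m → ℝ, ∑ i : {i // ¬ s i ≠ k}, f i =
              ∑ i ∈ Finset.univ.filter (fun i => s i = k), f i := by
            intro f
            exact (Finset.sum_subtype _ (by simp) f).symm
          simp only [hA, Set.mem_preimage, Set.mem_ofPred_eq] at hy ⊢
          rw [hcard, hsum fun i => h s v (fun j => y j) (y i)]
          exact hy
      _ = _ := by simp
  refine le_trans (measure_mono fun ω hω => ?_)
    ((measure_union_le _ _).trans (add_le_add le_rfl hbound))
  by_cases hc : τ < groupSize (S ω) k * ∫⁻ o, ‖h (S ω) (u ω) (fun j => D ω j) o‖ₑ ^ 2 ∂P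
  · exact Or.inl hc
  · exact Or.inr ⟨hω, not_lt.1 hc⟩

/-- Sums over a group of functions fitted outside of the group are negligible, once their
conditional variances are. -/
theorem isLittleOP_sum_group {S : (m : ℕ) → Ω → Fin m → Fin K} (hS : ∀ m, Measurable (S m))
    {u : ℕ → Ω → U} (hu : ∀ m, Measurable (u m)) {O : ℕ → Ω → 𝒪} (hO : ∀ i, Measurable (O i))
    (hlaw : ∀ i, μ.map (O i) = P) (hOi : iIndepFun O μ)
    (hindep : ∀ m, IndepFun (fun ω => (S m ω, u m ω)) (fun ω (i : Fin m) => O i ω) μ)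
    (k : Fin K)
    {h : (m : ℕ) → (s : Fin m → Fin K) → U → ({i : Fin m // s i ≠ k} → 𝒪) → 𝒪 → ℝ}
    (hm : ∀ m s, Measurable fun q : U × ({i : Fin m // s i ≠ k} → 𝒪) × 𝒪 =>
      h m s q.1 q.2.1 q.2.2)
    (h0 : ∀ m s v x, ∫⁻ o, ‖h m s v x o‖ₑ ^ 2 ∂P < ∞ → ∫ o, h m s v x o ∂P = 0)
    (hV : IsLittleOP μ fun m ω => groupSize (S m ω) k *
      ∫⁻ o, ‖h m (S m ω) (u m ω) (fun j => O j ω) o‖ₑ ^ 2 ∂P) :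
    IsLittleOP μ fun m ω => ‖∑ i ∈ Finset.univ.filter (fun i => S m ω i = k),
      h m (S m ω) (u m ω) (fun j => O j ω) (O i ω)‖ₑ := by
  have hDlaw : ∀ m : ℕ, μ.map (fun ω (i : Fin m) => O i ω) = Measure.pi fun _ => P := by
    intro m
    have := (iIndepFun_iff_map_fun_eq_pi_map (μ := μ) (f := fun i : Fin m => O i)
      fun i => (hO i).aemeasurable).1 (hOi.precomp Fin.val_injective)
    rw [this]
    simp [hlaw]
  have hD : ∀ m : ℕ, Measurable fun ω (i : Fin m) => O i ω := fun m =>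
    measurable_pi_lambda _ fun i => hO i
  intro ε hε
  rw [ENNReal.tendsto_nhds_zero]
  intro ρ hρ
  obtain ⟨δ, hδ, hδε⟩ : ∃ δ : ℝ, 0 < δ ∧ ENNReal.ofReal δ ≤ ε := by
    rcases eq_or_ne ε ∞ with rfl | ht
    · exact ⟨1, one_pos, le_top⟩
    · exact ⟨ε.toReal, ENNReal.toReal_pos hε.ne' ht, (ENNReal.ofReal_toReal ht).le⟩
  -- the truncation level of the conditional variance
  obtain ⟨τ, hτ0, hτ, hτρ⟩ : ∃ τ : ℝ≥0∞, 0 < τ ∧ τ ≠ ∞ ∧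
      τ / ENNReal.ofReal (δ ^ 2) ≤ ρ / 2 := by
    have hd0 : ENNReal.ofReal (δ ^ 2) ≠ 0 := by simp; positivity
    refine ⟨min 1 (ρ / 2 * ENNReal.ofReal (δ ^ 2)), ?_, ?_, ?_⟩
    · exact lt_min one_pos (ENNReal.mul_pos (ENNReal.half_pos hρ.ne').ne' hd0)
    · exact ((min_le_left _ _).trans_lt ENNReal.one_lt_top).ne
    · exact ENNReal.div_le_of_le_mul (min_le_right _ _)
  filter_upwards [(ENNReal.tendsto_nhds_zero.1 (hV τ hτ0)) (ρ / 2) (ENNReal.half_pos hρ.ne')]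
    with m hm'
  have hkey := abs_sum_group_ge_le (hS m) (hu m) (hD m) (hDlaw m) (hindep m) k (hm m) (h0 m) hδ hτ
  refine le_trans (measure_mono fun ω hω => ?_) (hkey.trans
    ((add_le_add hm' hτρ).trans (ENNReal.add_halves ρ).le))
  have h1 := hδε.trans (le_of_lt hω)
  rw [Real.enorm_eq_ofReal_abs] at h1
  exact (ENNReal.ofReal_le_ofReal_iff (abs_nonneg _)).1 h1

end OutOfFold

/-! ### One-dimensional submodels -/

section Submodel

variable {d : ℕ} {P : Measure (Obs d)} [IsProbabilityMeasure P] {g : Obs d → ℝ} {B : ℝ} {ε : ℝ}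

/-- Near `ε = 0` the density `1 + ε g` of the submodel is bounded away from zero. -/
theorem one_add_mul_score_mem (hB : ∀ o, |g o| ≤ B) (hε : |ε| * B ≤ 1 / 2) (o : Obs d) :
    1 / 2 ≤ 1 + ε * g o ∧ 1 + ε * g o ≤ 3 / 2 := by
  have h : |ε * g o| ≤ 1 / 2 := by
    rw [abs_mul]
    exact (mul_le_mul_of_nonneg_left (hB o) (abs_nonneg _)).trans hε
  rw [abs_le] at h
  constructor <;> linarith

theorem integrable_score (hg : Measurable g) (hB : ∀ o, |g o| ≤ B) : Integrable g P :=
  integrable_of_abs_le hg (ae_of_all _ hB)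

theorem isProbabilityMeasure_submodel (hg : IsScore P g) (hB : ∀ o, |g o| ≤ B)
    (hε : |ε| * B ≤ 1 / 2) : IsProbabilityMeasure (submodel P g ε) := by
  constructor
  rw [submodel, withDensity_apply _ MeasurableSet.univ, Measure.restrict_univ,
    ← ofReal_integral_eq_lintegral_ofReal, integral_add (integrable_const _)
    ((integrable_score hg.1 hB).const_mul _), integral_const_mul, hg.2.2]
  · simp
  · exact (integrable_const _).add ((integrable_score hg.1 hB).const_mul _)
  · exact ae_of_all _ fun o => by
      have := (one_add_mul_score_mem hB hε o).1
      change (0 : ℝ) ≤ 1 + ε * g o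
      linarith

theorem integral_submodel {P : Measure (Obs d)} (hg : Measurable g)
    (hB : ∀ o, |g o| ≤ B) (hε : |ε| * B ≤ 1 / 2)
    (f : Obs d → ℝ) : ∫ o, f o ∂(submodel P g ε) = ∫ o, (1 + ε * g o) * f o ∂P := by
  rw [submodel, integral_withDensity_eq_integral_toReal_smul (by fun_prop) (by simp)]
  refine integral_congr_ae (ae_of_all _ fun o => ?_)
  have := (one_add_mul_score_mem hB hε o).1
  simp only [smul_eq_mul]
  rw [ENNReal.toReal_ofReal (by linarith)]

theorem setIntegral_submodel {P : Measure (Obs d)} (hg : Measurable g)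
    (hB : ∀ o, |g o| ≤ B) (hε : |ε| * B ≤ 1 / 2)
    (f : Obs d → ℝ) {s : Set (Obs d)} (hs : MeasurableSet s) :
    ∫ o in s, f o ∂(submodel P g ε) = ∫ o in s, (1 + ε * g o) * f o ∂P := by
  rw [← integral_indicator hs, ← integral_indicator hs, integral_submodel hg hB hε]
  refine integral_congr_ae (ae_of_all _ fun o => ?_)
  by_cases ho : o ∈ s <;> simp [ho]

theorem integrable_submodel_iff {P : Measure (Obs d)} (hg : Measurable g)
    (hB : ∀ o, |g o| ≤ B) (hε : |ε| * B ≤ 1 / 2)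
    (f : Obs d → ℝ) :
    Integrable f (submodel P g ε) ↔ Integrable (fun o => (1 + ε * g o) * f o) P := by
  rw [submodel, integrable_withDensity_iff_integrable_smul' (by fun_prop) (by simp)]
  refine integrable_congr (ae_of_all _ fun o => ?_)
  have := (one_add_mul_score_mem hB hε o).1
  simp only [smul_eq_mul]
  rw [ENNReal.toReal_ofReal (by linarith)]

/-- Bayes' formula for the conditional expectation given `(A, X, N)` under a submodel. -/
theorem condAXN_submodel (hg : IsScore P g) (hB : ∀ o, |g o| ≤ B) (hε : |ε| * B ≤ 1 / 2)
    {f : Obs d → ℝ} (hf : Integrable f P) :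
    ∀ᵐ o ∂P, condAXN (submodel P g ε) f o.N o.A o.X * (1 + ε * condAXN P g o.N o.A o.X) =
      condAXN P f o.N o.A o.X + ε * condAXN P (fun o => f o * g o) o.N o.A o.X := by
  have hQ := isProbabilityMeasure_submodel hg hB hε
  set Q := submodel P g ε with hQdef
  set mA : MeasurableSpace (Obs d) := MeasurableSpace.comap Obs.AXN inferInstance
  have hgi : Integrable g P := integrable_score hg.1 hB
  have hfg : Integrable (fun o => f o * g o) P :=
    hf.mul_bdd (c := B) hg.1.aestronglyMeasurable (ae_of_all _ hB)
  have hpi : Integrable (fun o => 1 + ε * g o) P := (integrable_const _).add (hgi.const_mul _)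
  have hpf : Integrable (fun o => (1 + ε * g o) * f o) P := by
    refine (hf.add (hfg.const_mul ε)).congr (ae_of_all _ fun o => ?_)
    simp only [Pi.add_apply]; ring
  have hfQ : Integrable f Q := (integrable_submodel_iff hg.1 hB hε f).2 hpf
  have hcQ : Integrable (fun o => (1 + ε * g o) * (Q[f | mA]) o) P :=
    (integrable_submodel_iff hg.1 hB hε _).1 integrable_condExp
  have hcm : StronglyMeasurable[mA] (Q[f | mA]) := stronglyMeasurable_condExp
  have hcQ' : Integrable (fun o => (Q[f | mA]) o * (1 + ε * g o)) P := by
    simpa only [mul_comm] using hcQ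
  have hpull : P[fun o => (Q[f | mA]) o * (1 + ε * g o) | mA] =ᵐ[P]
      fun o => (Q[f | mA]) o * (P[fun o => 1 + ε * g o | mA]) o :=
    condExp_mul_of_stronglyMeasurable_left hcm hcQ' hpi
  -- both sides have the same integrals over the sets of the σ-algebra
  have hmain : P[fun o => (Q[f | mA]) o * (1 + ε * g o) | mA] =ᵐ[P]
      P[fun o => (1 + ε * g o) * f o | mA] := by
    refine ae_eq_condExp_of_forall_setIntegral_eq comap_AXN_le hpf
      (fun s _ _ => integrable_condExp.integrableOn) (fun s hs _ => ?_)
      stronglyMeasurable_condExp.aestronglyMeasurable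
    rw [setIntegral_condExp comap_AXN_le hcQ' hs,
      ← setIntegral_submodel hg.1 hB hε f (comap_AXN_le s hs),
      ← setIntegral_condExp comap_AXN_le hfQ hs,
      setIntegral_submodel hg.1 hB hε _ (comap_AXN_le s hs)]
    exact integral_congr_ae (ae_of_all _ fun o => mul_comm _ _)
  have e1 : P[fun o => 1 + ε * g o | mA] =ᵐ[P] fun o => 1 + ε * (P[g | mA]) o := by
    have h1 := condExp_add (μ := P) (integrable_const (1 : ℝ)) (hgi.const_mul ε) mA
    have h2 := condExp_smul (μ := P) ε g mA
    have h3 : P[fun _ : Obs d => (1 : ℝ) | mA] = fun _ => 1 := condExp_const comap_AXN_le 1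
    filter_upwards [h1, h2] with o h1 h2
    have : (P[fun o => 1 + ε * g o | mA]) o = (P[fun _ => (1 : ℝ) | mA] +
      P[fun o => ε * g o | mA]) o := h1
    rw [this, Pi.add_apply, h3]
    have h2' : (P[fun o => ε * g o | mA]) o = ε * (P[g | mA]) o := h2
    rw [h2']
  have e2 : P[fun o => (1 + ε * g o) * f o | mA] =ᵐ[P]
      fun o => (P[f | mA]) o + ε * (P[fun o => f o * g o | mA]) o := by
    have h1 := condExp_add (μ := P) hf (hfg.const_mul ε) mA
    have h2 := condExp_smul (μ := P) ε (fun o => f o * g o) mA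
    have h3 : (fun o => (1 + ε * g o) * f o) = f + fun o => ε * (f o * g o) := by
      funext o; simp only [Pi.add_apply]; ring
    rw [h3]
    filter_upwards [h1, h2] with o h1 h2
    rw [h1, Pi.add_apply]
    have h2' : (P[fun o => ε * (f o * g o) | mA]) o = ε * (P[fun o => f o * g o | mA]) o := h2
    rw [h2']
  filter_upwards [hpull, hmain, e1, e2] with o k1 k2 k3 k4
  rw [condAXN_apply, condAXN_apply, condAXN_apply, condAXN_apply]
  rw [k1, k4, k3] at k2
  exact k2

theorem abs_condAXN_le {P : Measure (Obs d)} (hB : ∀ o, |g o| ≤ B) :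
    ∀ᵐ o ∂P, |condAXN P g o.N o.A o.X| ≤ B := by
  have h := ae_bdd_abs_condExp_of_ae_bdd_abs
    (m := MeasurableSpace.comap (Obs.AXN (d := d)) inferInstance) (μ := P) (R := B) (f := g) (ae_of_all _ hB)
  filter_upwards [h] with o ho
  rw [condAXN_apply]
  exact ho

theorem abs_condXN_le {P : Measure (Obs d)} (hB : ∀ o, |g o| ≤ B) :
    ∀ᵐ o ∂P, |condXN P g o.N o.X| ≤ B := by
  have h := ae_bdd_abs_condExp_of_ae_bdd_abs
    (m := MeasurableSpace.comap (Obs.XN (d := d)) inferInstance) (μ := P) (R := B) (f := g) (ae_of_all _ hB)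
  filter_upwards [h] with o ho
  rw [condXN_apply]
  exact ho

/-- Conditional means of products with bounded functions are bounded, since `|y| ≤ 1 + y²`. -/
theorem abs_condAXN_mul_le {f : Obs d → ℝ} (hf : Integrable f P)
    (hf2 : Integrable (fun o => f o ^ 2) P) {D : ℝ}
    (hD : ∀ᵐ o ∂P, |condAXN P (fun o => f o ^ 2) o.N o.A o.X| ≤ D) (hg : Measurable g)
    (hB0 : 0 ≤ B) (hB : ∀ o, |g o| ≤ B) :
    ∀ᵐ o ∂P, |condAXN P (fun o => f o * g o) o.N o.A o.X| ≤ B * (1 + D) := by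
  set mA : MeasurableSpace (Obs d) := MeasurableSpace.comap Obs.AXN inferInstance
  have hfg : Integrable (fun o => f o * g o) P :=
    hf.mul_bdd (c := B) hg.aestronglyMeasurable (ae_of_all _ hB)
  set af : Obs d → ℝ := |fun o => f o * g o| with haf
  have h1 := abs_condExp_ae_le_condExp_abs (μ := P) (m := mA) (fun o => f o * g o)
  have hi : Integrable (fun o => B * (1 + f o ^ 2)) P :=
    ((integrable_const _).add hf2).const_mul B
  have h2 : P[af | mA] ≤ᵐ[P] P[fun o => B * (1 + f o ^ 2) | mA] := by
    refine condExp_mono hfg.abs hi (ae_of_all _ fun o => ?_)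
    change |f o * g o| ≤ B * (1 + f o ^ 2)
    rw [abs_mul, mul_comm]
    refine mul_le_mul (hB o) ?_ (abs_nonneg _) hB0
    rw [← sq_abs]
    nlinarith [sq_nonneg (|f o| - 1 / 2)]
  have h3 := condExp_smul (μ := P) B (fun o => 1 + f o ^ 2) mA
  have h4 := condExp_add (μ := P) (integrable_const (1 : ℝ)) hf2 mA
  have h5 : P[fun _ : Obs d => (1 : ℝ) | mA] = fun _ => 1 := condExp_const comap_AXN_le 1
  filter_upwards [h1, h2, h3, h4, hD] with o k1 k2 k3 k4 k5
  rw [condAXN_apply] at k5 ⊢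
  have k3' : (P[fun o => B * (1 + f o ^ 2) | mA]) o = B * (P[fun o => 1 + f o ^ 2 | mA]) o := k3
  have k4' : (P[fun o => 1 + f o ^ 2 | mA]) o =
    (P[fun _ => (1 : ℝ) | mA] + P[fun o => f o ^ 2 | mA]) o := k4
  rw [Pi.add_apply, h5] at k4'
  refine (show _ ≤ _ from k1).trans (k2.trans ?_)
  rw [k3', k4']
  have := (le_abs_self _).trans k5
  gcongr

theorem norm_le_of_abs_apply_le {n M : ℕ} (h : n ≤ M) {v : EuclideanSpace ℝ (Fin n)} {D : ℝ}
    (hD : 0 ≤ D) (hv : ∀ j, |v j| ≤ D) : ‖v‖ ≤ M * D := by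
  have h1 : ‖v‖ ≤ ∑ j, |v j| := by
    rw [EuclideanSpace.norm_eq]
    refine Real.sqrt_le_iff.2 ⟨by positivity, ?_⟩
    simpa using Finset.sum_sq_le_sq_sum_of_nonneg (s := Finset.univ) (f := fun j => ‖v j‖)
      fun j _ => norm_nonneg _
  refine h1.trans ((Finset.sum_le_sum fun j _ => hv j).trans ?_)
  simp only [Finset.sum_const, Finset.card_univ, Fintype.card_fin, nsmul_eq_mul]
  gcongr

end Submodel

/-! ### Differentiability of the estimand along submodels -/

section Derivative

variable {d : ℕ}

/-- The derivative of the outcome regression along the submodel with score `g`, that is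
`E {(Y - G) g(O) | A = a, X = x, N = n}`. -/
noncomputable def outcomeRegDeriv (P : Measure (Obs d)) (g : Obs d → ℝ) (n : ℕ) (a : Treat n)
    (x : Cov d n) : EuclideanSpace ℝ (Fin n) :=
  condScoreY P g n a x - condAXN P g n a x • outcomeReg P n a x

theorem measurable_outcomeRegDeriv (P : Measure (Obs d)) (g : Obs d → ℝ) (n : ℕ) (a : Treat n) :
    Measurable (outcomeRegDeriv P g n a) :=
  (measurable_condScoreY P g n a).sub
    ((measurable_condAXN P g n a).smul (measurable_outcomeReg P n a))

theorem measurable_condPhiScore {P : Measure (Obs d)} {φ : PhiFun d} {g : Obs d → ℝ}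
    (hφ : ∀ n a' a, Measurable fun x => φ n a' x a) (n : ℕ) (a : Treat n) :
    Measurable (condPhiScore P φ g n a) := by
  unfold condPhiScore
  exact Finset.measurable_sum _ fun a' _ => (measurable_condXN P _ n).smul (hφ n a' a)

variable {P : Measure (Obs d)} [IsProbabilityMeasure P] {η : Nuisance d} {c C B : ℝ} {M : ℕ}
  {g : Obs d → ℝ} {D ε : ℝ}

theorem norm_outcomeRegDeriv_le (h : RegularTruth P η c C M B) (hg : Measurable g) (hD0 : 0 ≤ D)
    (hD : ∀ o, |g o| ≤ D) :
    ∀ᵐ o ∂P, ∀ a : Treat o.N, |condAXN P g o.N a o.X| ≤ D ∧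
      ‖outcomeRegDeriv P g o.N a o.X‖ ≤ M * (D * (1 + B)) + D * C := by
  have hj : ∀ᵐ o ∂P, ∀ j, |condAXN P (fun o => o.unitY j * g o) o.N o.A o.X| ≤ D * (1 + B) :=
    ae_all_iff.2 fun j =>
      abs_condAXN_mul_le (h.int_Y j) (h.int_Y_sq j) (h.cond_Y_sq j) hg hD0 hD
  have hB := h.B_nonneg
  refine ae_forall_treat h.size h.pos (p := fun n a x => |condAXN P g n a x| ≤ D ∧
    ‖outcomeRegDeriv P g n a x‖ ≤ M * (D * (1 + B)) + D * C) (fun n a => ?_) ?_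
  · exact (measurableSet_le (measurable_condAXN P g n a).abs measurable_const).inter
      (measurableSet_le (measurable_outcomeRegDeriv P g n a).norm measurable_const)
  · filter_upwards [hj, abs_condAXN_le (P := P) hD, h.size, h.bdd] with o h1 h2 h3 h4
    refine ⟨h2, (norm_sub_le _ _).trans (add_le_add ?_ ?_)⟩
    · exact norm_le_of_abs_apply_le h3 (by positivity) fun j => h1 j
    · rw [norm_smul, Real.norm_eq_abs]
      have := (h4 o.A o.A).2.1
      rw [h.G_eq] at this
      exact mul_le_mul h2 this (norm_nonneg _) hD0

/-- The increment of the outcome regression along a submodel, without remainder: by Bayes' formula it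
is `ε E {(Y - G) g | A, X, N} / (1 + ε E {g | A, X, N})`. -/
theorem outcomeReg_submodel (h : RegularTruth P η c C M B) (hg : IsScore P g)
    (hD : ∀ o, |g o| ≤ D) (hε : |ε| * D ≤ 1 / 2) :
    ∀ᵐ o ∂P, ∀ a : Treat o.N, (1 + ε * condAXN P g o.N a o.X) •
      (outcomeReg (submodel P g ε) o.N a o.X - outcomeReg P o.N a o.X) =
        ε • outcomeRegDeriv P g o.N a o.X := by
  refine ae_forall_treat h.size h.pos (p := fun n a x => (1 + ε * condAXN P g n a x) •
    (outcomeReg (submodel P g ε) n a x - outcomeReg P n a x) =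
      ε • outcomeRegDeriv P g n a x) (fun n a => ?_) ?_
  · exact measurableSet_eq_fun ((measurable_const.add
      ((measurable_condAXN P g n a).const_mul ε)).smul
      ((measurable_outcomeReg _ n a).sub (measurable_outcomeReg P n a)))
      ((measurable_outcomeRegDeriv P g n a).const_smul ε)
  · filter_upwards [ae_all_iff.2 fun j => condAXN_submodel hg hD hε (h.int_Y j)] with o ho
    ext j
    have hj := ho j
    simp only [outcomeRegDeriv, outcomeReg, condScoreY, PiLp.smul_apply, PiLp.sub_apply,
      smul_eq_mul]
    linear_combination hj

theorem norm_condPhiScore_le {P : Measure (Obs d)} (h : RegularTruth P η c C M B) (hD0 : 0 ≤ D)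
    (hD : ∀ o, |g o| ≤ D) :
    ∀ᵐ o ∂P, ∀ a : Treat o.N, ‖condPhiScore P η.φ g o.N a o.X‖ ≤ 2 ^ M * (D * C) := by
  have hC := h.C_nonneg
  have h1 : ∀ᵐ o ∂P, ∀ q : Σ n : ℕ, Treat n,
      |condXN P (Set.indicator {o' | o'.AN = ⟨q.1, q.2⟩} g) o.N o.X| ≤ D :=
    ae_all_iff.2 fun q => abs_condXN_le fun o => by
      by_cases ho : o ∈ {o' : Obs d | o'.AN = ⟨q.1, q.2⟩}
      · rw [Set.indicator_of_mem ho]; exact hD o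
      · rw [Set.indicator_of_notMem ho]; simpa using hD0
  filter_upwards [h1, h.bdd, h.size] with o h1 h2 h3 a
  refine (norm_sum_le _ _).trans (sum_treat_le h3 (by positivity) fun a' => ?_)
  rw [norm_smul, Real.norm_eq_abs]
  exact mul_le_mul (h1 ⟨o.N, a'⟩) (h2 a a').2.2.1 (norm_nonneg _) hD0

/-- The product rule for a difference quotient of `(1 + εγ) ⟨w_ε, G_ε⟩`, with remainder. -/
theorem abs_quotient_sub_le {E : Type*} [NormedAddCommGroup E] [InnerProductSpace ℝ E]
    {w w' G G' δ R : E} {ε γ s C D L N : ℝ} (hε0 : ε ≠ 0) (hε1 : |ε| ≤ 1) (hε : |ε| * D ≤ 1 / 2)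
    (hs : |s| ≤ D) (hγ : |γ| ≤ D) (hw : ‖w‖ ≤ C) (hG : ‖G‖ ≤ C) (hR : ‖R‖ ≤ L) (hδ : ‖δ‖ ≤ N)
    (hG' : (1 + ε * γ) • (G' - G) = ε • R) :
    |ε⁻¹ * ((1 + ε * s) * inner ℝ w' G' - inner ℝ w G) -
        (s * inner ℝ w G + inner ℝ δ G + inner ℝ w R)| ≤
      ((D + 1) * (C + 2 * L) * (1 + N) + 4 * D * C * L + 2 * N * L) *
        (‖ε⁻¹ • (w' - w) - δ‖ + |ε|) := by
  set ζ := ε⁻¹ • (w' - w) - δ with hζ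
  have hD0 : 0 ≤ D := (abs_nonneg _).trans hs
  have hC0 : 0 ≤ C := (norm_nonneg _).trans hw
  have hL0 : 0 ≤ L := (norm_nonneg _).trans hR
  have hN0 : 0 ≤ N := (norm_nonneg _).trans hδ
  have hε00 : 0 ≤ |ε| := abs_nonneg _
  have hγ' : 1 / 2 ≤ 1 + ε * γ := by
    have : |ε * γ| ≤ 1 / 2 := by
      rw [abs_mul]; exact (mul_le_mul_of_nonneg_left hγ hε00).trans hε
    linarith [(abs_le.1 this).1]
  have hw' : w' - w = ε • (ζ + δ) := by
    rw [hζ, sub_add_cancel, smul_smul, mul_inv_cancel₀ hε0, one_smul]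
  have hGd : G' - G = (ε * (1 + ε * γ)⁻¹) • R := by
    have : (1 + ε * γ) ≠ 0 := by linarith
    rw [mul_comm, ← smul_smul, ← hG', smul_smul, inv_mul_cancel₀ this, one_smul]
  have hinv : (1 + ε * γ)⁻¹ ≤ 2 := by
    rw [inv_le_comm₀ (by linarith) (by norm_num)]; linarith
  have hinv0 : 0 ≤ (1 + ε * γ)⁻¹ := inv_nonneg.2 (by linarith)
  have hGn : ‖G' - G‖ ≤ |ε| * (2 * L) := by
    rw [hGd, norm_smul, Real.norm_eq_abs, abs_mul, abs_of_nonneg hinv0, mul_assoc]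
    gcongr
  have hG'n : ‖G'‖ ≤ C + 2 * L := by
    have : G' = G + (G' - G) := by abel
    rw [this]
    refine (norm_add_le _ _).trans (add_le_add hG (hGn.trans ?_))
    exact mul_le_of_le_one_left (by positivity) hε1
  set θ := ε⁻¹ • (G' - G) - R with hθ
  have hθn : ‖θ‖ ≤ |ε| * (2 * D * L) := by
    have e : θ = (-(ε * γ) * (1 + ε * γ)⁻¹) • R := by
      have h0 : (1 + ε * γ) ≠ 0 := by linarith
      have h1 : ε⁻¹ • (G' - G) = (1 + ε * γ)⁻¹ • R := by
        rw [hGd, smul_smul, ← mul_assoc, inv_mul_cancel₀ hε0, one_mul]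
      have h2 : -(ε * γ) * (1 + ε * γ)⁻¹ = (1 + ε * γ)⁻¹ - 1 := by
        field_simp; ring
      rw [hθ, h1, h2, sub_smul, one_smul]
    rw [e, norm_smul, Real.norm_eq_abs, abs_mul, abs_neg, abs_mul, abs_of_nonneg hinv0]
    calc |ε| * |γ| * (1 + ε * γ)⁻¹ * ‖R‖ ≤ |ε| * D * 2 * L := by gcongr
      _ = _ := by ring
  have hexp : ε⁻¹ * ((1 + ε * s) * inner ℝ w' G' - inner ℝ w G) -
        (s * inner ℝ w G + inner ℝ δ G + inner ℝ w R) =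
      s * (ε * inner ℝ (ζ + δ) G' + inner ℝ w (G' - G)) + inner ℝ ζ G' + inner ℝ δ (G' - G) +
        inner ℝ w θ := by
    have e1 : w' = w + ε • (ζ + δ) := by rw [← hw']; abel
    have e2 : (inner ℝ w θ : ℝ) = ε⁻¹ * inner ℝ w (G' - G) - inner ℝ w R := by
      rw [hθ, inner_sub_right, real_inner_smul_right]
    rw [e2, e1]
    simp only [inner_add_left, inner_sub_right, real_inner_smul_left]
    field_simp
    ring
  have hcs : ∀ {u v : E} {p q : ℝ}, ‖u‖ ≤ p → ‖v‖ ≤ q → |inner ℝ u v| ≤ p * q :=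
    fun {u v p q} hu hv => (abs_real_inner_le_norm u v).trans
      (mul_le_mul hu hv (norm_nonneg _) ((norm_nonneg _).trans hu))
  have b1 : |s * (ε * inner ℝ (ζ + δ) G' + inner ℝ w (G' - G))| ≤
      D * (|ε| * ((‖ζ‖ + N) * (C + 2 * L)) + C * (|ε| * (2 * L))) := by
    rw [abs_mul]
    refine mul_le_mul hs ((abs_add_le _ _).trans (add_le_add ?_ (hcs hw hGn))) (abs_nonneg _) hD0
    rw [abs_mul]
    exact mul_le_mul_of_nonneg_left (hcs ((norm_add_le _ _).trans (by linarith)) hG'n) hε00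
  have b2 : |inner ℝ ζ G'| ≤ ‖ζ‖ * (C + 2 * L) := hcs le_rfl hG'n
  have b3 : |inner ℝ δ (G' - G)| ≤ N * (|ε| * (2 * L)) := hcs hδ hGn
  have b4 : |inner ℝ w θ| ≤ C * (|ε| * (2 * D * L)) := hcs hw hθn
  rw [hexp]
  have hsum := (abs_add_le _ _).trans (add_le_add ((abs_add_le _ _).trans (add_le_add
    ((abs_add_le _ _).trans (add_le_add b1 b2)) b3)) b4)
  refine hsum.trans ?_
  have hζ0 : 0 ≤ ‖ζ‖ := norm_nonneg _
  have k1 : D * (|ε| * (‖ζ‖ * (C + 2 * L))) ≤ D * (‖ζ‖ * (C + 2 * L)) :=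
    mul_le_mul_of_nonneg_left (mul_le_of_le_one_left (by positivity) hε1) hD0
  have k2 : 0 ≤ (D + 1) * (C + 2 * L) * N * ‖ζ‖ + (C + 2 * L) * (1 + N) * |ε| +
      D * (C + 2 * L) * |ε| +
      (4 * D * C * L + 2 * N * L) * ‖ζ‖ := by positivity
  linear_combination k1 + k2

end Derivative

section DerivativeFormula

variable {d : ℕ} {P : Measure (Obs d)} [IsProbabilityMeasure P] {η : Nuisance d} {c C B : ℝ}
  {M : ℕ} {w : Measure (Obs d) → VecFun d} {φ : PhiFun d} {g : Obs d → ℝ}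

/-- The derivative of `(1 + ε g) ∑_a w_εᵀ G_ε` at `ε = 0` by the product rule. -/
noncomputable def estimandScore (P : Measure (Obs d)) (η : Nuisance d) (g : Obs d → ℝ)
    (o : Obs d) : ℝ :=
  g o * ∑ a : Treat o.N, inner ℝ (η.w o.N a o.X) (η.G o.N a o.X) +
    (∑ a : Treat o.N, inner ℝ (condPhiScore P η.φ g o.N a o.X) (η.G o.N a o.X) +
    ∑ a : Treat o.N, inner ℝ (η.w o.N a o.X) (outcomeRegDeriv P g o.N a o.X))

theorem integrable_estimandScore_terms (h : RegularTruth P η c C M B) (hg : IsScore P g) :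
    Integrable (fun o : Obs d =>
      g o * ∑ a : Treat o.N, inner ℝ (η.w o.N a o.X) (η.G o.N a o.X)) P ∧
    Integrable (fun o : Obs d => ∑ a : Treat o.N,
      (inner ℝ (condPhiScore P η.φ g o.N a o.X) (η.G o.N a o.X) : ℝ)) P ∧
    Integrable (fun o : Obs d => ∑ a : Treat o.N,
      (inner ℝ (η.w o.N a o.X) (outcomeRegDeriv P g o.N a o.X) : ℝ)) P := by
  obtain ⟨D', hD'⟩ := hg.2.1
  obtain ⟨D, hD0, hD⟩ : ∃ D, 0 ≤ D ∧ ∀ o, |g o| ≤ D :=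
    ⟨|D'|, abs_nonneg _, fun o => (hD' o).trans (le_abs_self _)⟩
  have hC := h.C_nonneg
  have hB := h.B_nonneg
  refine ⟨?_, ?_, ?_⟩
  · exact (integral_uncenteredEIF h h.meas h.bdd).2.1.bdd_mul (c := D)
      hg.1.aestronglyMeasurable (ae_of_all _ hD)
  · refine integrable_of_abs_le (C := 2 ^ M * (2 ^ M * (D * C) * C)) (measurable_axn
      (F := fun n _ x => ∑ a : Treat n, (inner ℝ (condPhiScore P η.φ g n a x) (η.G n a x) : ℝ))
      fun n _ => Finset.measurable_sum _ fun a _ => (measurable_condPhiScore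
        (fun n a' a => h.meas.meas_φ n a a') n a).inner (h.meas.meas_G n a)) ?_
    filter_upwards [norm_condPhiScore_le h hD0 hD, h.bdd, h.size] with o h1 h2 h3
    refine (Finset.abs_sum_le_sum_abs _ _).trans (sum_treat_le h3 (by positivity) fun a => ?_)
    exact (abs_real_inner_le_norm _ _).trans (mul_le_mul (h1 a) (h2 a a).2.1 (norm_nonneg _)
      (by positivity))
  · refine integrable_of_abs_le (C := 2 ^ M * (C * (M * (D * (1 + B)) + D * C))) (measurable_axn
      (F := fun n _ x => ∑ a : Treat n, (inner ℝ (η.w n a x) (outcomeRegDeriv P g n a x) : ℝ))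
      fun n _ => Finset.measurable_sum _ fun a _ =>
        (h.meas.meas_w n a).inner (measurable_outcomeRegDeriv P g n a)) ?_
    filter_upwards [norm_outcomeRegDeriv_le h hg.1 hD0 hD, h.bdd, h.size] with o h1 h2 h3
    refine (Finset.abs_sum_le_sum_abs _ _).trans (sum_treat_le h3 (by positivity) fun a => ?_)
    exact (abs_real_inner_le_norm _ _).trans (mul_le_mul (h2 a a).2.2.2 (h1 a).2 (norm_nonneg _)
      hC)

theorem integrable_estimandScore (h : RegularTruth P η c C M B) (hg : IsScore P g) :
    Integrable (estimandScore P η g) P :=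
  let ⟨h1, h2, h3⟩ := integrable_estimandScore_terms h hg
  h1.add (h2.add h3)

/-- The estimand is differentiable along submodels. The error of the difference quotient is bounded
by a multiple of `|ε|` and of the `L¹` error of the difference quotient of the weight. -/
theorem hasDerivAt_estimand (h : RegularTruth P η c C M B) (hη : η = trueNuisance P w φ)
    (hw : ∀ Q n a, Measurable (w Q n a)) (hφ : IsWeightEIF P w φ) (hg : IsScore P g) :
    HasDerivAt (fun ε => estimand w (submodel P g ε)) (∫ o, estimandScore P η g o ∂P) 0 := by
  obtain ⟨D', hD'⟩ := hg.2.1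
  obtain ⟨D, hD0, hD⟩ : ∃ D, 0 ≤ D ∧ ∀ o, |g o| ≤ D :=
    ⟨|D'|, abs_nonneg _, fun o => (hD' o).trans (le_abs_self _)⟩
  have hC := h.C_nonneg
  have hB := h.B_nonneg
  have hηw : η.w = w P := by rw [hη]; rfl
  have hηφ : η.φ = φ := by rw [hη]; rfl
  have hηG : η.G = outcomeReg P := h.G_eq
  have hsub0 : submodel P g 0 = P := by simp [submodel]
  set L' : ℝ := M * (D * (1 + B)) + D * C
  set N' : ℝ := 2 ^ M * (D * C)
  set L : ℝ := (D + 1) * (C + 2 * L') * (1 + N') + 4 * D * C * L' + 2 * N' * L' with hL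
  have hL0 : 0 ≤ L := by positivity
  set e : ℝ → ℝ≥0∞ := fun ε => ∫⁻ o, ∑ a : Treat o.N,
    ‖ε⁻¹ • (w (submodel P g ε) o.N a o.X - w P o.N a o.X) - condPhiScore P φ g o.N a o.X‖ₑ ∂P
    with he
  have hlim : Tendsto e (𝓝[≠] 0) (𝓝 0) := hφ.derivative g hg
  have hε0 : Tendsto (fun ε : ℝ => ε) (𝓝[≠] 0) (𝓝 0) := tendsto_nhdsWithin_of_tendsto_nhds
    tendsto_id
  have habs : Tendsto (fun ε : ℝ => |ε|) (𝓝[≠] 0) (𝓝 0) := by simpa using hε0.abs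
  have hev : ∀ᶠ ε in 𝓝[≠] (0 : ℝ), edist (ε⁻¹ • (estimand w (submodel P g (0 + ε)) -
      estimand w (submodel P g 0))) (∫ o, estimandScore P η g o ∂P) ≤
      ENNReal.ofReal L * (e ε + 2 ^ M * ‖ε‖ₑ) := by
    have h1 : ∀ᶠ ε in 𝓝[≠] (0 : ℝ), |ε| ≤ 1 :=
      (habs.eventually_lt_const one_pos).mono fun _ h => h.le
    have h2 : ∀ᶠ ε in 𝓝[≠] (0 : ℝ), |ε| * D ≤ 1 / 2 := by
      have := habs.mul_const D
      rw [zero_mul] at this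
      exact (this.eventually_lt_const (by norm_num)).mono fun _ h => h.le
    have h3 : ∀ᶠ ε in 𝓝[≠] (0 : ℝ), e ε < 1 := hlim.eventually_lt_const one_pos
    filter_upwards [h1, h2, h3, self_mem_nhdsWithin] with ε hε1 hεD hefin hεne
    have hεne : ε ≠ 0 := hεne
    rw [zero_add, hsub0]
    set Q := submodel P g ε with hQ
    -- the integrands of the estimand at `P_ε` and at `P`, as functions integrated over `P`
    let fε : Obs d → ℝ := fun o => (1 + ε * g o) *
      ∑ a : Treat o.N, inner ℝ (w Q o.N a o.X) (outcomeReg Q o.N a o.X)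
    let f0 : Obs d → ℝ := fun o => ∑ a : Treat o.N, inner ℝ (η.w o.N a o.X) (η.G o.N a o.X)
    have hfεm : Measurable fε := by
      refine (measurable_const.add (hg.1.const_mul ε)).mul (measurable_axn
        (F := fun n _ x => ∑ a : Treat n, (inner ℝ (w Q n a x) (outcomeReg Q n a x) : ℝ))
        fun n _ => Finset.measurable_sum _ fun a _ =>
          (hw Q n a).inner (measurable_outcomeReg Q n a))
    have hf0 : Integrable f0 P := (integral_uncenteredEIF h h.meas h.bdd).2.1
    have hT := integrable_estimandScore h hg
    let q : Obs d → ℝ := fun o => ε⁻¹ * (fε o - f0 o) - estimandScore P η g o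
    have hqm : AEStronglyMeasurable q P :=
      ((hfεm.aestronglyMeasurable.sub hf0.aestronglyMeasurable).const_mul _).sub
        hT.aestronglyMeasurable
    have hq : ∀ᵐ o ∂P, ‖q o‖ₑ ≤ ENNReal.ofReal L * (∑ a : Treat o.N,
        ‖ε⁻¹ • (w Q o.N a o.X - w P o.N a o.X) - condPhiScore P φ g o.N a o.X‖ₑ +
        2 ^ M * ‖ε‖ₑ) := by
      filter_upwards [h.bdd, h.size, norm_outcomeRegDeriv_le h hg.1 hD0 hD,
        norm_condPhiScore_le h hD0 hD, outcomeReg_submodel h hg hD hεD] with o k1 k2 k3 k4 k5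
      rw [hηφ] at k4
      have hqe : q o = ∑ a : Treat o.N, (ε⁻¹ * ((1 + ε * g o) *
          inner ℝ (w Q o.N a o.X) (outcomeReg Q o.N a o.X) -
          inner ℝ (w P o.N a o.X) (outcomeReg P o.N a o.X)) -
          (g o * inner ℝ (w P o.N a o.X) (outcomeReg P o.N a o.X) +
            inner ℝ (condPhiScore P φ g o.N a o.X) (outcomeReg P o.N a o.X) +
            inner ℝ (w P o.N a o.X) (outcomeRegDeriv P g o.N a o.X))) := by
        simp only [q, fε, f0, estimandScore, hηw, hηG, hηφ, Finset.sum_sub_distrib,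
          Finset.sum_add_distrib, ← Finset.mul_sum]
        ring
      rw [hqe]
      refine (enorm_sum_le _ _).trans ?_
      have hterm : ∀ a : Treat o.N, ‖ε⁻¹ * ((1 + ε * g o) *
          inner ℝ (w Q o.N a o.X) (outcomeReg Q o.N a o.X) -
          inner ℝ (w P o.N a o.X) (outcomeReg P o.N a o.X)) -
          (g o * inner ℝ (w P o.N a o.X) (outcomeReg P o.N a o.X) +
            inner ℝ (condPhiScore P φ g o.N a o.X) (outcomeReg P o.N a o.X) +
            inner ℝ (w P o.N a o.X) (outcomeRegDeriv P g o.N a o.X))‖ₑ ≤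
          ENNReal.ofReal L * (‖ε⁻¹ • (w Q o.N a o.X - w P o.N a o.X) -
            condPhiScore P φ g o.N a o.X‖ₑ + ‖ε‖ₑ) := by
        intro a
        have kw := (k1 a a).2.2.2
        have kG := (k1 a a).2.1
        rw [hηw] at kw
        rw [hηG] at kG
        have := abs_quotient_sub_le hεne hε1 hεD (hD o) (k3 a).1 kw kG (k3 a).2 (k4 a) (k5 a)
          (w' := w Q o.N a o.X)
        rw [Real.enorm_eq_ofReal_abs]
        refine (ENNReal.ofReal_le_ofReal this).trans (le_of_eq ?_)
        rw [ENNReal.ofReal_mul hL0, ENNReal.ofReal_add (norm_nonneg _) (abs_nonneg _),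
          ofReal_norm, ← Real.enorm_eq_ofReal_abs]
      refine (Finset.sum_le_sum fun a _ => hterm a).trans ?_
      rw [← Finset.mul_sum, Finset.sum_add_distrib]
      gcongr
      rw [Finset.sum_const, nsmul_eq_mul]
      gcongr
      rw [Finset.card_univ, Fintype.card_pi_const, Fintype.card_bool, Nat.cast_pow,
        Nat.cast_ofNat]
      exact pow_le_pow_right₀ (by norm_num) k2
    have hqi : ∫⁻ o, ‖q o‖ₑ ∂P ≤ ENNReal.ofReal L * (e ε + 2 ^ M * ‖ε‖ₑ) := by
      refine (lintegral_mono_ae hq).trans ?_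
      rw [lintegral_const_mul' _ _ ENNReal.ofReal_ne_top, lintegral_add_right _ measurable_const,
        lintegral_const, measure_univ, mul_one]
    have hfin : ENNReal.ofReal L * (e ε + 2 ^ M * ‖ε‖ₑ) < ∞ := by
      refine ENNReal.mul_lt_top ENNReal.ofReal_lt_top (ENNReal.add_lt_top.2
        ⟨hefin.trans ENNReal.one_lt_top, ENNReal.mul_lt_top ?_ enorm_lt_top⟩)
      exact ENNReal.pow_lt_top (by simp)
    have hqI : Integrable q P := ⟨hqm, hqi.trans_lt hfin⟩
    -- integrability of the integrand at `P_ε` is not assumed; it follows from that of the remainder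
    have hfεI : Integrable fε P := by
      refine (((hqI.add hT).const_mul ε).add hf0).congr (ae_of_all _ fun o => ?_)
      simp only [q, Pi.add_apply]
      field_simp
      ring
    have hval : ε⁻¹ • (estimand w Q - estimand w P) - ∫ o, estimandScore P η g o ∂P =
        ∫ o, q o ∂P := by
      have e1 : estimand w Q = ∫ o, fε o ∂P := integral_submodel hg.1 hD hεD _
      have e2 : estimand w P = ∫ o, f0 o ∂P := by
        simp only [estimand, f0, hηw, hηG]
      rw [e1, e2, ← integral_sub hfεI hf0, smul_eq_mul, ← integral_const_mul]
      exact (integral_sub ((hfεI.sub hf0).const_mul _) hT).symm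
    rw [edist_eq_enorm_sub, hval]
    exact (enorm_integral_le_lintegral_enorm q).trans hqi
  rw [hasDerivAt_iff_tendsto_slope_zero, tendsto_iff_edist_tendsto_0]
  have hup : Tendsto (fun ε : ℝ => ENNReal.ofReal L * (e ε + 2 ^ M * ‖ε‖ₑ)) (𝓝[≠] 0) (𝓝 0) := by
    have he2 : Tendsto (fun ε : ℝ => ‖ε‖ₑ) (𝓝[≠] 0) (𝓝 0) := by
      have := (continuous_enorm.tendsto (0 : ℝ)).comp hε0
      simpa only [Function.comp_def, enorm_zero] using this
    have h1 := ENNReal.Tendsto.const_mul (a := (2 : ℝ≥0∞) ^ M) he2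
      (Or.inr (ENNReal.pow_ne_top (by simp)))
    have h2 := ENNReal.Tendsto.const_mul (a := ENNReal.ofReal L) (hlim.add h1)
      (Or.inr ENNReal.ofReal_ne_top)
    simpa using h2
  exact tendsto_of_tendsto_of_tendsto_of_le_of_le' tendsto_const_nhds hup
    (Eventually.of_forall fun _ => zero_le) hev

/-- The derivative of the estimand along a submodel is the inner product of the score with the
influence function. -/
theorem integral_estimandScore (h : RegularTruth P η c C M B) (hη : η = trueNuisance P w φ)
    (hg : IsScore P g) :
    ∫ o, estimandScore P η g o ∂P = ∫ o, centeredEIF P w φ o * g o ∂P := by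
  obtain ⟨D', hD'⟩ := hg.2.1
  obtain ⟨D, hD0, hD⟩ : ∃ D, 0 ≤ D ∧ ∀ o, |g o| ≤ D :=
    ⟨|D'|, abs_nonneg _, fun o => (hD' o).trans (le_abs_self _)⟩
  obtain ⟨t1, t2, t3⟩ := integrable_estimandScore_terms h hg
  have hC := h.C_nonneg
  have hc := h.c_pos
  have hgi : Integrable g P := integrable_score hg.1 hD
  have hηG : η.G = outcomeReg P := h.G_eq
  -- the correction for the estimated weight
  let S : (n : ℕ) → Treat n → Cov d n → ℝ := fun n b x =>
    ∑ a, inner ℝ (η.φ n b x a) (η.G n a x)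
  have hS : ∀ n b, Measurable (S n b) := fun n b => Finset.measurable_sum _ fun a _ =>
    (h.meas.meas_φ n a b).inner (h.meas.meas_G n a)
  have hSb : ∀ᵐ o : Obs d ∂P, ‖S o.N o.A o.X‖ ≤ 2 ^ M * (C * C) := by
    filter_upwards [h.bdd, h.size] with o k1 k2
    refine (Finset.abs_sum_le_sum_abs _ _).trans (sum_treat_le k2 (by positivity) fun a => ?_)
    exact (abs_real_inner_le_norm _ _).trans (mul_le_mul (k1 a o.A).2.2.1 (k1 a a).2.1
      (norm_nonneg _) hC)
  have hSg : Integrable (fun o : Obs d => S o.N o.A o.X * g o) P :=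
    hgi.bdd_mul (measurable_axn hS).aestronglyMeasurable hSb
  have hS2 := (integral_eq_integral_sum_condXN h.size hgi hS hSg).2
  have hSδ : ∀ o : Obs d, ∑ b : Treat o.N,
      S o.N b o.X * condXN P (Set.indicator {o' | o'.AN = ⟨o.N, b⟩} g) o.N o.X =
      ∑ a : Treat o.N, inner ℝ (condPhiScore P η.φ g o.N a o.X) (η.G o.N a o.X) := by
    intro o
    simp only [S, condPhiScore, sum_inner, Finset.sum_mul, real_inner_smul_left]
    rw [Finset.sum_comm]
    exact Finset.sum_congr rfl fun a _ => Finset.sum_congr rfl fun b _ => mul_comm _ _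
  simp_rw [hSδ] at hS2
  -- the residual term
  let v : VecFun d := fun n a x => (η.H n a x)⁻¹ • η.w n a x
  have hv : ∀ n a, Measurable (v n a) := fun n a =>
    (h.meas.meas_H n a).inv.smul (h.meas.meas_w n a)
  have hvC : ∀ᵐ o ∂P, ‖v o.N o.A o.X‖ ≤ c⁻¹ * C := by
    filter_upwards [h.bdd] with o h2
    have e := (h2 o.A o.A).1.1
    rw [norm_smul, norm_inv, Real.norm_of_nonneg (hc.trans e).le]
    exact mul_le_mul (inv_anti₀ hc e.le) (h2 o.A o.A).2.2.2 (norm_nonneg _) (inv_pos.2 hc).le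
  obtain ⟨hY1, hY2, hY3⟩ := integral_score_inner_Y h.size h.int_Y hv hvC hg.1 hD
  let V : (n : ℕ) → Treat n → Cov d n → ℝ := fun n a x => inner ℝ (v n a x) (η.G n a x)
  have hV : ∀ n a, Measurable (V n a) := fun n a => (hv n a).inner (h.meas.meas_G n a)
  have hVb : ∀ᵐ o : Obs d ∂P, ‖V o.N o.A o.X‖ ≤ c⁻¹ * C * C := by
    filter_upwards [h.bdd, hvC] with o k1 k2
    exact (abs_real_inner_le_norm _ _).trans (mul_le_mul k2 (k1 o.A o.A).2.1
      (norm_nonneg _) (by positivity))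
  have hVg : Integrable (fun o : Obs d => V o.N o.A o.X * g o) P :=
    hgi.bdd_mul (measurable_axn hV).aestronglyMeasurable hVb
  obtain ⟨hV1, hV2⟩ := integral_mul_condAXN P hgi hV hVg
  have hVD : ∀ o : Obs d, inner ℝ (v o.N o.A o.X) (condScoreY P g o.N o.A o.X) -
      V o.N o.A o.X * condAXN P g o.N o.A o.X =
      inner ℝ (v o.N o.A o.X) (outcomeRegDeriv P g o.N o.A o.X) := by
    intro o
    simp only [V, outcomeRegDeriv, inner_sub_right, real_inner_smul_right, hηG]
    ring
  have hvD : Integrable (fun o : Obs d =>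
      (inner ℝ (v o.N o.A o.X) (outcomeRegDeriv P g o.N o.A o.X) : ℝ)) P :=
    (hY2.sub hV1).congr (ae_of_all _ hVD)
  have hA := (integral_axn h.size (F := fun n a x => inner ℝ (v n a x)
    (outcomeRegDeriv P g n a x)) (fun n a => (hv n a).inner (measurable_outcomeRegDeriv P g n a))
    hvD).2
  have hA' : ∫ o : Obs d, ∑ a : Treat o.N, inner ℝ (v o.N a o.X)
      (outcomeRegDeriv P g o.N a o.X) * treatProb P o.N a o.X ∂P =
      ∫ o : Obs d, ∑ a : Treat o.N, inner ℝ (η.w o.N a o.X)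
        (outcomeRegDeriv P g o.N a o.X) ∂P := by
    refine integral_congr_ae ?_
    filter_upwards [h.bdd] with o k1
    refine Finset.sum_congr rfl fun a _ => ?_
    have e : η.H o.N a o.X ≠ 0 := (hc.trans (k1 a a).1.1).ne'
    rw [← h.H_eq, real_inner_smul_left]
    field_simp
  rw [hA'] at hA
  have hres : ∫ o, inner ℝ (v o.N o.A o.X) o.Y * g o ∂P - ∫ o, V o.N o.A o.X * g o ∂P =
      ∫ o : Obs d, ∑ a : Treat o.N, inner ℝ (η.w o.N a o.X)
        (outcomeRegDeriv P g o.N a o.X) ∂P := by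
    rw [hY3, hV2, ← integral_sub hY2 hV1, ← hA]
    exact integral_congr_ae (ae_of_all _ hVD)
  -- the influence function in terms of these pieces
  have hdec : ∀ o : Obs d, centeredEIF P w φ o * g o =
      g o * ∑ a : Treat o.N, inner ℝ (η.w o.N a o.X) (η.G o.N a o.X) + S o.N o.A o.X * g o +
      (inner ℝ (v o.N o.A o.X) o.Y * g o - V o.N o.A o.X * g o) - estimand w P * g o := by
    intro o
    rw [centeredEIF, ← hη]
    simp only [uncenteredEIF, S, V, v, inner_add_left, Finset.sum_add_distrib, inner_sub_right,
      real_inner_smul_left]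
    ring
  have i1 : Integrable (fun o : Obs d =>
      g o * ∑ a : Treat o.N, inner ℝ (η.w o.N a o.X) (η.G o.N a o.X) +
      S o.N o.A o.X * g o) P := t1.add hSg
  have i2 : Integrable (fun o : Obs d =>
      inner ℝ (v o.N o.A o.X) o.Y * g o - V o.N o.A o.X * g o) P := hY1.sub hVg
  have i3 : Integrable (fun o : Obs d =>
      g o * ∑ a : Treat o.N, inner ℝ (η.w o.N a o.X) (η.G o.N a o.X) +
      S o.N o.A o.X * g o +
      (inner ℝ (v o.N o.A o.X) o.Y * g o - V o.N o.A o.X * g o)) P := i1.add i2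
  have i4 : Integrable (fun o : Obs d =>
      (∑ a : Treat o.N, inner ℝ (condPhiScore P η.φ g o.N a o.X) (η.G o.N a o.X) +
    ∑ a : Treat o.N, inner ℝ (η.w o.N a o.X) (outcomeRegDeriv P g o.N a o.X) : ℝ)) P := t2.add t3
  simp_rw [hdec]
  rw [integral_sub i3 (hgi.const_mul _), integral_add i1 i2, integral_add t1 hSg,
    integral_sub hY1 hVg, hres, hS2, integral_const_mul, hg.2.2, mul_zero, sub_zero]
  unfold estimandScore
  rw [integral_add t1 i4, integral_add t2 t3]
  ring

end DerivativeFormula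

/-! ### The efficiency bound -/

section Bound

variable {d : ℕ} {P : Measure (Obs d)} [IsProbabilityMeasure P]

/-- The variance of an influence function is the supremum of the Cramér–Rao bounds: it is an upper
bound by the Cauchy–Schwarz inequality, and it is approached by truncations of the influence
function itself. The score `g₀` is needed only if the variance is zero. -/
theorem isLUB_cramerRao {f : Obs d → ℝ} (hf : Measurable f) (hL : MemLp f 2 P)
    (hf0 : ∫ o, f o ∂P = 0) {g₀ : Obs d → ℝ} (hg₀ : IsScore P g₀) (hg₀2 : 0 < ∫ o, g₀ o ^ 2 ∂P) :
    IsLUB {b : ℝ | ∃ g, IsScore P g ∧ 0 < ∫ o, g o ^ 2 ∂P ∧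
      b = (∫ o, f o * g o ∂P) ^ 2 / ∫ o, g o ^ 2 ∂P} (∫ o, f o ^ 2 ∂P) := by
  have hf2 : Integrable (fun o => f o ^ 2) P :=
    (memLp_two_iff_integrable_sq hL.aestronglyMeasurable).1 hL
  have hfi : Integrable f P := hL.integrable (by norm_num)
  have hgL : ∀ {g : Obs d → ℝ}, IsScore P g → Integrable (fun o => f o * g o) P ∧
      Integrable (fun o => g o ^ 2) P := by
    intro g hg
    obtain ⟨D, hD⟩ := hg.2.1
    refine ⟨hfi.mul_bdd hg.1.aestronglyMeasurable (ae_of_all _ hD), ?_⟩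
    refine integrable_of_abs_le (C := D ^ 2) (hg.1.pow_const 2) (ae_of_all _ fun o => ?_)
    rw [abs_pow]
    exact pow_le_pow_left₀ (abs_nonneg _) (hD o) 2
  constructor
  · rintro b ⟨g, hg, hg2, rfl⟩
    obtain ⟨i1, i2⟩ := hgL hg
    set s := ∫ o, f o * g o ∂P
    set t := ∫ o, g o ^ 2 ∂P
    have hnn : 0 ≤ ∫ o, (f o - s / t * g o) ^ 2 ∂P := integral_nonneg fun o => sq_nonneg _
    have hexp : ∫ o, (f o - s / t * g o) ^ 2 ∂P =
        ∫ o, f o ^ 2 ∂P - 2 * (s / t) * s + (s / t) ^ 2 * t := by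
      have e : ∀ o, (f o - s / t * g o) ^ 2 =
          f o ^ 2 - 2 * (s / t) * (f o * g o) + (s / t) ^ 2 * g o ^ 2 := fun o => by ring
      have i3 : Integrable (fun o => f o ^ 2 - 2 * (s / t) * (f o * g o)) P :=
        hf2.sub (i1.const_mul _)
      simp_rw [e]
      rw [integral_add i3 (i2.const_mul _), integral_sub hf2 (i1.const_mul _),
        integral_const_mul, integral_const_mul]
    rw [hexp] at hnn
    have h0 : t ≠ 0 := hg2.ne'
    have : 2 * (s / t) * s - (s / t) ^ 2 * t = s ^ 2 / t := by field_simp; ring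
    linarith
  · intro b hb
    have hb0 : 0 ≤ b := le_trans (by positivity) (hb ⟨g₀, hg₀, hg₀2, rfl⟩)
    rcases eq_or_lt_of_le (integral_nonneg fun o => sq_nonneg (f o) : 0 ≤ ∫ o, f o ^ 2 ∂P)
      with h0 | hpos
    · rw [← h0]; exact hb0
    -- truncation of `f` at level `n`
    let t : ℕ → Obs d → ℝ := fun n => Set.indicator {o | |f o| ≤ n} f
    have htm : ∀ n, MeasurableSet {o | |f o| ≤ (n : ℝ)} := fun n =>
      measurableSet_le hf.abs measurable_const
    have hmeas : ∀ n, Measurable (t n) := fun n => hf.indicator (htm n)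
    have hle : ∀ n o, |t n o| ≤ |f o| := fun n o => by
      by_cases ho : o ∈ {o | |f o| ≤ (n : ℝ)}
      · simp only [t, Set.indicator_of_mem ho]; exact le_rfl
      · simp only [t, Set.indicator_of_notMem ho]; simp
    have hbd : ∀ n o, |t n o| ≤ n := fun n o => by
      by_cases ho : o ∈ {o | |f o| ≤ (n : ℝ)}
      · simp only [t, Set.indicator_of_mem ho]; exact ho
      · simp only [t, Set.indicator_of_notMem ho]; simp
    have hlim : ∀ o, Tendsto (fun n => t n o) atTop (𝓝 (f o)) := fun o => by
      refine tendsto_const_nhds.congr' ?_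
      obtain ⟨n₀, hn₀⟩ := exists_nat_ge |f o|
      filter_upwards [eventually_ge_atTop n₀] with n hn
      have : o ∈ {o | |f o| ≤ (n : ℝ)} :=
        hn₀.trans (Nat.cast_le.2 hn)
      simp only [t, Set.indicator_of_mem this]
    have hti : ∀ n, Integrable (t n) P := fun n =>
      integrable_of_abs_le (hmeas n) (ae_of_all _ (hbd n))
    have hft : ∀ n o, f o * t n o = t n o ^ 2 := fun n o => by
      by_cases ho : o ∈ {o | |f o| ≤ (n : ℝ)}
      · simp only [t, Set.indicator_of_mem ho]; ring
      · simp only [t, Set.indicator_of_notMem ho]; simp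
    have hti2 : ∀ n, Integrable (fun o => t n o ^ 2) P := fun n =>
      hf2.mono' ((hmeas n).pow_const 2).aestronglyMeasurable (ae_of_all _ fun o => by
        rw [Real.norm_of_nonneg (sq_nonneg _)]
        exact sq_le_sq.2 (hle n o))
    have hc : Tendsto (fun n => ∫ o, t n o ∂P) atTop (𝓝 0) := by
      rw [← hf0]
      exact tendsto_integral_of_dominated_convergence (fun o => |f o|)
        (fun n => (hmeas n).aestronglyMeasurable) hfi.abs
        (fun n => ae_of_all _ (hle n)) (ae_of_all _ hlim)
    have hs : Tendsto (fun n => ∫ o, t n o ^ 2 ∂P) atTop (𝓝 (∫ o, f o ^ 2 ∂P)) := by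
      refine tendsto_integral_of_dominated_convergence (fun o => f o ^ 2)
        (fun n => ((hmeas n).pow_const 2).aestronglyMeasurable) hf2
        (fun n => ae_of_all _ fun o => ?_) (ae_of_all _ fun o => (hlim o).pow 2)
      rw [Real.norm_of_nonneg (sq_nonneg _)]
      exact sq_le_sq.2 (hle n o)
    have hden : Tendsto (fun n => ∫ o, t n o ^ 2 ∂P - (∫ o, t n o ∂P) ^ 2) atTop
        (𝓝 (∫ o, f o ^ 2 ∂P)) := by
      simpa using hs.sub (hc.pow 2)
    have hratio : Tendsto (fun n => (∫ o, t n o ^ 2 ∂P) ^ 2 /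
        (∫ o, t n o ^ 2 ∂P - (∫ o, t n o ∂P) ^ 2)) atTop (𝓝 (∫ o, f o ^ 2 ∂P)) := by
      have := (hs.pow 2).div hden hpos.ne'
      rwa [sq, mul_div_assoc, div_self hpos.ne', mul_one] at this
    refine le_of_tendsto hratio ?_
    filter_upwards [hden.eventually_const_lt hpos] with n hn
    set m := ∫ o, t n o ∂P with hm
    have hscore : IsScore P fun o => t n o - m := by
      refine ⟨(hmeas n).sub_const m, ⟨n + |m|, fun o => ?_⟩, ?_⟩
      · exact (abs_sub _ _).trans (add_le_add (hbd n o) le_rfl)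
      · rw [integral_sub (hti n) (integrable_const _)]
        simp [hm]
    have e1 : ∫ o, (t n o - m) ^ 2 ∂P = ∫ o, t n o ^ 2 ∂P - m ^ 2 := by
      have e : ∀ o, (t n o - m) ^ 2 = t n o ^ 2 - 2 * m * t n o + m ^ 2 := fun o => by ring
      have i3 : Integrable (fun o => t n o ^ 2 - 2 * m * t n o) P :=
        (hti2 n).sub ((hti n).const_mul _)
      simp_rw [e]
      rw [integral_add i3 (integrable_const _), integral_sub (hti2 n) ((hti n).const_mul _),
        integral_const_mul, ← hm]
      simp
      ring
    have e2 : ∫ o, f o * (t n o - m) ∂P = ∫ o, t n o ^ 2 ∂P := by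
      have e : ∀ o, f o * (t n o - m) = t n o ^ 2 - m * f o := fun o => by rw [← hft]; ring
      simp_rw [e]
      rw [integral_sub (hti2 n) (hfi.const_mul _), integral_const_mul, hf0, mul_zero, sub_zero]
    exact hb ⟨_, hscore, by rw [e1]; exact hn, by rw [e1, e2]⟩

/-- Since treatment is random given the covariates, the model has a nonzero score. -/
theorem exists_score_pos {c : ℝ} (hc : 0 < c)
    (hH : ∀ᵐ o ∂P, ∀ a : Treat o.N, c < treatProb P o.N a o.X ∧ treatProb P o.N a o.X < 1 - c) :
    ∃ g, IsScore P g ∧ 0 < ∫ o, g o ^ 2 ∂P := by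
  classical
  obtain ⟨n, hn⟩ : ∃ n, P {o | o.N = n} ≠ 0 := by
    by_contra! hcon
    have : P (⋃ n, {o : Obs d | o.N = n}) = 0 := measure_iUnion_null hcon
    have hu : (⋃ n, {o : Obs d | o.N = n}) = Set.univ := by ext o; simp
    rw [hu, measure_univ] at this
    exact one_ne_zero this
  let a : Treat n := fun _ => false
  let E : Set (Obs d) := {o | o.AN = ⟨n, a⟩}
  have hE : MeasurableSet E := Obs.measurableSet_AN n a
  let f : Obs d → ℝ := Set.indicator E 1
  have hfm : Measurable f := measurable_one.indicator hE
  have hf01 : ∀ o, f o = 0 ∨ f o = 1 := fun o => by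
    by_cases ho : o ∈ E
    · right; simp [f, ho]
    · left; simp [f, ho]
  set p := ∫ o, f o ∂P with hp
  have hfi : Integrable f P := integrable_of_abs_le (C := 1) hfm (ae_of_all _ fun o => by
    rcases hf01 o with h | h <;> simp [h])
  have hscore : IsScore P fun o => f o - p := by
    refine ⟨hfm.sub_const p, ⟨1 + |p|, fun o => ?_⟩, ?_⟩
    · refine (abs_sub _ _).trans (add_le_add ?_ le_rfl)
      rcases hf01 o with h | h <;> simp [h]
    · rw [integral_sub hfi (integrable_const _)]
      simp [hp]
  refine ⟨_, hscore, ?_⟩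
  refine lt_of_le_of_ne (integral_nonneg fun o => sq_nonneg _) fun h0 => hn ?_
  have hsq : Integrable (fun o => (f o - p) ^ 2) P := by
    obtain ⟨D, hD⟩ := hscore.2.1
    refine integrable_of_abs_le (C := D ^ 2) (hscore.1.pow_const 2) (ae_of_all _ fun o => ?_)
    rw [abs_pow]
    exact pow_le_pow_left₀ (abs_nonneg _) (hD o) 2
  have hae : f =ᵐ[P] fun _ => p := by
    filter_upwards [(integral_eq_zero_iff_of_nonneg (fun o => sq_nonneg _) hsq).1 h0.symm]
      with o ho
    have : (f o - p) ^ 2 = 0 := ho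
    exact sub_eq_zero.1 (pow_eq_zero_iff (two_ne_zero)|>.1 this)
  -- a constant indicator function would make the treatment deterministic in clusters of size `n`
  have hcond := condExp_congr_ae (m := MeasurableSpace.comap (Obs.XN (d := d)) inferInstance) hae
  rw [condExp_const comap_XN_le] at hcond
  rw [measure_eq_zero_iff_ae_notMem]
  filter_upwards [hae, hcond, hH] with o h1 h2 h3 ho
  have hN : o.N = n := ho
  rw [← condXN_apply] at h2
  have h4 : treatProb P o.N (fun _ => false) o.X = p := by
    rw [← h2]
    subst hN
    rfl
  have h5 := h3 fun _ => false
  rw [h4] at h5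
  rcases hf01 o with h | h <;> rw [h] at h1 <;> linarith [h5.1, h5.2]

end Bound

/-! ### Asymptotic linearity of cross-fitted averages -/

section AsymptoticLinearity

variable {Ω : Type*} [MeasurableSpace Ω] {μ : Measure Ω}

/-- Bounds that hold outside of events of vanishing probability suffice for `o_P(1)`. -/
theorem IsLittleOP.mono_of_tendsto {X Y : ℕ → Ω → ℝ≥0∞} (hY : IsLittleOP μ Y) {E : ℕ → Set Ω}
    (hE : Tendsto (fun m => μ (E m)) atTop (𝓝 0))
    (h : ∀ᶠ m in atTop, ∀ᵐ ω ∂μ, ω ∉ E m → X m ω ≤ Y m ω) : IsLittleOP μ X := by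
  intro ε hε
  have hlim := (hY ε hε).add hE
  rw [add_zero] at hlim
  refine tendsto_of_tendsto_of_tendsto_of_le_of_le' tendsto_const_nhds hlim
    (Eventually.of_forall fun _ => zero_le) (h.mono fun m hm => ?_)
  refine (measure_mono_ae ?_).trans (measure_union_le _ _)
  filter_upwards [hm] with ω hω h1
  by_cases hω' : ω ∈ E m
  · exact Or.inr hω'
  · exact Or.inl (lt_of_lt_of_le (show ε < X m ω from h1) (hω hω'))

theorem TendstoInMeasure.isLittleOP {X : ℕ → Ω → ℝ} {a : ℝ}
    (h : TendstoInMeasure μ X atTop fun _ => a) : IsLittleOP μ fun m ω => ‖X m ω - a‖ₑ := by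
  rw [tendstoInMeasure_iff_enorm] at h
  intro ε hε
  rcases eq_or_ne ε ∞ with rfl | ht
  · simp
  · exact tendsto_of_tendsto_of_tendsto_of_le_of_le tendsto_const_nhds (h ε hε ht)
      (fun _ => zero_le) fun m => measure_mono fun ω hω => le_of_lt (show ε < _ from hω)

variable {𝒪 : Type*} [MeasurableSpace 𝒪] {P : Measure 𝒪} [IsProbabilityMeasure P]

theorem lintegral_enorm_sub_integral_sq_le {f : 𝒪 → ℝ} (hf : Measurable f) :
    ∫⁻ o, ‖f o - ∫ o', f o' ∂P‖ₑ ^ 2 ∂P ≤ ∫⁻ o, ‖f o‖ₑ ^ 2 ∂P := by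
  by_cases hL : MemLp f 2 P
  · have h1 : evariance f P = ENNReal.ofReal (variance f P) := hL.ofReal_variance_eq.symm
    have h2 := variance_le_expectation_sq (X := f) (μ := P) hf.aestronglyMeasurable
    have hi := (memLp_two_iff_integrable_sq hf.aestronglyMeasurable).1 hL
    calc ∫⁻ o, ‖f o - ∫ o', f o' ∂P‖ₑ ^ 2 ∂P = ENNReal.ofReal (variance f P) := h1
      _ ≤ ENNReal.ofReal (∫ o, f o ^ 2 ∂P) := ENNReal.ofReal_le_ofReal h2
      _ = ∫⁻ o, ENNReal.ofReal (f o ^ 2) ∂P :=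
        ofReal_integral_eq_lintegral_ofReal hi (ae_of_all _ fun o => sq_nonneg _)
      _ = _ := lintegral_congr fun o => by
        rw [Real.enorm_eq_ofReal_abs, ← ENNReal.ofReal_pow (abs_nonneg _), sq_abs]
  · rw [memLp_two_iff_integrable_sq hf.aestronglyMeasurable] at hL
    refine le_top.trans (top_le_iff.2 ?_).ge
    by_contra hcon
    refine hL ⟨(hf.pow_const 2).aestronglyMeasurable, ?_⟩
    simpa [HasFiniteIntegral, enorm_pow] using lt_top_iff_ne_top.2 hcon

theorem integral_mul_sub_integral_eq_zero (f : 𝒪 → ℝ) (a : ℝ) :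
    ∫ o, a * (f o - ∫ o', f o' ∂P) ∂P = 0 := by
  by_cases hi : Integrable f P
  · rw [integral_const_mul, integral_sub hi (integrable_const _)]
    simp
  · -- both integrals have the junk value `0`
    simp [integral_const_mul, integral_undef hi]

theorem groupSize_le {K m : ℕ} (s : Fin m → Fin K) (k : Fin K) : groupSize s k ≤ m :=
  (Finset.card_filter_le _ _).trans (by simp)

/-- Up to two sums that are centred given the data outside of the group, and the bias, the
contribution of a group to the cross-fitted average is a sum of influence functions. -/
theorem sqrt_mul_group_mean_sub_eq {ι : Type*} (s : Finset ι) {m K a θ b : ℝ} {f f₀ : ι → ℝ}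
    (ha : a * s.card = √m / K) :
    a * ∑ i ∈ s, f i - √m / K * θ - (√m)⁻¹ * ∑ i ∈ s, (f₀ i - θ) =
      ∑ i ∈ s, a * (f i - f₀ i - (b - θ)) + ∑ i ∈ s, (a - (√m)⁻¹) * (f₀ i - θ) +
        √m / K * (b - θ) := by
  simp only [← Finset.mul_sum, Finset.sum_sub_distrib, Finset.sum_const, nsmul_eq_mul]
  rw [← ha]
  ring

variable [IsProbabilityMeasure μ] {U : Type*} [MeasurableSpace U] {K : ℕ}

/-- A cross-fitted average of fitted influence functions is asymptotically linear, with the limit of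
the fitted functions as its influence function, once the fitted functions converge in mean square
and their bias is negligible. -/
theorem isLittleOP_crossFit_sub (hK : 1 ≤ K)
    {S : (m : ℕ) → Ω → Fin m → Fin K} (hS : ∀ m, Measurable (S m))
    {u : ℕ → Ω → U} (hu : ∀ m, Measurable (u m)) {O : ℕ → Ω → 𝒪} (hO : ∀ i, Measurable (O i))
    (hlaw : ∀ i, μ.map (O i) = P) (hOi : iIndepFun O μ)
    (hindep : ∀ m, IndepFun (fun ω => (S m ω, u m ω)) (fun ω (i : Fin m) => O i ω) μ)
    (hbal : ∀ k, TendstoInMeasure μ (fun m ω => (groupSize (S m ω) k : ℝ) / m) atTop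
      (fun _ => 1 / (K : ℝ)))
    {f : (m : ℕ) → (k : Fin K) → (s : Fin m → Fin K) → U → ({i : Fin m // s i ≠ k} → 𝒪) → 𝒪 → ℝ}
    (hf : ∀ m k s, Measurable fun q : U × ({i : Fin m // s i ≠ k} → 𝒪) × 𝒪 =>
      f m k s q.1 q.2.1 q.2.2)
    (hfi : ∀ m k, ∀ᵐ ω ∂μ, Integrable (f m k (S m ω) (u m ω) fun j => O j ω) P)
    {f₀ : 𝒪 → ℝ} (hf₀ : Measurable f₀) (hf₀2 : MemLp f₀ 2 P) {θ : ℝ} (hθ : ∫ o, f₀ o ∂P = θ)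
    (hV : ∀ k, IsLittleOP μ fun m ω =>
      ∫⁻ o, ‖f m k (S m ω) (u m ω) (fun j => O j ω) o - f₀ o‖ₑ ^ 2 ∂P)
    (hbias : ∀ k, IsLittleOP μ fun m ω =>
      ENNReal.ofReal √m * ‖∫ o, f m k (S m ω) (u m ω) (fun j => O j ω) o ∂P - θ‖ₑ) :
    IsLittleOP μ fun m ω =>
      ‖√(m : ℝ) * ((1 / (K : ℝ)) * ∑ k : Fin K, (1 / (groupSize (S m ω) k : ℝ)) *
          ∑ i ∈ Finset.univ.filter (fun i => S m ω i = k),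
            f m k (S m ω) (u m ω) (fun j => O j ω) (O i ω) - θ) -
        (√(m : ℝ))⁻¹ * ∑ i : Fin m, (f₀ (O i ω) - θ)‖ₑ := by
  have hK0 : (0 : ℝ) < K := by exact_mod_cast hK
  have hK1 : (1 : ℝ) ≤ K := by exact_mod_cast hK
  -- the weight of an observation of group `k` in the estimator, and its deviation from `1 / √m`
  let a : (m : ℕ) → (Fin m → Fin K) → Fin K → ℝ := fun m s k => √(m : ℝ) / (K * groupSize s k)
  let bad : Fin K → ℕ → Set Ω := fun k m =>
    {ω | ENNReal.ofReal (1 / (2 * K)) ≤ ‖(groupSize (S m ω) k : ℝ) / m - 1 / (K : ℝ)‖ₑ}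
  have hbad : ∀ k, Tendsto (fun m => μ (bad k m)) atTop (𝓝 0) := fun k =>
    (tendstoInMeasure_iff_enorm.1 (hbal k)) _ (ENNReal.ofReal_pos.2 (by positivity))
      ENNReal.ofReal_ne_top
  have hgood : ∀ k (m : ℕ), 0 < m → ∀ ω ∉ bad k m,
      (m : ℝ) / (2 * K) ≤ groupSize (S m ω) k ∧ (0 : ℝ) < groupSize (S m ω) k := by
    intro k m hm ω hω
    have hm' : (0 : ℝ) < m := by exact_mod_cast hm
    simp only [bad, Set.mem_ofPred_eq, not_le, Real.enorm_eq_ofReal_abs] at hω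
    have h1 := (ENNReal.ofReal_lt_ofReal_iff (by positivity)).1 hω
    have h2 := (abs_lt.1 h1).1
    have h3 : 1 / (2 * (K : ℝ)) < groupSize (S m ω) k / m := by
      have : 1 / (K : ℝ) = 1 / (2 * K) + 1 / (2 * K) := by field_simp; norm_num
      linarith
    rw [lt_div_iff₀ hm'] at h3
    have h4 : (m : ℝ) / (2 * K) = 1 / (2 * K) * m := by ring
    have h5 : (0 : ℝ) < 1 / (2 * K) * m := by positivity
    exact ⟨h4 ▸ h3.le, h5.trans h3⟩
  have hfm : ∀ m k s v x, Measurable (f m k s v x) := fun m k s v x =>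
    (hf m k s).comp (f := fun o : 𝒪 => (v, x, o)) (by fun_prop)
  -- the centred fitted part
  have hA : ∀ k, IsLittleOP μ fun m ω =>
      ‖∑ i ∈ Finset.univ.filter (fun i => S m ω i = k), a m (S m ω) k *
        (f m k (S m ω) (u m ω) (fun j => O j ω) (O i ω) - f₀ (O i ω) -
          ∫ o, (f m k (S m ω) (u m ω) (fun j => O j ω) o - f₀ o) ∂P)‖ₑ := by
    intro k
    refine isLittleOP_sum_group (P := P) hS hu hO hlaw hOi hindep k
      (h := fun m s v x o => a m s k * (f m k s v x o - f₀ o - ∫ o', (f m k s v x o' - f₀ o') ∂P))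
      (fun m s => ?_) (fun m s v x _ => ?_) ?_
    · have h1 : Measurable fun q : (U × ({i : Fin m // s i ≠ k} → 𝒪)) × 𝒪 =>
          f m k s q.1.1 q.1.2 q.2 - f₀ q.2 :=
        ((hf m k s).comp (f := fun q : (U × ({i : Fin m // s i ≠ k} → 𝒪)) × 𝒪 =>
          (q.1.1, q.1.2, q.2)) (by fun_prop)).sub (hf₀.comp measurable_snd)
      have h2 : Measurable fun z : U × ({i : Fin m // s i ≠ k} → 𝒪) =>
          ∫ o, (f m k s z.1 z.2 o - f₀ o) ∂P :=
        (StronglyMeasurable.integral_prod_right' (ν := P) h1.stronglyMeasurable).measurable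
      exact ((((hf m k s).sub (hf₀.comp (f := fun q : U × ({i : Fin m // s i ≠ k} → 𝒪) × 𝒪 =>
        q.2.2) (by fun_prop))).sub (h2.comp (f := fun q : U × ({i : Fin m // s i ≠ k} → 𝒪) × 𝒪 =>
          (q.1, q.2.1)) (by fun_prop)))).const_mul _
    · exact integral_mul_sub_integral_eq_zero (fun o => f m k s v x o - f₀ o) _
    · refine (((hV k).const_mul (a := 2) (by simp))).mono_of_tendsto (hbad k) ?_
      filter_upwards [eventually_gt_atTop 0] with m hm
      refine ae_of_all _ fun ω hω => ?_
      obtain ⟨h1, h2⟩ := hgood k m hm ω hω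
      have hm' : (0 : ℝ) < m := by exact_mod_cast hm
      simp only [enorm_mul, mul_pow]
      rw [lintegral_const_mul' _ _ (by simp), ← mul_assoc]
      refine mul_le_mul' ?_ (lintegral_enorm_sub_integral_sq_le ((hfm _ _ _ _ _).sub hf₀))
      have h3 : (groupSize (S m ω) k : ℝ) * a m (S m ω) k ^ 2 ≤ 2 := by
        have : (groupSize (S m ω) k : ℝ) * a m (S m ω) k ^ 2 =
            m / (K ^ 2 * groupSize (S m ω) k) := by
          simp only [a]
          rw [div_pow, Real.sq_sqrt hm'.le]
          field_simp
        rw [this, div_le_iff₀ (by positivity)]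
        rw [div_le_iff₀ (by positivity)] at h1
        have : (K : ℝ) ≤ K ^ 2 := by nlinarith
        nlinarith
      calc (groupSize (S m ω) k : ℝ≥0∞) * ‖a m (S m ω) k‖ₑ ^ 2
          = ENNReal.ofReal ((groupSize (S m ω) k : ℝ) * a m (S m ω) k ^ 2) := by
            rw [ENNReal.ofReal_mul (by positivity), ENNReal.ofReal_natCast,
              Real.enorm_eq_ofReal_abs, ← ENNReal.ofReal_pow (abs_nonneg _), sq_abs]
        _ ≤ _ := by simpa using ENNReal.ofReal_le_ofReal h3
  -- the effect of unequal group sizes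
  have hB : ∀ k, IsLittleOP μ fun m ω =>
      ‖∑ i ∈ Finset.univ.filter (fun i => S m ω i = k), (a m (S m ω) k - (√(m : ℝ))⁻¹) *
        (f₀ (O i ω) - θ)‖ₑ := by
    intro k
    have hfin : ∫⁻ o, ‖f₀ o - θ‖ₑ ^ 2 ∂P < ∞ := by
      have h1 : MemLp (fun o => f₀ o - θ) 2 P := hf₀2.sub (memLp_const θ)
      have h2 := (memLp_two_iff_integrable_sq h1.aestronglyMeasurable).1 h1
      simpa [HasFiniteIntegral, enorm_pow] using h2.2
    refine isLittleOP_sum_group (P := P) hS hu hO hlaw hOi hindep k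
      (h := fun m s _ _ o => (a m s k - (√(m : ℝ))⁻¹) * (f₀ o - θ))
      (fun m s => ?_) (fun m s v x _ => ?_) ?_
    · exact ((hf₀.comp (f := fun q : U × ({i : Fin m // s i ≠ k} → 𝒪) × 𝒪 => q.2.2)
        (by fun_prop)).sub_const _).const_mul _
    · rw [integral_const_mul, integral_sub (hf₀2.integrable (by norm_num)) (integrable_const _), hθ]
      simp
    · refine (((TendstoInMeasure.isLittleOP (hbal k)).const_mul
        (a := ENNReal.ofReal (2 * K) * ∫⁻ o, ‖f₀ o - θ‖ₑ ^ 2 ∂P)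
        (ENNReal.mul_lt_top ENNReal.ofReal_lt_top hfin).ne)).mono_of_tendsto (hbad k) ?_
      filter_upwards [eventually_gt_atTop 0] with m hm
      refine ae_of_all _ fun ω hω => ?_
      obtain ⟨h1, h2⟩ := hgood k m hm ω hω
      have hm' : (0 : ℝ) < m := by exact_mod_cast hm
      simp only [enorm_mul, mul_pow]
      rw [lintegral_const_mul' _ _ (by simp), ← mul_assoc,
        mul_right_comm (ENNReal.ofReal _)]
      refine mul_le_mul' ?_ le_rfl
      set g : ℝ := (groupSize (S m ω) k : ℝ) with hg
      have hgm : g ≤ m := Nat.cast_le.2 (groupSize_le (S m ω) k)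
      have h3 : g * (a m (S m ω) k - (√(m : ℝ))⁻¹) ^ 2 ≤ 2 * K * |g / m - 1 / K| := by
        have e1 : g * (a m (S m ω) k - (√(m : ℝ))⁻¹) ^ 2 = (g / m - 1 / K) ^ 2 * (m / g) := by
          have hs : √(m : ℝ) ^ 2 = m := Real.sq_sqrt hm'.le
          have hs0 : 0 < √(m : ℝ) := Real.sqrt_pos.2 hm'
          simp only [a, ← hg]
          generalize √(m : ℝ) = r at hs hs0
          rw [← hs]
          field_simp
          ring
        have e2 : |g / m - 1 / K| ≤ 1 := by
          have b1 : g / m ≤ 1 := (div_le_one hm').2 hgm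
          have b2 : 0 ≤ g / m := by positivity
          have b3 : 1 / (K : ℝ) ≤ 1 := (div_le_one hK0).2 hK1
          have b4 : 0 ≤ 1 / (K : ℝ) := by positivity
          rw [abs_le]; constructor <;> linarith
        have e3 : m / g ≤ 2 * K := by
          rw [div_le_iff₀ h2]
          rwa [div_le_iff₀ (by positivity), mul_comm] at h1
        rw [e1, ← sq_abs, mul_comm]
        refine mul_le_mul e3 ?_ (sq_nonneg _) (by positivity)
        nlinarith [abs_nonneg (g / m - 1 / K)]
      calc (groupSize (S m ω) k : ℝ≥0∞) * ‖a m (S m ω) k - (√(m : ℝ))⁻¹‖ₑ ^ 2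
          = ENNReal.ofReal (g * (a m (S m ω) k - (√(m : ℝ))⁻¹) ^ 2) := by
            rw [ENNReal.ofReal_mul (by positivity), hg, ENNReal.ofReal_natCast,
              Real.enorm_eq_ofReal_abs, ← ENNReal.ofReal_pow (abs_nonneg _), sq_abs]
        _ ≤ _ := by
            rw [Real.enorm_eq_ofReal_abs, ← ENNReal.ofReal_mul (by positivity)]
            exact ENNReal.ofReal_le_ofReal h3
  have hsum := IsLittleOP.sum Finset.univ fun k _ => ((hA k).add (hB k)).add (hbias k)
  have hE : Tendsto (fun m => μ (⋃ k, bad k m)) atTop (𝓝 0) := by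
    have h1 := tendsto_finsetSum Finset.univ fun k (_ : k ∈ Finset.univ) => hbad k
    rw [Finset.sum_const_zero] at h1
    exact tendsto_of_tendsto_of_tendsto_of_le_of_le tendsto_const_nhds h1 (fun _ => zero_le)
      fun m => measure_iUnion_fintype_le _ _
  refine hsum.mono_of_tendsto hE ?_
  filter_upwards [eventually_gt_atTop 0] with m hm
  filter_upwards [ae_all_iff.2 (hfi m)] with ω hω hωE
  have hg : ∀ k, (0 : ℝ) < groupSize (S m ω) k := fun k =>
    (hgood k m hm ω fun hk => hωE (Set.mem_iUnion.2 ⟨k, hk⟩)).2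
  have hint : ∀ k, ∫ o, (f m k (S m ω) (u m ω) (fun j => O j ω) o - f₀ o) ∂P =
      ∫ o, f m k (S m ω) (u m ω) (fun j => O j ω) o ∂P - θ := fun k => by
    rw [integral_sub (hω k) (hf₀2.integrable (by norm_num)), hθ]
  have hkey : √(m : ℝ) * ((1 / (K : ℝ)) * ∑ k : Fin K, (1 / (groupSize (S m ω) k : ℝ)) *
          ∑ i ∈ Finset.univ.filter (fun i => S m ω i = k),
            f m k (S m ω) (u m ω) (fun j => O j ω) (O i ω) - θ) -
        (√(m : ℝ))⁻¹ * ∑ i : Fin m, (f₀ (O i ω) - θ) =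
      ∑ k : Fin K, (∑ i ∈ Finset.univ.filter (fun i => S m ω i = k), a m (S m ω) k *
        (f m k (S m ω) (u m ω) (fun j => O j ω) (O i ω) - f₀ (O i ω) -
          ∫ o, (f m k (S m ω) (u m ω) (fun j => O j ω) o - f₀ o) ∂P) +
        ∑ i ∈ Finset.univ.filter (fun i => S m ω i = k), (a m (S m ω) k - (√(m : ℝ))⁻¹) *
          (f₀ (O i ω) - θ) +
        √(m : ℝ) / K * (∫ o, f m k (S m ω) (u m ω) (fun j => O j ω) o ∂P - θ)) := by
    have hcard : ∀ k, a m (S m ω) k *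
        ((Finset.univ.filter (fun i => S m ω i = k)).card : ℝ) = √(m : ℝ) / K := by
      intro k
      have := hg k
      change √(m : ℝ) / (K * groupSize (S m ω) k) * groupSize (S m ω) k = _
      field_simp
    simp only [hint]
    rw [Finset.sum_congr rfl fun k _ => (sqrt_mul_group_mean_sub_eq
      (Finset.univ.filter fun i => S m ω i = k) (m := m) (K := K) (θ := θ)
      (b := ∫ o, f m k (S m ω) (u m ω) (fun j => O j ω) o ∂P)
      (f := fun i => f m k (S m ω) (u m ω) (fun j => O j ω) (O i ω))
      (f₀ := fun i => f₀ (O i ω)) (hcard k)).symm]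
    have e1 : √(m : ℝ) * θ = ∑ _k : Fin K, √(m : ℝ) / K * θ := by
      rw [Finset.sum_const, Finset.card_univ, Fintype.card_fin, nsmul_eq_mul]
      field_simp
    rw [← Finset.sum_fiberwise Finset.univ (S m ω) fun i => f₀ (O i ω) - θ, mul_sub, e1,
      Finset.mul_sum, Finset.mul_sum, Finset.mul_sum, ← Finset.sum_sub_distrib,
      ← Finset.sum_sub_distrib]
    refine Finset.sum_congr rfl fun k _ => ?_
    congr 2
    have := hg k
    simp only [a]
    field_simp
  rw [hkey]
  refine (enorm_sum_le _ _).trans (Finset.sum_le_sum fun k _ => ?_)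
  refine (enorm_add_le _ _).trans (add_le_add (enorm_add_le _ _) ?_)
  rw [enorm_mul]
  gcongr
  rw [Real.enorm_of_nonneg (by positivity)]
  exact ENNReal.ofReal_le_ofReal (div_le_self (Real.sqrt_nonneg _) hK1)

end AsymptoticLinearity

/-! ### Rates of the variance and of the bias -/

section Rates

variable {d : ℕ} {P : Measure (Obs d)} [IsProbabilityMeasure P] {η : Nuisance d} {c C B : ℝ}
  {M : ℕ} {Ω : Type*} [MeasurableSpace Ω] {μ : Measure Ω}

theorem tendsto_sqrt_mul_zero {f : ℕ → ℝ} (hf : f =o[atTop] fun m => (m : ℝ) ^ (-(1 / 2) : ℝ)) :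
    Tendsto (fun m : ℕ => √(m : ℝ) * f m) atTop (𝓝 0) := by
  refine hf.tendsto_div_nhds_zero.congr fun m => ?_
  rw [Real.rpow_neg (Nat.cast_nonneg m), div_inv_eq_mul, Real.sqrt_eq_rpow, mul_comm]

/-- The fitted influence functions converge in mean square. -/
theorem isLittleOP_influence_sub (h : RegularTruth P η c C M B)
    {ηhat : ℕ → Ω → Nuisance d} (hmeas : ∀ m ω, (ηhat m ω).IsMeasurable)
    (hbdd : ∀ m, ∀ᵐ ω ∂μ, (ηhat m ω).IsBounded P c C) {rG rH rφ rw : ℕ → ℝ}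
    (hH : IsBigOP μ (fun m ω => errH P (ηhat m ω) η) rH)
    (hG : IsBigOP μ (fun m ω => errG P (ηhat m ω) η) rG)
    (hφ : IsBigOP μ (fun m ω => errPhi P (ηhat m ω) η) rφ)
    (hw : IsBigOP μ (fun m ω => errW P (ηhat m ω) η) rw)
    (hrG : Tendsto rG atTop (𝓝 0)) (hrH : Tendsto rH atTop (𝓝 0))
    (hrφ : Tendsto rφ atTop (𝓝 0)) (hrw : Tendsto rw atTop (𝓝 0)) :
    IsLittleOP μ fun m ω => ∫⁻ o, ‖uncenteredEIF (ηhat m ω) o - uncenteredEIF η o‖ₑ ^ 2 ∂P := by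
  have hsum := (((hw.isLittleOP hrw).add ((hφ.isLittleOP hrφ).const_mul (a := 2) (by simp))).add
    (hG.isLittleOP hrG)).add (hH.isLittleOP hrH)
  refine (hsum.const_mul (ENNReal.ofReal_ne_top (r := 4 * (2 ^ M * (2 * C * C) +
    C * (1 + C) / c) * (2 * C + (1 + C) / c + C * (1 + C) / c ^ 2) * (1 + M * B)))).mono
    (Eventually.of_forall fun m => ?_)
  filter_upwards [hbdd m] with ω hω
  exact lintegral_influence_sub_sq_le h (hmeas m ω) hω

/-- The bias of the fitted influence functions is `o_P(m^{-1/2})`. -/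
theorem isLittleOP_sqrt_mul_bias (h : RegularTruth P η c C M B)
    {ηhat : ℕ → Ω → Nuisance d} (hmeas : ∀ m ω, (ηhat m ω).IsMeasurable)
    (hbdd : ∀ m, ∀ᵐ ω ∂μ, (ηhat m ω).IsBounded P c C) {rG rH rφ rw : ℕ → ℝ}
    (hG0 : ∀ m, 0 < rG m) (hH0 : ∀ m, 0 < rH m) (hφ0 : ∀ m, 0 < rφ m)
    (hH : IsBigOP μ (fun m ω => errH P (ηhat m ω) η) rH)
    (hG : IsBigOP μ (fun m ω => errG P (ηhat m ω) η) rG)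
    (hφ : IsBigOP μ (fun m ω => errPhi P (ηhat m ω) η) rφ)
    (hw : IsBigOP μ (fun m ω => errW P (ηhat m ω) η) rw)
    (hrw : Tendsto (fun m : ℕ => √(m : ℝ) * rw m) atTop (𝓝 0))
    (hprod : Tendsto (fun m : ℕ => √(m : ℝ) * (rG m * (rH m + rφ m))) atTop (𝓝 0)) :
    IsLittleOP μ fun m ω => ENNReal.ofReal √m *
      ‖∫ o, uncenteredEIF (ηhat m ω) o ∂P -
        ∫ o, ∑ a : Treat o.N, inner ℝ (η.w o.N a o.X) (η.G o.N a o.X) ∂P‖ₑ := by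
  have hs : ∀ m : ℕ, 0 ≤ √(m : ℝ) := fun m => Real.sqrt_nonneg _
  have h1 : Tendsto (fun m : ℕ => √(m : ℝ) * (rH m * rG m)) atTop (𝓝 0) := by
    refine squeeze_zero (fun m => ?_) (fun m => ?_) hprod
    · have := hG0 m; have := hH0 m; positivity
    · have := hG0 m; have := hφ0 m
      exact mul_le_mul_of_nonneg_left (by nlinarith) (hs m)
  have h2 : Tendsto (fun m : ℕ => √(m : ℝ) * (rφ m * rG m)) atTop (𝓝 0) := by
    refine squeeze_zero (fun m => ?_) (fun m => ?_) hprod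
    · have := hG0 m; have := hφ0 m; positivity
    · have := hG0 m; have := hH0 m
      exact mul_le_mul_of_nonneg_left (by nlinarith) (hs m)
  have k0 := (hw.isLittleOP_mul hs hrw).const_mul (ENNReal.ofReal_ne_top (r := 3 * C))
  have k1 := ((hH.mul hG hH0 hG0).isLittleOP_mul hs h1).const_mul
    (ENNReal.ofReal_ne_top (r := C / c))
  have k2 := (hφ.mul hG hφ0 hG0).isLittleOP_mul hs h2
  refine ((k0.add k1).add k2).mono (Eventually.of_forall fun m => ?_)
  filter_upwards [hbdd m] with ω hω
  refine (mul_le_mul_right (enorm_bias_le h (hmeas m ω) hω) _).trans (le_of_eq ?_)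
  ring

end Rates

/-! ### Asymptotic normality of the cross-fitted estimator -/

section Normality

variable {d K : ℕ}

theorem Learner.IsMeasurable.nuisanceMeasurable {U : Type*} [MeasurableSpace U]
    {L : Learner d K U} (hL : L.IsMeasurable) (m : ℕ) (k : Fin K) (s : Fin m → Fin K) :
    NuisanceMeasurable fun z : U × ({i : Fin m // s i ≠ k} → Obs d) => L m k s z.1 z.2 where
  G n a := (hL.G m k s n a).comp
    (f := fun p : (U × ({i : Fin m // s i ≠ k} → Obs d)) × Cov d n => (p.1.1, p.1.2, p.2))
    (by fun_prop)
  H n a := (hL.H m k s n a).comp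
    (f := fun p : (U × ({i : Fin m // s i ≠ k} → Obs d)) × Cov d n => (p.1.1, p.1.2, p.2))
    (by fun_prop)
  w n a := (hL.w m k s n a).comp
    (f := fun p : (U × ({i : Fin m // s i ≠ k} → Obs d)) × Cov d n => (p.1.1, p.1.2, p.2))
    (by fun_prop)
  φ n a a' := (hL.φ m k s n a a').comp
    (f := fun p : (U × ({i : Fin m // s i ≠ k} → Obs d)) × Cov d n => (p.1.1, p.1.2, p.2))
    (by fun_prop)

theorem Learner.IsMeasurable.measurable_uncenteredEIF {U : Type*} [MeasurableSpace U]
    {L : Learner d K U} (hL : L.IsMeasurable) (m : ℕ) (k : Fin K) (s : Fin m → Fin K) :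
    Measurable fun q : U × ({i : Fin m // s i ≠ k} → Obs d) × Obs d =>
      uncenteredEIF (L m k s q.1 q.2.1) q.2.2 :=
  (hL.nuisanceMeasurable m k s).measurable_uncenteredEIF.comp
    (f := fun q : U × ({i : Fin m // s i ≠ k} → Obs d) × Obs d => ((q.1, q.2.1), q.2.2))
    (by fun_prop)

theorem measurable_crossFit {U : Type*} [MeasurableSpace U]
    {L : Learner d K U} (hL : L.IsMeasurable) (m : ℕ) :
    Measurable fun q : (Fin m → Fin K) × U × (Fin m → Obs d) => crossFit L q.1 q.2.1 q.2.2 := by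
  refine measurable_from_prod_countable_right fun s => ?_
  change Measurable fun q : U × (Fin m → Obs d) => (1 / (K : ℝ)) * ∑ k : Fin K,
    (1 / (groupSize s k : ℝ)) * ∑ i ∈ Finset.univ.filter (fun i => s i = k),
      uncenteredEIF (L m k s q.1 fun j => q.2 j) (q.2 i)
  refine (Finset.measurable_sum _ fun k _ => ?_).const_mul _
  refine (Finset.measurable_sum _ fun i _ => ?_).const_mul _
  exact (hL.measurable_uncenteredEIF m k s).comp (f := fun q : U × (Fin m → Obs d) =>
    (q.1, (fun j : {i : Fin m // s i ≠ k} => q.2 j), q.2 i)) (by fun_prop)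

/-- An asymptotically linear sequence with a square integrable, centred influence function is
asymptotically normal. -/
theorem tendstoInDistribution_of_asymptoticallyLinear {Ω 𝒪 : Type*} [MeasurableSpace Ω]
    [MeasurableSpace 𝒪] {μ : Measure Ω} [IsProbabilityMeasure μ] {P : Measure 𝒪}
    {O : ℕ → Ω → 𝒪} (hO : ∀ i, Measurable (O i))
    (hlaw : ∀ i, μ.map (O i) = P) (hOi : iIndepFun O μ) {f : 𝒪 → ℝ} (hf : Measurable f)
    (hf2 : MemLp f 2 P) (hf0 : ∫ o, f o ∂P = 0) {T : ℕ → Ω → ℝ} (hT : ∀ m, AEMeasurable (T m) μ)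
    (hlin : IsLittleOP μ fun m ω => ‖T m ω - (√(m : ℝ))⁻¹ * ∑ i : Fin m, f (O i ω)‖ₑ) :
    TendstoInDistribution T atTop (id : ℝ → ℝ) (fun _ => μ)
      (gaussianReal 0 (∫ o, f o ^ 2 ∂P).toNNReal) := by
  have hmean : ∫ ω, f (O 0 ω) ∂μ = 0 := by
    rw [← hf0, ← hlaw 0, integral_map (hO 0).aemeasurable hf.aestronglyMeasurable]
  have hvar : variance (fun ω => f (O 0 ω)) μ = ∫ o, f o ^ 2 ∂P := by
    rw [variance_of_integral_eq_zero (X := fun ω => f (O 0 ω))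
      (hf.comp (hO 0)).aemeasurable hmean, ← hlaw 0,
      integral_map (hO 0).aemeasurable (hf.pow_const 2).aestronglyMeasurable]
  have hmem : MemLp (fun ω => f (O 0 ω)) 2 μ :=
    hf2.comp_measurePreserving ⟨hO 0, hlaw 0⟩
  have hclt := tendstoInDistribution_inv_sqrt_mul_sum_sub (X := fun i ω => f (O i ω)) (P := μ)
    (P' := gaussianReal 0 (∫ o, f o ^ 2 ∂P).toNNReal) (Y := id)
    (by rw [hvar]; exact HasLaw.id) hmem (hOi.comp (fun _ => f) fun _ => hf)
    (fun i => IdentDistrib.comp (u := f)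
      ⟨(hO i).aemeasurable, (hO 0).aemeasurable, (hlaw i).trans (hlaw 0).symm⟩ hf)
  simp only [hmean, mul_zero, sub_zero] at hclt
  refine tendstoInDistribution_of_tendstoInMeasure_sub _ _ hclt ?_ hT
  refine IsLittleOP.tendstoInMeasure ?_
  simpa only [Pi.sub_apply, Finset.sum_range] using hlin

end Normality

theorem theorem3
    {d K : ℕ} (hK : 1 ≤ K)
    -- the super population, the weight function and its influence function
    (P : Measure (Obs d)) [IsProbabilityMeasure P]
    (w : Measure (Obs d) → VecFun d) (φ : PhiFun d)
    (hw_meas : ∀ Q n a, Measurable (w Q n a))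
    (hφ_meas : ∀ n a' a, Measurable fun x => φ n a' x a)
    (hφ : IsWeightEIF P w φ)
    -- finite moments of the outcomes and finite cluster size
    (hmoment : ∃ B : ℝ, ∀ j q : ℕ, 1 ≤ q → q ≤ 4 →
      Integrable (fun o : Obs d => o.unitY j ^ q) P ∧
      ∀ᵐ o ∂P, |condAXN P (fun o' => o'.unitY j ^ q) o.N o.A o.X| ≤ B)
    (hsize : ∃ nmax : ℕ, ∀ᵐ o ∂P, o.N ≤ nmax)
    -- the i.i.d. sample, and the random split and seed, which are independent of the sample
    {Ω : Type*} [MeasurableSpace Ω] (μ : Measure Ω) [IsProbabilityMeasure μ]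
    (O : ℕ → Ω → Obs d) (hO_meas : ∀ i, Measurable (O i))
    (hO_law : ∀ i, μ.map (O i) = P) (hO_indep : iIndepFun O μ)
    {U : Type*} [MeasurableSpace U]
    (S : (m : ℕ) → Ω → Fin m → Fin K) (hS_meas : ∀ m, Measurable (S m))
    (u : ℕ → Ω → U) (hu_meas : ∀ m, Measurable (u m))
    (hsplit : ∀ m, IndepFun (fun ω => (S m ω, u m ω)) (fun ω (i : Fin m) => O i ω) μ)
    (hbalance : ∀ k, TendstoInMeasure μ (fun m ω => (groupSize (S m ω) k : ℝ) / m) atTop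
      (fun _ => 1 / (K : ℝ)))
    -- the nuisance estimators
    (L : Learner d K U) (hL : L.IsMeasurable)
    (η : Nuisance d) (hη : η = trueNuisance P w φ)
    (ηhat : (m : ℕ) → Ω → Fin K → Nuisance d)
    (hηhat : ∀ m ω k, ηhat m ω k = fitted L (S m ω) (u m ω) (fun i => O i ω) k)
    -- boundedness
    (c C : ℝ) (hc : 0 < c ∧ c < 1) (hC : 0 < C)
    (hbdd : η.IsBounded P c C)
    (hbdd_hat : ∀ m k, ∀ᵐ ω ∂μ, (ηhat m ω k).IsBounded P c C)
    -- rates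
    (rG rH rφ rw : ℕ → ℝ) (hr : ∀ m, 0 < rG m ∧ 0 < rH m ∧ 0 < rφ m ∧ 0 < rw m)
    (hH_rate : ∀ k, IsBigOP μ (fun m ω => errH P (ηhat m ω k) η) rH)
    (hG_rate : ∀ k, IsBigOP μ (fun m ω => errG P (ηhat m ω k) η) rG)
    (hφ_rate : ∀ k, IsBigOP μ (fun m ω => errPhi P (ηhat m ω k) η) rφ)
    (hw_rate : ∀ k, IsBigOP μ (fun m ω => errW P (ηhat m ω k) η) (fun m => rw m ^ 2))
    (hrG : rG =o[atTop] fun _ => (1 : ℝ))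
    (hrH : rH =o[atTop] fun _ => (1 : ℝ))
    (hrφ : rφ =o[atTop] fun _ => (1 : ℝ))
    (hrw : rw =o[atTop] fun m => (m : ℝ) ^ (-(1 / 4) : ℝ))
    (hprod : (fun m => rG m * (rH m + rφ m)) =o[atTop] fun m => (m : ℝ) ^ (-(1 / 2) : ℝ)) :
    MemLp (centeredEIF P w φ) 2 P ∧
    TendstoInDistribution
      (fun (m : ℕ) ω => √(m : ℝ) *
        (crossFit L (S m ω) (u m ω) (fun i => O i ω) - estimand w P))
      atTop (id : ℝ → ℝ) (fun _ => μ) (gaussianReal 0 (asympVar P w φ).toNNReal) ∧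
    IsEfficiencyBound (estimand w) P (asympVar P w φ) := by
  obtain ⟨B, hB⟩ := hmoment
  obtain ⟨M, hM⟩ := hsize
  have hG : η.G = outcomeReg P := by rw [hη]; rfl
  have hH : η.H = treatProb P := by rw [hη]; rfl
  have hw : η.w = w P := by rw [hη]; rfl
  have hφ' : η.φ = φ := by rw [hη]; rfl
  have h : RegularTruth P η c C M |B| :=
    { G_eq := hG
      H_eq := hH
      meas :=
        { G := fun n a => by rw [hG]; exact (measurable_outcomeReg P n a).comp measurable_snd
          H := fun n a => by rw [hH]; exact (measurable_treatProb P n a).comp measurable_snd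
          w := fun n a => by rw [hw]; exact (hw_meas P n a).comp measurable_snd
          φ := fun n a a' => by rw [hφ']; exact (hφ_meas n a' a).comp measurable_snd }
      c_pos := hc.1
      C_nonneg := hC.le
      B_nonneg := abs_nonneg _
      bdd := hbdd
      size := hM
      int_Y := fun j => by simpa using (hB j 1 le_rfl (by norm_num)).1
      int_Y_sq := fun j => (hB j 2 (by norm_num) (by norm_num)).1
      cond_Y_sq := fun j => (hB j 2 (by norm_num) (by norm_num)).2.mono
        fun o ho => ho.trans (le_abs_self B)
      mean_zero := by rw [hH, hφ']; exact hφ.mean_zero }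
  have hΨ : estimand w P = ∫ o, ∑ a : Treat o.N, inner ℝ (η.w o.N a o.X) (η.G o.N a o.X) ∂P := by
    rw [hw, hG]; rfl
  have hf₀ : Measurable (uncenteredEIF η) := h.meas.measurable_uncenteredEIF
  have hf₀2 : MemLp (uncenteredEIF η) 2 P := memLp_uncenteredEIF h h.meas h.bdd
  have hθ : ∫ o, uncenteredEIF η o ∂P = estimand w P := by
    rw [hΨ, integral_uncenteredEIF_truth h]
  have hcent : centeredEIF P w φ = fun o => uncenteredEIF η o - estimand w P := by
    rw [hη]; rfl
  have hcm : Measurable (centeredEIF P w φ) := by rw [hcent]; exact hf₀.sub_const _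
  have hc2 : MemLp (centeredEIF P w φ) 2 P := by
    rw [hcent]; exact hf₀2.sub (memLp_const _)
  have hc0 : ∫ o, centeredEIF P w φ o ∂P = 0 := by
    rw [hcent, integral_sub (hf₀2.integrable (by norm_num)) (integrable_const _), hθ]
    simp
  refine ⟨hc2, ?_, ?_⟩
  · have hmeas : ∀ m ω k, (ηhat m ω k).IsMeasurable := fun m ω k => by
      rw [hηhat]
      exact (hL.nuisanceMeasurable m k (S m ω)).apply (u m ω, fun i => O i ω)
    have hrw2 : Tendsto (fun m : ℕ => √(m : ℝ) * rw m ^ 2) atTop (𝓝 0) := by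
      refine tendsto_sqrt_mul_zero ((hrw.pow (n := 2) (by norm_num)).congr_right fun m => ?_)
      rw [← Real.rpow_natCast, ← Real.rpow_mul (Nat.cast_nonneg m)]
      norm_num
    have hrw0 : Tendsto (fun m : ℕ => rw m ^ 2) atTop (𝓝 0) := by
      refine squeeze_zero' (Eventually.of_forall fun m => sq_nonneg _) ?_ hrw2
      filter_upwards [eventually_ge_atTop 1] with m hm
      exact le_mul_of_one_le_left (sq_nonneg _) (Real.one_le_sqrt.2 (by exact_mod_cast hm))
    have hfit : ∀ m ω k, L m k (S m ω) (u m ω) (fun j => O j ω) = ηhat m ω k := fun m ω k =>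
      (hηhat m ω k).symm
    refine tendstoInDistribution_of_asymptoticallyLinear hO_meas hO_law hO_indep hcm hc2 hc0
      (fun m => ?_) ?_
    · exact ((((measurable_crossFit hL m).comp (f := fun ω => (S m ω, u m ω, fun i : Fin m =>
        O i ω)) ((hS_meas m).prodMk ((hu_meas m).prodMk
          (measurable_pi_lambda _ fun i => hO_meas i)))).sub_const _).const_mul _).aemeasurable
    · rw [hcent]
      refine isLittleOP_crossFit_sub hK hS_meas hu_meas hO_meas hO_law hO_indep hsplit hbalance
        (f := fun m k s v x => uncenteredEIF (L m k s v x)) hL.measurable_uncenteredEIF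
        (fun m k => ?_) hf₀ hf₀2 hθ (fun k => ?_) (fun k => ?_)
      · filter_upwards [hbdd_hat m k] with ω hω
        rw [hfit]
        exact (memLp_uncenteredEIF h (hmeas m ω k) hω).integrable (by norm_num)
      · simp only [hfit]
        exact isLittleOP_influence_sub h (fun m ω => hmeas m ω k) (fun m => hbdd_hat m k)
          (hH_rate k) (hG_rate k) (hφ_rate k) (hw_rate k) ((isLittleO_one_iff ℝ).1 hrG)
          ((isLittleO_one_iff ℝ).1 hrH) ((isLittleO_one_iff ℝ).1 hrφ) hrw0
      · simp only [hfit]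
        rw [hΨ]
        exact isLittleOP_sqrt_mul_bias h (fun m ω => hmeas m ω k) (fun m => hbdd_hat m k)
          (fun m => (hr m).1) (fun m => (hr m).2.1) (fun m => (hr m).2.2.1) (hH_rate k)
          (hG_rate k) (hφ_rate k) (hw_rate k) hrw2 (tendsto_sqrt_mul_zero hprod)
  · have hderiv : ∀ g, IsScore P g → HasDerivAt (fun ε => estimand w (submodel P g ε))
        (∫ o, centeredEIF P w φ o * g o ∂P) 0 := fun g hg => by
      rw [← integral_estimandScore h hη hg]
      exact hasDerivAt_estimand h hη hw_meas hφ hg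
    obtain ⟨g₀, hg₀, hg₀2⟩ := exists_score_pos (P := P) hc.1 (by
      filter_upwards [hbdd] with o ho a
      rw [← hH]
      exact (ho a a).1)
    refine ⟨fun g hg => (hderiv g hg).differentiableAt, ?_⟩
    have hset : {b : ℝ | ∃ g, IsScore P g ∧ 0 < ∫ o, g o ^ 2 ∂P ∧
        b = deriv (fun ε => estimand w (submodel P g ε)) 0 ^ 2 / ∫ o, g o ^ 2 ∂P} =
        {b : ℝ | ∃ g, IsScore P g ∧ 0 < ∫ o, g o ^ 2 ∂P ∧
          b = (∫ o, centeredEIF P w φ o * g o ∂P) ^ 2 / ∫ o, g o ^ 2 ∂P} := by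
      ext b
      refine exists_congr fun g => and_congr_right fun hg => ?_
      rw [(hderiv g hg).deriv]
    rw [hset]
    exact isLUB_cramerRao hcm hc2 hc0 hg₀ hg₀2
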